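/- **Theorem 4.6.** Let $p$ and $q$ be distinct primes with $p\equiv 1\pmod 8$ and $q\equiv 1\pmod 8$. Suppose that $p=c^2+d^2=x^2+2qy^2$ and $q=a^2+b^2$ with $a,b,c,d,x,y\in\mathbb Z$, where $c\equiv 1\pmod 4$ and $d=2^r d_0$ for some integers $r\ge 0$ and $d_0$ with $d_0\equiv 1\pmod 4$. Assume that $\gcd(c,x+d)=1$ or $\gcd(d_0,x+c)=1$. Then for every integer $m$, $$(-q)^{\frac{p-1}{8}}\equiv(-1)^{\frac d4+\frac y2}\left(\frac dc\right)^m \pmod p \quad\Longleftrightarrow\quad \left(\frac{ac+bd}{ac-bd}\right)^{\frac{q-1}{8}}\equiv\left(\frac ba\right)^m \pmod q,$$ where the fractions in parentheses denote quotients of residue classes in the fields $\mathbb Z/p\mathbb Z$ and $\mathbb Z/q\mathbb Z$ (they are not Legendre symbols). The hypotheses imply that $4\mid d$, $2\mid y$, $p\nmid c$, $q\nmid a$ and $q\nmid ac-bd$, so all expressions are defined. -/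

import Mathlib

/-! Put π = c + di, so that N(π) = p, and let χ_α be the quartic residue symbol modulo an odd
Gaussian integer α. Both sides of the equivalence become statements about a power of i built from
χ_x(π) and χ_{y₀}(π), where y₀ is the odd part of y.

Modulo π the unit i becomes d/c, and x² ≡ -2qy² reads ((1-i)y)² · (-iq) ≡ x². The power (p-1)/8 of
this expresses (-q)^((p-1)/8) through χ_π(x), χ_π(y) and χ_π(1-i), and reciprocity inverts the
symbols of x and y₀ (`neg_pow_eq_map_iPow`).

Modulo ϖ = a + bi the unit i becomes b/a and the quotient becomes π/π̄. Since ππ̄ = p ≡ x² modulo q,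
its power of exponent (q-1)/8 is χ_ϖ(π/x). If α = π + x then αx ≡ πᾱ modulo q, and if α = π + ix
then αx ≡ iπᾱ. So, up to a power of χ_ϖ(i), the value is χ_ϖ(α)/χ_ϖ(ᾱ) = χ_q(α)
(`exists_div_pow_eq_map_iPow`).

To compute χ_q(α) for α = π + x, use N(α) = 2x(x+c) + 2qy². Modulo the odd part of α this determines
q through x, x+c, y and 2. Reciprocity moves the symbols to rational moduli, where α ≡ π modulo x, α
≡ di modulo x+c, and α² ≡ 2(x+c)π modulo y. Again χ_x(π)/χ_{y₀}(π) appears, times an explicit power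
of i coming from the prime above 2. The case α = π + ix is the same with x+d in place of x+c. Each
gcd hypothesis provides the coprimality needed for one choice of α. Comparing exponents modulo 4
ends the proof.

The reciprocity used is the one between a rational integer n ≡ 1 modulo 4 and a Gaussian integer
(`quarticSym_reciprocity`). It follows from the Gauss sum identity G⁴ = ϖ³ϖ̄ (`gaussSum_pow_four`)
and the Frobenius action on G. The supplements are `quarticSym_mk_two` and
`quarticSym_mk_one_sub_i`. -/

namespace QuarticSymbol

/-! ### Powers of i and norms of Gaussian integers. -/

/-- The unit `i` of the Gaussian integers. -/
def iUnit : GaussianIntˣ := ⟨⟨0, 1⟩, ⟨0, -1⟩, by decide, by decide⟩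

/-- The power `i ^ k` of the imaginary unit, for an integer `k`. -/
def iPow (k : ℤ) : GaussianInt := ((iUnit ^ k : GaussianIntˣ) : GaussianInt)

lemma iPow_zero : iPow 0 = 1 := by simp [iPow]

lemma iPow_one : iPow 1 = ⟨0, 1⟩ := by simp [iPow, iUnit]

lemma iPow_add (a b : ℤ) : iPow (a + b) = iPow a * iPow b := by
  simp [iPow, zpow_add]

lemma iUnit_pow_four : iUnit ^ (4 : ℤ) = 1 := by
  ext <;> decide

lemma iPow_congr {a b : ℤ} (h : a ≡ b [ZMOD 4]) : iPow a = iPow b := by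
  obtain ⟨k, hk⟩ := h.dvd
  have : b = a + 4 * k := by omega
  rw [this, iPow, iPow, zpow_add, zpow_mul, iUnit_pow_four, one_zpow, mul_one]

lemma iPow_two : iPow 2 = -1 := by
  rw [show (2 : ℤ) = 1 + 1 by norm_num, iPow_add, iPow_one]; decide

lemma iPow_three : iPow 3 = ⟨0, -1⟩ := by
  rw [show (3 : ℤ) = 1 + 2 by norm_num, iPow_add, iPow_one, iPow_two]; decide

lemma iPow_mul (a : ℤ) (n : ℕ) : iPow (a * n) = iPow a ^ n := by
  simp [iPow, zpow_mul]

lemma isUnit_iPow (k : ℤ) : IsUnit (iPow k) := Units.isUnit _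

lemma iPow_ne_zero (k : ℤ) : iPow k ≠ 0 := (isUnit_iPow k).ne_zero

lemma iPow_cases (k : ℤ) : (k % 4 = 0 ∧ iPow k = 1) ∨ (k % 4 = 1 ∧ iPow k = ⟨0, 1⟩) ∨
    (k % 4 = 2 ∧ iPow k = -1) ∨ (k % 4 = 3 ∧ iPow k = ⟨0, -1⟩) := by
  have h : k % 4 = 0 ∨ k % 4 = 1 ∨ k % 4 = 2 ∨ k % 4 = 3 := by omega
  rcases h with h | h | h | h
  · exact .inl ⟨h, (iPow_congr (b := 0) h).trans iPow_zero⟩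
  · exact .inr (.inl ⟨h, (iPow_congr (b := 1) h).trans iPow_one⟩)
  · exact .inr (.inr (.inl ⟨h, (iPow_congr (b := 2) h).trans iPow_two⟩))
  · exact .inr (.inr (.inr ⟨h, (iPow_congr (b := 3) h).trans iPow_three⟩))

lemma iPow_inj {a b : ℤ} (h : iPow a = iPow b) : a ≡ b [ZMOD 4] := by
  rcases iPow_cases a with ⟨ha, ha'⟩ | ⟨ha, ha'⟩ | ⟨ha, ha'⟩ | ⟨ha, ha'⟩ <;>
  rcases iPow_cases b with ⟨hb, hb'⟩ | ⟨hb, hb'⟩ | ⟨hb, hb'⟩ | ⟨hb, hb'⟩ <;>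
  rw [ha', hb'] at h <;> first | exact ha.trans hb.symm | (exact absurd h (by decide))

lemma star_iPow (k : ℤ) : star (iPow k) = iPow (-k) := by
  rcases iPow_cases k with ⟨ha, ha'⟩ | ⟨ha, ha'⟩ | ⟨ha, ha'⟩ | ⟨ha, ha'⟩ <;>
  rcases iPow_cases (-k) with ⟨hb, hb'⟩ | ⟨hb, hb'⟩ | ⟨hb, hb'⟩ | ⟨hb, hb'⟩ <;>
  rw [ha', hb'] <;> first | omega | decide

lemma exists_iPow_of_isUnit {u : GaussianInt} (h : IsUnit u) : ∃ k, u = iPow k := by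
  have h1 : u.norm = 1 := (Zsqrtd.norm_eq_one_iff' (by norm_num) u).2 h
  rw [Zsqrtd.norm_def] at h1
  obtain ⟨x, y⟩ := u
  simp only at h1
  have hx : -1 ≤ x ∧ x ≤ 1 := by constructor <;> nlinarith [sq_nonneg x, sq_nonneg y]
  have hy : -1 ≤ y ∧ y ≤ 1 := by constructor <;> nlinarith [sq_nonneg x, sq_nonneg y]
  obtain ⟨hx1, hx2⟩ := hx
  obtain ⟨hy1, hy2⟩ := hy
  interval_cases x <;> interval_cases y <;> norm_num at h1
  · exact ⟨2, by rw [iPow_two]; rfl⟩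
  · exact ⟨3, by rw [iPow_three]⟩
  · exact ⟨1, by rw [iPow_one]⟩
  · exact ⟨0, by rw [iPow_zero]; rfl⟩

lemma norm_mod_four {z : GaussianInt} (h : Odd z.norm) : z.norm % 4 = 1 := by
  obtain ⟨x, y⟩ := z
  have e : Zsqrtd.norm (⟨x, y⟩ : GaussianInt) = x * x + y * y := by rw [Zsqrtd.norm_def]; ring
  rw [Int.odd_iff, e] at h
  rw [e]
  rcases Int.even_or_odd' x with ⟨a, rfl | rfl⟩ <;> rcases Int.even_or_odd' y with ⟨b, rfl | rfl⟩
  · rw [show 2 * a * (2 * a) + 2 * b * (2 * b) = 2 * (2 * (a * a + b * b)) by ring] at h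
    omega
  · rw [show 2 * a * (2 * a) + (2 * b + 1) * (2 * b + 1) = 4 * (a * a + b * b + b) + 1 by ring]
    omega
  · rw [show (2 * a + 1) * (2 * a + 1) + 2 * b * (2 * b) = 4 * (a * a + b * b + a) + 1 by ring]
    omega
  · rw [show (2 * a + 1) * (2 * a + 1) + (2 * b + 1) * (2 * b + 1) =
      2 * (2 * (a * a + b * b + a + b) + 1) by ring] at h
    omega

lemma norm_natAbs_sub_one {z : GaussianInt} (h : Odd z.norm) :
    4 * ((z.norm.natAbs - 1) / 4) = z.norm.natAbs - 1 := by
  have := norm_mod_four h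
  have := GaussianInt.norm_nonneg z
  omega

lemma natAbs_norm_star (z : GaussianInt) : (star z).norm = z.norm := Zsqrtd.norm_conj z

lemma norm_dvd_norm {a b : GaussianInt} (h : a ∣ b) : a.norm ∣ b.norm := by
  obtain ⟨c, rfl⟩ := h
  exact ⟨c.norm, Zsqrtd.norm_mul _ _⟩

/-! ### Odd Gaussian primes, their residue fields and Fermat's theorem. -/

/-- An odd Gaussian prime has norm a rational prime congruent to `1` modulo `4`, or is
associated to a rational prime congruent to `3`. -/
lemma prime_cases {ϖ : GaussianInt} (hϖ : Prime ϖ) (hodd : Odd ϖ.norm) :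
    (∃ p : ℕ, p.Prime ∧ p % 4 = 1 ∧ ϖ.norm = p) ∨
      (∃ l : ℕ, l.Prime ∧ l % 4 = 3 ∧ Associated ϖ (l : GaussianInt)) := by
  -- The prime ϖ divides its norm, hence some rational prime l. Then N(ϖ) divides l², which leaves l
  -- (split) and l² (inert).
  have hN : ϖ ∣ ((ϖ.norm.natAbs : ℕ) : GaussianInt) := by
    have : ((ϖ.norm.natAbs : ℕ) : GaussianInt) = ((ϖ.norm : ℤ) : GaussianInt) := by
      rw [← Int.cast_natCast, GaussianInt.abs_natCast_norm]
    rw [this, Zsqrtd.norm_eq_mul_conj]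
    exact dvd_mul_right _ _
  have key : ∃ l : ℕ, l.Prime ∧ ϖ ∣ (l : GaussianInt) := by
    have h0 : ϖ.norm.natAbs ≠ 0 := by
      rw [Int.natAbs_ne_zero]; rintro h; rw [h] at hodd; revert hodd; decide
    rw [← Nat.prod_primeFactorsList h0, Nat.cast_list_prod] at hN
    obtain ⟨m, hm, hd⟩ := (Prime.dvd_prod_iff hϖ).1 hN
    obtain ⟨l, hl, rfl⟩ := List.mem_map.1 hm
    exact ⟨l, Nat.prime_of_mem_primeFactorsList hl, hd⟩
  obtain ⟨l, hl, hd⟩ := key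
  have h2 : ϖ.norm.natAbs ∣ l ^ 2 := by
    have := norm_dvd_norm hd
    rw [Zsqrtd.norm_natCast] at this
    have := Int.natAbs_dvd_natAbs.2 this
    rwa [Int.natAbs_mul, Int.natAbs_natCast, ← pow_two] at this
  have h4 := norm_mod_four hodd
  have hnn := GaussianInt.norm_nonneg ϖ
  obtain ⟨k, hk, hk'⟩ := (Nat.dvd_prime_pow hl).1 h2
  interval_cases k
  · exfalso
    rw [pow_zero] at hk'
    exact hϖ.not_isUnit (Zsqrtd.norm_eq_one_iff.1 hk')
  · left
    rw [pow_one] at hk'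
    exact ⟨l, hl, by omega, by omega⟩
  · right
    have hassoc : Associated ϖ (l : GaussianInt) := by
      obtain ⟨c, hc⟩ := hd
      have hn : ϖ.norm = (l : ℤ) * l := by
        have : (ϖ.norm.natAbs : ℤ) = ((l ^ 2 : ℕ) : ℤ) := by rw [hk']
        rw [GaussianInt.abs_natCast_norm] at this
        rw [this]; push_cast; ring
      have h1 := congrArg Zsqrtd.norm hc
      rw [Zsqrtd.norm_natCast, Zsqrtd.norm_mul, hn] at h1
      have hl0 : (l : ℤ) * l ≠ 0 := by
        have := hl.ne_zero; positivity
      have hc1 : c.norm = 1 := (mul_right_eq_self₀.1 h1.symm).resolve_right hl0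
      have hu : IsUnit c := (Zsqrtd.norm_eq_one_iff' (by norm_num) c).1 hc1
      exact ⟨hu.unit, by rw [hc]; rfl⟩
    refine ⟨l, hl, ?_, hassoc⟩
    have : Fact l.Prime := ⟨hl⟩
    exact GaussianInt.mod_four_eq_three_of_nat_prime_of_prime l (hassoc.prime hϖ)

/-- A ring homomorphism to a nontrivial ring that kills a prime has kernel that prime ideal. -/
lemma map_eq_zero_iff_dvd {K : Type*} [CommRing K] [Nontrivial K] {ϖ : GaussianInt} (hϖ : Prime ϖ)
    (f : GaussianInt →+* K) (h0 : f ϖ = 0) (z : GaussianInt) : f z = 0 ↔ ϖ ∣ z := by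
  constructor
  · intro hz
    by_contra hd
    obtain ⟨u, v, huv⟩ := (hϖ.irreducible.coprime_iff_not_dvd).2 hd
    have := congrArg f huv
    rw [map_add, map_mul, map_mul, h0, hz, mul_zero, mul_zero, add_zero, map_one] at this
    exact zero_ne_one this
  · rintro ⟨c, rfl⟩
    rw [map_mul, h0, zero_mul]

/-- For a prime `p = a² + b²`, the reduction `ℤ[i] → ℤ/p` modulo `a + bi`. -/
lemma exists_hom_zmod {p : ℕ} [Fact p.Prime] {ϖ : GaussianInt} (hN : ϖ.norm = p) :
    (ϖ.re : ZMod p) ≠ 0 ∧ ∃ f : GaussianInt →+* ZMod p,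
      (f ⟨0, 1⟩ = (ϖ.im : ZMod p) / (ϖ.re : ZMod p)) ∧ f ϖ = 0 := by
  have hp : p.Prime := Fact.out
  have hN' : (p : ℤ) = ϖ.re ^ 2 + ϖ.im ^ 2 := by rw [← hN, Zsqrtd.norm_def]; ring
  have hz : (ϖ.re : ZMod p) ^ 2 + (ϖ.im : ZMod p) ^ 2 = 0 := by
    have := congrArg (Int.cast : ℤ → ZMod p) hN'
    push_cast at this
    rw [← this, ZMod.natCast_self]
  have h0 : (ϖ.re : ZMod p) ≠ 0 := by
    intro h
    have h' : (ϖ.im : ZMod p) = 0 := by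
      rw [h] at hz; simpa using hz
    rw [ZMod.intCast_zmod_eq_zero_iff_dvd] at h h'
    obtain ⟨s, hs⟩ := h
    obtain ⟨t, ht⟩ := h'
    rw [hs, ht] at hN'
    have hp0 : (p : ℤ) ≠ 0 := by exact_mod_cast hp.ne_zero
    have : (1 : ℤ) = p * (s ^ 2 + t ^ 2) := by
      apply mul_left_cancel₀ hp0; linear_combination hN'
    have h1 : (p : ℤ) ∣ 1 := ⟨_, this⟩
    have := Int.natCast_dvd_natCast.1 (show (p : ℤ) ∣ (1 : ℕ) by simpa using h1)
    exact hp.one_lt.ne' (Nat.dvd_one.1 this)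
  refine ⟨h0, Zsqrtd.lift ⟨(ϖ.im : ZMod p) / ϖ.re, ?_⟩, ?_, ?_⟩
  · field_simp; push_cast; linear_combination hz
  · simp [Zsqrtd.lift]
  · simp only [Zsqrtd.lift, Equiv.coe_fn_mk, RingHom.coe_mk, MonoidHom.coe_mk, OneHom.coe_mk]
    field_simp; linear_combination hz

lemma prime_of_norm_prime {p : ℕ} (hp : p.Prime) {ϖ : GaussianInt} (hN : ϖ.norm = p) :
    Prime ϖ := by
  rw [← irreducible_iff_prime, irreducible_iff]
  have hu : ∀ z : GaussianInt, z.norm.natAbs = 1 → IsUnit z := fun z => Zsqrtd.norm_eq_one_iff.1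
  refine ⟨fun h => ?_, fun a b hab => ?_⟩
  · have := Zsqrtd.norm_eq_one_iff.2 h
    rw [hN] at this
    exact hp.one_lt.ne' (by simpa using this)
  · have h1 := congrArg Int.natAbs (congrArg Zsqrtd.norm hab)
    rw [Zsqrtd.norm_mul, hN, Int.natAbs_mul, Int.natAbs_natCast] at h1
    rcases (Nat.prime_mul_iff.1 (h1 ▸ hp)) with h | h
    · exact .inr (hu _ h.2)
    · exact .inl (hu _ h.2)

/-- The Frobenius of an inert prime is complex conjugation: the l-th power is additive modulo l,
fixes rational integers, and sends i to i³ = -i. -/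
lemma inert_pow_dvd {l : ℕ} (hl : l.Prime) (h3 : l % 4 = 3) (β : GaussianInt) :
    (l : GaussianInt) ∣ β ^ l - star β := by
  have := Fact.mk hl
  obtain ⟨a, b⟩ := β
  have h1 : (l : GaussianInt) ∣ (⟨a, b⟩ : GaussianInt) ^ l - ((a : GaussianInt) ^ l +
      ((⟨0, 1⟩ : GaussianInt) * b) ^ l) := by
    obtain ⟨r, hr⟩ := exists_add_pow_prime_eq hl (a : GaussianInt) ((⟨0, 1⟩ : GaussianInt) * b)
    have e : (⟨a, b⟩ : GaussianInt) = (a : GaussianInt) + (⟨0, 1⟩ : GaussianInt) * b := by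
      ext <;> simp
    rw [e, hr]
    exact ⟨a * (⟨0, 1⟩ * b) * r, by ring⟩
  have h2 : ∀ m : ℤ, (l : GaussianInt) ∣ (m : GaussianInt) ^ l - m := by
    intro m
    have : (l : ℤ) ∣ m ^ l - m := by
      rw [← ZMod.intCast_zmod_eq_zero_iff_dvd]
      push_cast
      rw [ZMod.pow_card, sub_self]
    obtain ⟨c, hc⟩ := this
    exact ⟨c, by have := congrArg (Int.cast : ℤ → GaussianInt) hc; push_cast at this; exact this⟩
  have h3' : (⟨0, 1⟩ : GaussianInt) ^ l = ⟨0, -1⟩ := by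
    rw [← iPow_one, ← iPow_mul, ← iPow_three]
    apply iPow_congr
    show (1 * (l : ℤ)) % 4 = 3 % 4
    omega
  have e2 : star (⟨a, b⟩ : GaussianInt) = (a : GaussianInt) + (⟨0, -1⟩ : GaussianInt) * b := by
    ext <;> simp
  rw [e2]
  have : (⟨a, b⟩ : GaussianInt) ^ l - ((a : GaussianInt) + (⟨0, -1⟩ : GaussianInt) * b) =
      ((⟨a, b⟩ : GaussianInt) ^ l - ((a : GaussianInt) ^ l +
      ((⟨0, 1⟩ : GaussianInt) * b) ^ l)) + ((a : GaussianInt) ^ l - a) +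
      (⟨0, -1⟩ : GaussianInt) * ((b : GaussianInt) ^ l - b) := by
    rw [mul_pow, h3']; ring
  rw [this]
  exact dvd_add (dvd_add h1 (h2 a)) (Dvd.dvd.mul_left (h2 b) _)

lemma associated_natAbs_norm {a b : GaussianInt} (h : Associated a b) :
    a.norm.natAbs = b.norm.natAbs := by
  rw [Zsqrtd.norm_eq_of_associated (by norm_num) h]

/-- Fermat's little theorem modulo an odd Gaussian prime. -/
lemma fermat {ϖ : GaussianInt} (hϖ : Prime ϖ) (hodd : Odd ϖ.norm) {β : GaussianInt}
    (hβ : ¬ ϖ ∣ β) : ϖ ∣ β ^ (ϖ.norm.natAbs - 1) - 1 := by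
  rcases prime_cases hϖ hodd with ⟨p, hp, -, hN⟩ | ⟨l, hl, h3, ha⟩
  · have := Fact.mk hp
    obtain ⟨-, f, -, hf⟩ := exists_hom_zmod hN
    rw [← map_eq_zero_iff_dvd hϖ f hf] at hβ ⊢
    rw [map_sub, map_pow, map_one, hN, Int.natAbs_natCast, ZMod.pow_card_sub_one_eq_one hβ, sub_self]
  · rw [associated_natAbs_norm ha, ha.dvd_iff_dvd_left]
    rw [ha.dvd_iff_dvd_left] at hβ
    have hlp : Prime (l : GaussianInt) := ha.prime hϖ
    -- Two applications of Frobenius give β^(l²) ≡ β, and β can be cancelled.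
    have h1 := inert_pow_dvd hl h3 β
    have h2 : (l : GaussianInt) ∣ (β ^ l) ^ l - (star β) ^ l := h1.trans (sub_dvd_pow_sub_pow _ _ _)
    have h4 := inert_pow_dvd hl h3 (star β)
    rw [star_star] at h4
    have h5 := dvd_add h2 h4
    have hn : (Zsqrtd.norm (l : GaussianInt)).natAbs = l * l := by
      rw [Zsqrtd.norm_natCast, Int.natAbs_mul, Int.natAbs_natCast]
    rw [hn]
    have hl1 : 1 ≤ l * l := Nat.one_le_iff_ne_zero.2 (by have := hl.ne_zero; positivity)
    have e : (β ^ l) ^ l - star β ^ l + (star β ^ l - β) = β * (β ^ (l * l - 1) - 1) := by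
      rw [← pow_mul]
      conv_lhs => rw [show l * l = (l * l - 1) + 1 by omega, pow_succ]
      ring
    rw [e] at h5
    exact (hlp.dvd_mul.1 h5).resolve_left hβ

/-! ### The quartic symbol modulo an odd Gaussian prime. -/

/-- Two distinct powers of i differ by an element whose norm divides 4, which no odd prime can
divide. This makes the value of the symbol unique. -/
lemma not_dvd_iPow_sub {ϖ : GaussianInt} (hϖ : Prime ϖ) (hodd : Odd ϖ.norm) {a b : ℤ}
    (h : ϖ ∣ iPow a - iPow b) : a ≡ b [ZMOD 4] := by
  by_contra hab
  have hpow : ∀ z : GaussianInt, z.norm ∣ 4 → ¬ ϖ ∣ z := by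
    intro z hz hd
    have h1 := (norm_dvd_norm hd).trans hz
    have h2 : IsCoprime ϖ.norm (4 : ℤ) := by
      rw [show (4 : ℤ) = 2 ^ 2 by norm_num]
      obtain ⟨k, hk⟩ := hodd
      exact IsCoprime.pow_right ⟨1, -k, by rw [hk]; ring⟩
    have h3 : IsUnit ϖ.norm := h2.isUnit_of_dvd h1
    exact hϖ.not_isUnit ((Zsqrtd.isUnit_iff_norm_isUnit ϖ).2 h3)
  refine hpow _ ?_ h
  rcases iPow_cases a with ⟨ha, ha'⟩ | ⟨ha, ha'⟩ | ⟨ha, ha'⟩ | ⟨ha, ha'⟩ <;>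
  rcases iPow_cases b with ⟨hb, hb'⟩ | ⟨hb, hb'⟩ | ⟨hb, hb'⟩ | ⟨hb, hb'⟩ <;>
  rw [ha', hb'] <;> first | (exfalso; exact hab (ha.trans hb.symm)) | decide

/-- Over ℤ[i] the polynomial z⁴ - 1 splits into the four factors z - i^k. -/
lemma exists_dvd_sub_iPow {ϖ : GaussianInt} (hϖ : Prime ϖ) {z : GaussianInt}
    (h : ϖ ∣ z ^ 4 - 1) : ∃ k : ℤ, ϖ ∣ z - iPow k := by
  have e : z ^ 4 - 1 = (z - 1) * ((z + 1) * ((z - ⟨0, 1⟩) * (z - ⟨0, -1⟩))) := by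
    have h1 : (⟨0, -1⟩ : GaussianInt) = -⟨0, 1⟩ := by decide
    have h2 : (⟨0, 1⟩ : GaussianInt) ^ 2 = -1 := by decide
    rw [h1]; linear_combination (z ^ 2 - 1) * h2
  rw [e] at h
  rcases hϖ.dvd_mul.1 h with h | h
  · exact ⟨0, by rwa [iPow_zero]⟩
  rcases hϖ.dvd_mul.1 h with h | h
  · exact ⟨2, by rwa [iPow_two, sub_neg_eq_add]⟩
  rcases hϖ.dvd_mul.1 h with h | h
  · exact ⟨1, by rwa [iPow_one]⟩
  · exact ⟨3, by rwa [iPow_three]⟩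

open Classical in
/-- Some power `i ^ k` whose exponent satisfies `P`, or `0` if there is none. -/
noncomputable def chooseIPow (P : ℤ → Prop) : GaussianInt :=
  if h : ∃ k, P k then iPow h.choose else 0

/-- The quartic residue symbol of `β` modulo an odd Gaussian prime `ϖ`: the power of `i`
congruent to `β ^ ((N ϖ - 1) / 4)`, or `0` if `ϖ ∣ β`. -/
noncomputable def primeSym (ϖ β : GaussianInt) : GaussianInt :=
  chooseIPow fun k => ϖ ∣ β ^ ((ϖ.norm.natAbs - 1) / 4) - iPow k

lemma primeSym_eq {ϖ β : GaussianInt} (hϖ : Prime ϖ) (hodd : Odd ϖ.norm) {k : ℤ}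
    (h : ϖ ∣ β ^ ((ϖ.norm.natAbs - 1) / 4) - iPow k) : primeSym ϖ β = iPow k := by
  have hex : ∃ k : ℤ, ϖ ∣ β ^ ((ϖ.norm.natAbs - 1) / 4) - iPow k := ⟨k, h⟩
  rw [primeSym, chooseIPow, dif_pos hex]
  apply iPow_congr
  apply not_dvd_iPow_sub hϖ hodd
  have := dvd_sub h hex.choose_spec
  rwa [sub_sub_sub_cancel_left] at this

/-- With exponent 0 Euler's criterion would give 1, not 0, for multiples of ϖ. -/
lemma norm_pos_exponent {ϖ : GaussianInt} (hϖ : Prime ϖ) (hodd : Odd ϖ.norm) :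
    (ϖ.norm.natAbs - 1) / 4 ≠ 0 := by
  intro h
  have h1 := norm_natAbs_sub_one hodd
  have h2 := norm_mod_four hodd
  have : ϖ.norm.natAbs = 1 := by omega
  exact hϖ.not_isUnit (Zsqrtd.norm_eq_one_iff.1 this)

lemma primeSym_eq_zero {ϖ β : GaussianInt} (hϖ : Prime ϖ) (hodd : Odd ϖ.norm) (h : ϖ ∣ β) :
    primeSym ϖ β = 0 := by
  rw [primeSym, chooseIPow, dif_neg]
  rintro ⟨k, hk⟩
  have h1 : ϖ ∣ β ^ ((ϖ.norm.natAbs - 1) / 4) := dvd_pow h (norm_pos_exponent hϖ hodd)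
  have := (dvd_sub_right h1).1 hk
  exact hϖ.not_isUnit (isUnit_of_dvd_unit this (isUnit_iPow k))

lemma primeSym_spec {ϖ β : GaussianInt} (hϖ : Prime ϖ) (hodd : Odd ϖ.norm) (h : ¬ ϖ ∣ β) :
    ∃ k : ℤ, primeSym ϖ β = iPow k ∧ ϖ ∣ β ^ ((ϖ.norm.natAbs - 1) / 4) - iPow k := by
  have h1 := fermat hϖ hodd h
  rw [← norm_natAbs_sub_one hodd, mul_comm, pow_mul] at h1
  obtain ⟨k, hk⟩ := exists_dvd_sub_iPow hϖ h1
  exact ⟨k, primeSym_eq hϖ hodd hk, hk⟩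

/-- Euler's criterion for the quartic symbol. -/
lemma dvd_pow_sub_primeSym {ϖ : GaussianInt} (hϖ : Prime ϖ) (hodd : Odd ϖ.norm) (β : GaussianInt) :
    ϖ ∣ β ^ ((ϖ.norm.natAbs - 1) / 4) - primeSym ϖ β := by
  by_cases h : ϖ ∣ β
  · rw [primeSym_eq_zero hϖ hodd h, sub_zero]
    exact dvd_pow h (norm_pos_exponent hϖ hodd)
  · obtain ⟨k, hk, hd⟩ := primeSym_spec hϖ hodd h
    rwa [hk]

lemma primeSym_congr {ϖ β γ : GaussianInt} (h : ϖ ∣ β - γ) : primeSym ϖ β = primeSym ϖ γ := by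
  have : ∀ k, ϖ ∣ β ^ ((ϖ.norm.natAbs - 1) / 4) - iPow k ↔
      ϖ ∣ γ ^ ((ϖ.norm.natAbs - 1) / 4) - iPow k := by
    intro k
    have h1 : ϖ ∣ β ^ ((ϖ.norm.natAbs - 1) / 4) - γ ^ ((ϖ.norm.natAbs - 1) / 4) :=
      h.trans (sub_dvd_pow_sub_pow _ _ _)
    rw [← dvd_add_right (c := γ ^ ((ϖ.norm.natAbs - 1) / 4) - iPow k) h1, sub_add_sub_cancel]
  simp only [primeSym, this]

lemma primeSym_associated {ϖ ϖ' : GaussianInt} (h : Associated ϖ ϖ') (β : GaussianInt) :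
    primeSym ϖ β = primeSym ϖ' β := by
  simp only [primeSym, associated_natAbs_norm h, h.dvd_iff_dvd_left]

lemma primeSym_mul {ϖ : GaussianInt} (hϖ : Prime ϖ) (hodd : Odd ϖ.norm) (β γ : GaussianInt) :
    primeSym ϖ (β * γ) = primeSym ϖ β * primeSym ϖ γ := by
  by_cases hβ : ϖ ∣ β
  · rw [primeSym_eq_zero hϖ hodd hβ, primeSym_eq_zero hϖ hodd (hβ.mul_right γ), zero_mul]
  by_cases hγ : ϖ ∣ γ
  · rw [primeSym_eq_zero hϖ hodd hγ, primeSym_eq_zero hϖ hodd (hγ.mul_left β), mul_zero]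
  obtain ⟨a, ha, ha'⟩ := primeSym_spec hϖ hodd hβ
  obtain ⟨b, hb, hb'⟩ := primeSym_spec hϖ hodd hγ
  rw [ha, hb, ← iPow_add]
  apply primeSym_eq hϖ hodd
  rw [iPow_add, mul_pow]
  set e := (ϖ.norm.natAbs - 1) / 4
  have : β ^ e * γ ^ e - iPow a * iPow b = (β ^ e - iPow a) * γ ^ e + iPow a * (γ ^ e - iPow b) := by
    ring
  rw [this]
  exact dvd_add (ha'.mul_right _) (hb'.mul_left _)

lemma prime_star {ϖ : GaussianInt} (hϖ : Prime ϖ) : Prime (star ϖ) :=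
  (MulEquiv.prime_iff (starMulAut (R := GaussianInt))).2 hϖ

lemma star_dvd_star {a b : GaussianInt} : star a ∣ star b ↔ a ∣ b := by
  constructor
  · rintro ⟨c, hc⟩
    refine ⟨star c, ?_⟩
    rw [← star_star b, hc, star_mul', star_star]
  · rintro ⟨c, rfl⟩
    exact ⟨star c, star_mul' _ _⟩

lemma primeSym_star {ϖ : GaussianInt} (hϖ : Prime ϖ) (hodd : Odd ϖ.norm) (β : GaussianInt) :
    primeSym (star ϖ) (star β) = star (primeSym ϖ β) := by
  have hodd' : Odd (star ϖ).norm := by rwa [natAbs_norm_star]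
  by_cases hβ : ϖ ∣ β
  · rw [primeSym_eq_zero hϖ hodd hβ, primeSym_eq_zero (prime_star hϖ) hodd' (star_dvd_star.2 hβ),
      star_zero]
  obtain ⟨a, ha, ha'⟩ := primeSym_spec hϖ hodd hβ
  rw [ha, star_iPow]
  apply primeSym_eq (prime_star hϖ) hodd'
  rw [← star_iPow, natAbs_norm_star, ← star_pow, ← star_sub]
  exact star_dvd_star.2 ha'

/-! ### The quartic symbol for composite odd moduli. -/

open UniqueFactorizationMonoid

lemma ne_zero_of_odd_norm {α : GaussianInt} (h : Odd α.norm) : α ≠ 0 := by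
  rintro rfl
  rw [Zsqrtd.norm_zero] at h
  exact absurd h (by decide)

lemma odd_norm_mul {α β : GaussianInt} : Odd (α * β).norm ↔ Odd α.norm ∧ Odd β.norm := by
  rw [Zsqrtd.norm_mul, Int.odd_mul]

lemma odd_norm_of_dvd {α β : GaussianInt} (h : Odd β.norm) (hd : α ∣ β) : Odd α.norm := by
  obtain ⟨c, rfl⟩ := hd
  exact (odd_norm_mul.1 h).1

lemma odd_norm_intCast {n : ℤ} : Odd (n : GaussianInt).norm ↔ Odd n := by
  rw [Zsqrtd.norm_intCast, Int.odd_mul, and_self]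

/-- The quartic residue symbol in the Gaussian integers, extended multiplicatively to odd moduli. -/
noncomputable def quarticSym (α β : GaussianInt) : GaussianInt :=
  ((factors α).map fun ϖ => primeSym ϖ β).prod

/-- The multiset of prime factors is canonical only up to units, which the symbol does not see. -/
lemma prod_map_primeSym_of_rel {s t : Multiset GaussianInt} (h : Multiset.Rel Associated s t)
    (β : GaussianInt) :
    (s.map fun ϖ => primeSym ϖ β).prod = (t.map fun ϖ => primeSym ϖ β).prod := by
  induction h with
  | zero => rfl
  | cons hab _ ih => simp only [Multiset.map_cons, Multiset.prod_cons, ih, primeSym_associated hab]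

lemma quarticSym_mul_left {α α' : GaussianInt} (h : α ≠ 0) (h' : α' ≠ 0) (β : GaussianInt) :
    quarticSym (α * α') β = quarticSym α β * quarticSym α' β := by
  rw [quarticSym, prod_map_primeSym_of_rel (factors_mul h h'), Multiset.map_add, Multiset.prod_add]
  rfl

lemma quarticSym_of_prime {ϖ : GaussianInt} (h : Prime ϖ) (β : GaussianInt) :
    quarticSym ϖ β = primeSym ϖ β := by
  obtain ⟨b, hb, hf⟩ := factors_eq_singleton_of_irreducible h.irreducible
  rw [quarticSym, hf, Multiset.map_singleton, Multiset.prod_singleton, primeSym_associated hb]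

lemma quarticSym_of_isUnit {u : GaussianInt} (h : IsUnit u) (β : GaussianInt) :
    quarticSym u β = 1 := by
  rw [quarticSym, factors_of_isUnit h, Multiset.map_zero, Multiset.prod_zero]

lemma quarticSym_associated {α α' : GaussianInt} (h : Associated α α') (β : GaussianInt) :
    quarticSym α β = quarticSym α' β :=
  prod_map_primeSym_of_rel (factors_rel_of_associated h) β

/-- Induction on the prime factors of an odd Gaussian integer. -/
lemma odd_induction {P : GaussianInt → Prop} {α : GaussianInt} (hα : Odd α.norm)
    (hu : ∀ u, IsUnit u → P u)
    (hp : ∀ ϖ α, Prime ϖ → Odd ϖ.norm → Odd α.norm → P α → P (ϖ * α)) : P α := by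
  induction α using induction_on_prime with
  | h₁ => exact absurd rfl (ne_zero_of_odd_norm hα)
  | h₂ u h => exact hu u h
  | h₃ a p ha hp' ih =>
    obtain ⟨h1, h2⟩ := odd_norm_mul.1 hα
    exact hp p a hp' h1 h2 (ih h2)

lemma quarticSym_prime_mul {ϖ α : GaussianInt} (h : Prime ϖ) (hα : Odd α.norm) (β : GaussianInt) :
    quarticSym (ϖ * α) β = primeSym ϖ β * quarticSym α β := by
  rw [quarticSym_mul_left h.ne_zero (ne_zero_of_odd_norm hα), quarticSym_of_prime h]

lemma quarticSym_mul_right {α : GaussianInt} (hα : Odd α.norm) (β γ : GaussianInt) :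
    quarticSym α (β * γ) = quarticSym α β * quarticSym α γ := by
  refine odd_induction (P := fun α => quarticSym α (β * γ) = quarticSym α β * quarticSym α γ) hα
    (fun u h => ?_) (fun ϖ α hϖ h h' ih => ?_)
  · simp only [quarticSym_of_isUnit h, mul_one]
  · rw [quarticSym_prime_mul hϖ h', quarticSym_prime_mul hϖ h', quarticSym_prime_mul hϖ h', ih,
      primeSym_mul hϖ h]
    ring

lemma quarticSym_congr {α β γ : GaussianInt} (hα : Odd α.norm) (h : α ∣ β - γ) :
    quarticSym α β = quarticSym α γ := by
  revert h
  refine odd_induction (P := fun α => α ∣ β - γ → quarticSym α β = quarticSym α γ) hα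
    (fun u h _ => ?_) (fun ϖ α hϖ h h' ih hd => ?_)
  · simp only [quarticSym_of_isUnit h]
  · rw [quarticSym_prime_mul hϖ h', quarticSym_prime_mul hϖ h', ih (dvd_of_mul_left_dvd hd),
      primeSym_congr (dvd_of_mul_right_dvd hd)]

lemma quarticSym_star {α : GaussianInt} (hα : Odd α.norm) (β : GaussianInt) :
    quarticSym (star α) (star β) = star (quarticSym α β) := by
  refine odd_induction (P := fun α => quarticSym (star α) (star β) = star (quarticSym α β)) hα
    (fun u h => ?_) (fun ϖ α hϖ h h' ih => ?_)
  · rw [quarticSym_of_isUnit h, quarticSym_of_isUnit h.star, star_one]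
  · rw [quarticSym_prime_mul hϖ h', star_mul', star_mul', quarticSym_prime_mul (prime_star hϖ), ih,
      primeSym_star hϖ h]
    rwa [natAbs_norm_star]

lemma primeSym_one {ϖ : GaussianInt} (hϖ : Prime ϖ) (h : Odd ϖ.norm) : primeSym ϖ 1 = 1 := by
  rw [← iPow_zero]
  apply primeSym_eq hϖ h
  rw [iPow_zero, one_pow, sub_self]
  exact dvd_zero _

lemma quarticSym_one {α : GaussianInt} (hα : Odd α.norm) : quarticSym α 1 = 1 := by
  refine odd_induction (P := fun α => quarticSym α 1 = 1) hα
    (fun u h => ?_) (fun ϖ α hϖ h h' ih => ?_)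
  · rw [quarticSym_of_isUnit h]
  · rw [quarticSym_prime_mul hϖ h', ih, primeSym_one hϖ h, mul_one]

lemma quarticSym_pow {α : GaussianInt} (hα : Odd α.norm) (β : GaussianInt) (n : ℕ) :
    quarticSym α (β ^ n) = quarticSym α β ^ n := by
  induction n with
  | zero => rw [pow_zero, pow_zero, quarticSym_one hα]
  | succ n ih => rw [pow_succ, pow_succ, quarticSym_mul_right hα, ih]

/-- The symbol of coprime arguments is a power of `i`. -/
lemma exists_quarticSym_eq_iPow {α β : GaussianInt} (hα : Odd α.norm) (h : IsCoprime α β) :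
    ∃ k : ℤ, quarticSym α β = iPow k := by
  revert h
  refine odd_induction (P := fun α => IsCoprime α β → ∃ k : ℤ, quarticSym α β = iPow k) hα
    (fun u h _ => ⟨0, by rw [quarticSym_of_isUnit h, iPow_zero]⟩) (fun ϖ α hϖ h h' ih hc => ?_)
  obtain ⟨h1, h2⟩ := IsCoprime.mul_left_iff.1 hc
  obtain ⟨k, hk⟩ := ih h2
  obtain ⟨m, hm, -⟩ := primeSym_spec hϖ h ((hϖ.irreducible.coprime_iff_not_dvd).1 h1)
  exact ⟨m + k, by rw [quarticSym_prime_mul hϖ h', hk, hm, iPow_add]⟩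

/-- `χ_α(i) = i ^ ((N α - 1) / 4)`. -/
lemma quarticSym_iPow {α : GaussianInt} (hα : Odd α.norm) (k : ℤ) :
    quarticSym α (iPow k) = iPow (k * ((α.norm - 1) / 4)) := by
  refine odd_induction (P := fun α => quarticSym α (iPow k) = iPow (k * ((α.norm - 1) / 4))) hα
    (fun u h => ?_) (fun ϖ α hϖ h h' ih => ?_)
  · rw [quarticSym_of_isUnit h, (Zsqrtd.norm_eq_one_iff' (by norm_num) u).2 h]
    simp [iPow_zero]
  · have e : primeSym ϖ (iPow k) = iPow (k * ((ϖ.norm - 1) / 4)) := by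
      apply primeSym_eq hϖ h
      have h1 := norm_mod_four h
      have h2 := GaussianInt.norm_nonneg ϖ
      have : ((ϖ.norm - 1) / 4) = (((ϖ.norm.natAbs - 1) / 4 : ℕ) : ℤ) := by omega
      rw [this, iPow_mul, sub_self]
      exact dvd_zero _
    rw [quarticSym_prime_mul hϖ h', ih, e, ← iPow_add, Zsqrtd.norm_mul]
    apply iPow_congr
    have h1 := norm_mod_four h
    have h2 := norm_mod_four h'
    obtain ⟨a, ha⟩ : ∃ a, ϖ.norm = 4 * a + 1 := ⟨ϖ.norm / 4, by omega⟩
    obtain ⟨b, hb⟩ : ∃ a, α.norm = 4 * a + 1 := ⟨α.norm / 4, by omega⟩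
    rw [ha, hb]
    have e1 : (4 * a + 1 - 1) / 4 = a := by omega
    have e2 : (4 * b + 1 - 1) / 4 = b := by omega
    -- On integers congruent to 1 modulo 4, the map N ↦ (N-1)/4 turns products into sums modulo 4.
    have e3 : ((4 * a + 1) * (4 * b + 1) - 1) / 4 = a + b + 4 * (a * b) := by
      rw [show (4 * a + 1) * (4 * b + 1) - 1 = 4 * (a + b + 4 * (a * b)) by ring]; omega
    rw [e1, e2, e3]
    exact (Int.modEq_iff_dvd).2 ⟨k * (a * b), by ring⟩

/-! ### Symbols with a rational modulus. -/

/-- For a rational prime that stays prime, the symbol of `β` in closed form. -/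
lemma primeSym_natCast_eq {l : ℕ} (hl : l.Prime) (h3 : l % 4 = 3) {β : GaussianInt} {k : ℤ}
    (h : (l : GaussianInt) ∣ (β ^ (l - 1)) ^ ((l + 1) / 4) - iPow k) :
    primeSym (l : GaussianInt) β = iPow k := by
  have := Fact.mk hl
  have hp := GaussianInt.prime_of_nat_prime_of_mod_four_eq_three l h3
  apply primeSym_eq hp
  · rw [← Int.cast_natCast, odd_norm_intCast, Int.odd_iff]; omega
  · convert h using 2
    rw [← pow_mul, Zsqrtd.norm_natCast, Int.natAbs_mul, Int.natAbs_natCast]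
    congr 1
    obtain ⟨m, hm⟩ : ∃ m, l = 4 * m + 3 := ⟨l / 4, by omega⟩
    have e1 : (l + 1) / 4 = m + 1 := by omega
    have e2 : l * l - 1 = 4 * ((l - 1) * (m + 1)) := by
      rw [hm, show 4 * m + 3 - 1 = 4 * m + 2 by omega]
      have : (4 * m + 3) * (4 * m + 3) = 4 * ((4 * m + 2) * (m + 1)) + 1 := by ring
      omega
    rw [e1, e2]; omega

/-- A rational integer has trivial quartic symbol modulo a coprime odd rational prime. -/
lemma quarticSym_natPrime_intCast {l : ℕ} (hl : l.Prime) (h2 : Odd l) {m : ℤ} (h : ¬ (l : ℤ) ∣ m) :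
    quarticSym (l : GaussianInt) (m : GaussianInt) = 1 := by
  have := Fact.mk hl
  have hodd : Odd (l : GaussianInt).norm := by
    rw [← Int.cast_natCast, odd_norm_intCast]; exact_mod_cast h2
  by_cases hp : Prime (l : GaussianInt)
  · have h3 := GaussianInt.mod_four_eq_three_of_nat_prime_of_prime l
    rw [quarticSym_of_prime hp, ← iPow_zero]
    apply primeSym_natCast_eq hl (h3 hp)
    rw [iPow_zero]
    have h4 : (m : ZMod l) ≠ 0 := by rwa [Ne, ZMod.intCast_zmod_eq_zero_iff_dvd]
    have h5 : (l : ℤ) ∣ (m ^ (l - 1)) ^ ((l + 1) / 4) - 1 := by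
      rw [← ZMod.intCast_zmod_eq_zero_iff_dvd]
      push_cast
      rw [ZMod.pow_card_sub_one_eq_one h4, one_pow, sub_self]
    have h6 := (Zsqrtd.intCast_dvd_intCast (d := -1) _ _).2 h5
    push_cast at h6
    exact h6
  · obtain ⟨a, b, hab⟩ := GaussianInt.sq_add_sq_of_nat_prime_of_not_irreducible l
      (by rwa [irreducible_iff_prime])
    set ϖ : GaussianInt := ⟨a, b⟩
    have hN : ϖ.norm = l := by
      rw [Zsqrtd.norm_def, ← hab]; simp only [ϖ]; push_cast; ring
    have hϖ := prime_of_norm_prime hl hN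
    have hl' : (l : GaussianInt) = ϖ * star ϖ := by
      rw [← Zsqrtd.norm_eq_mul_conj, hN, Int.cast_natCast]
    have hϖodd : Odd ϖ.norm := by rw [hN]; exact_mod_cast h2
    have hnd : ¬ ϖ ∣ (m : GaussianInt) := by
      intro hd
      have hd' := norm_dvd_norm hd
      rw [hN, Zsqrtd.norm_intCast] at hd'
      exact h (((Nat.prime_iff_prime_int.1 hl).dvd_mul.1 hd').elim id id)
    obtain ⟨k, hk, -⟩ := primeSym_spec hϖ hϖodd hnd
    have hs : star (m : GaussianInt) = m := star_intCast m
    -- For split l the symbols of m modulo ϖ and modulo its conjugate are complex conjugates, so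
    -- their product is 1.
    rw [hl', quarticSym_prime_mul hϖ (by rwa [natAbs_norm_star]),
      quarticSym_of_prime (prime_star hϖ), hk]
    have := primeSym_star hϖ hϖodd (m : GaussianInt)
    rw [hs] at this
    rw [this, hk, star_iPow, ← iPow_add, add_neg_cancel, iPow_zero]

lemma ne_zero_of_odd {n : ℤ} (hn : Odd n) : n ≠ 0 := by
  rintro rfl; exact absurd hn (by decide)

/-- Induction on the prime factors of an odd integer. -/
lemma int_odd_induction {P : ℤ → Prop} {n : ℤ} (hn : Odd n) (h1 : P 1) (hneg : ∀ n, Odd n → P n → P (-n))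
    (hp : ∀ (l : ℕ) (n : ℤ), l.Prime → Odd l → Odd n → P n → P (l * n)) : P n := by
  have key : ∀ m : ℕ, Odd m → P m := by
    intro m
    induction m using induction_on_primes with
    | zero => intro h; exact absurd h (by decide)
    | one => intro _; exact_mod_cast h1
    | prime_mul p a hp' ih =>
      intro h
      obtain ⟨h3, h4⟩ := Nat.odd_mul.1 h
      have := hp p a hp' h3 (by exact_mod_cast h4) (ih h4)
      push_cast
      exact this
  rcases Int.natAbs_eq n with h | h
  · rw [h]; exact key _ (Int.natAbs_odd.2 hn)
  · rw [h]; exact hneg _ (by exact_mod_cast Int.natAbs_odd.2 hn) (key _ (Int.natAbs_odd.2 hn))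

lemma intCast_ne_zero_of_odd {n : ℤ} (hn : Odd n) : (n : GaussianInt) ≠ 0 :=
  Int.cast_ne_zero.2 (ne_zero_of_odd hn)

lemma quarticSym_neg_left (α β : GaussianInt) : quarticSym (-α) β = quarticSym α β :=
  quarticSym_associated (Associated.neg_left (Associated.refl α)) β

lemma quarticSym_natPrime_mul {l : ℕ} {n : ℤ} (hl : Odd l) (hn : Odd n) (β : GaussianInt) :
    quarticSym (((l : ℤ) * n : ℤ) : GaussianInt) β =
      quarticSym (l : GaussianInt) β * quarticSym (n : GaussianInt) β := by
  have hl' : Odd (l : ℤ) := by exact_mod_cast hl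
  have := quarticSym_mul_left (intCast_ne_zero_of_odd hl') (intCast_ne_zero_of_odd hn) β
  push_cast at this ⊢
  exact this

/-- Coprime rational integers have trivial quartic symbol. -/
lemma quarticSym_intCast_intCast {n m : ℤ} (hn : Odd n) (h : IsCoprime n m) :
    quarticSym (n : GaussianInt) (m : GaussianInt) = 1 := by
  revert h
  refine int_odd_induction (P := fun n => IsCoprime n m → quarticSym (n : GaussianInt) (m : GaussianInt) = 1)
    hn (fun _ => ?_) (fun n hn ih h => ?_) (fun l n hl hodd hn ih h => ?_)
  · rw [Int.cast_one, quarticSym_of_isUnit isUnit_one]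
  · rw [Int.cast_neg, quarticSym_neg_left, ih (IsCoprime.neg_left_iff _ _ |>.1 h)]
  · obtain ⟨h1, h2⟩ := IsCoprime.mul_left_iff.1 h
    rw [quarticSym_natPrime_mul hodd hn, ih h2, mul_one]
    apply quarticSym_natPrime_intCast hl hodd
    exact ((Nat.prime_iff_prime_int.1 hl).irreducible.coprime_iff_not_dvd).1 h1

/-- Frobenius sends 1+i to 1-i = (1+i)i³, and 1+i is invertible modulo l. -/
lemma zsqrtd_one_one_pow {l : ℕ} (hl : l.Prime) (h3 : l % 4 = 3) :
    (l : GaussianInt) ∣ (⟨1, 1⟩ : GaussianInt) ^ (l - 1) - iPow 3 := by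
  have := Fact.mk hl
  have hp := GaussianInt.prime_of_nat_prime_of_mod_four_eq_three l h3
  have h := inert_pow_dvd hl h3 ⟨1, 1⟩
  have e : (⟨1, 1⟩ : GaussianInt) ^ l - star ⟨1, 1⟩ = ⟨1, 1⟩ * ((⟨1, 1⟩ : GaussianInt) ^ (l - 1) - iPow 3) := by
    have h1 : star (⟨1, 1⟩ : GaussianInt) = ⟨1, 1⟩ * iPow 3 := by rw [iPow_three]; decide
    conv_lhs => rw [show l = (l - 1) + 1 by have := hl.pos; omega, pow_succ]
    rw [h1]; ring
  rw [e] at h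
  refine (hp.dvd_mul.1 h).resolve_left fun hd => ?_
  have := norm_dvd_norm hd
  rw [Zsqrtd.norm_natCast, show Zsqrtd.norm (⟨1, 1⟩ : GaussianInt) = 2 by decide] at this
  have h5 : l * l ∣ 2 := by exact_mod_cast this
  have h6 := Nat.le_of_dvd (by norm_num) h5
  have : 3 ≤ l := by omega
  nlinarith

/-- `χ_l(1 + i)` for an odd rational prime `l`. -/
lemma quarticSym_natPrime_one_add_i {l : ℕ} (hl : l.Prime) (h2 : Odd l) :
    quarticSym (l : GaussianInt) ⟨1, 1⟩ =
      iPow (if l % 4 = 1 then ((l : ℤ) - 1) / 4 else (-(l : ℤ) - 1) / 4) := by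
  have := Fact.mk hl
  have hcase : l % 4 = 1 ∨ l % 4 = 3 := by obtain ⟨k, rfl⟩ := h2; omega
  rcases hcase with h | h
  · rw [if_pos h]
    have hp : ¬ Prime (l : GaussianInt) := fun hp => by
      have := GaussianInt.mod_four_eq_three_of_nat_prime_of_prime l hp
      omega
    obtain ⟨a, b, hab⟩ := GaussianInt.sq_add_sq_of_nat_prime_of_not_irreducible l
      (by rwa [irreducible_iff_prime])
    set ϖ : GaussianInt := ⟨a, b⟩
    have hN : ϖ.norm = l := by
      rw [Zsqrtd.norm_def, ← hab]; simp only [ϖ]; push_cast; ring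
    have hϖ := prime_of_norm_prime hl hN
    have hl' : (l : GaussianInt) = ϖ * star ϖ := by
      rw [← Zsqrtd.norm_eq_mul_conj, hN, Int.cast_natCast]
    have hϖodd : Odd ϖ.norm := by rw [hN]; exact_mod_cast h2
    -- The symbol of 1+i modulo star ϖ is conjugate to that of 1-i modulo ϖ. As 1+i = i(1-i), the
    -- product over both primes leaves only the symbol of i modulo ϖ.
    have hi : (⟨1, 1⟩ : GaussianInt) = star ⟨1, 1⟩ * iPow 1 := by rw [iPow_one]; decide
    have hst := primeSym_star hϖ hϖodd (star (⟨1, 1⟩ : GaussianInt))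
    rw [star_star] at hst
    have hnd : ¬ ϖ ∣ star (⟨1, 1⟩ : GaussianInt) := by
      intro hd
      have hd' := norm_dvd_norm hd
      rw [hN, natAbs_norm_star, show Zsqrtd.norm (⟨1, 1⟩ : GaussianInt) = 2 by decide] at hd'
      have h5 : l ∣ 2 := by exact_mod_cast hd'
      have h6 := Nat.le_of_dvd (by norm_num) h5
      have := hl.one_lt
      omega
    obtain ⟨k, hk, -⟩ := primeSym_spec hϖ hϖodd hnd
    have e : primeSym ϖ ⟨1, 1⟩ = iPow (k + 1 * (((l : ℤ) - 1) / 4)) := by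
      rw [hi, primeSym_mul hϖ hϖodd, ← quarticSym_of_prime hϖ (iPow 1), quarticSym_iPow hϖodd, hk,
        hN, ← iPow_add]
    rw [hl', quarticSym_prime_mul hϖ (by rwa [natAbs_norm_star]),
      quarticSym_of_prime (prime_star hϖ), hst, hk, e, star_iPow, ← iPow_add]
    congr 1; ring
  · rw [if_neg (by omega)]
    rw [quarticSym_of_prime (GaussianInt.prime_of_nat_prime_of_mod_four_eq_three l h)]
    apply primeSym_natCast_eq hl h
    have h1 := (zsqrtd_one_one_pow hl h).trans (sub_dvd_pow_sub_pow _ _ ((l + 1) / 4))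
    rw [← iPow_mul] at h1
    convert h1 using 2
    apply iPow_congr
    have : ((l + 1) / 4 : ℕ) = ((l : ℤ) + 1) / 4 := by push_cast; rfl
    rw [this]
    show _ % _ = _ % _
    omega

lemma exists_eq_sign_mul_odd {n : ℤ} (hn : Odd n) : n % 4 = 1 ∨ n % 4 = 3 := by
  obtain ⟨k, rfl⟩ := hn; omega

/-- `χ_n(1 + i) = i ^ ((n - 1) / 4)` for a rational integer `n ≡ 1 [ZMOD 4]`. -/
lemma quarticSym_intCast_one_add_i {n : ℤ} (hn : n % 4 = 1) :
    quarticSym (n : GaussianInt) ⟨1, 1⟩ = iPow ((n - 1) / 4) := by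
  have hodd : Odd n := by rw [Int.odd_iff]; omega
  -- Prime factors may be 3 modulo 4, so the induction runs over all odd n, with -n replacing n in
  -- that class.
  have key : quarticSym (n : GaussianInt) ⟨1, 1⟩ =
      iPow (if n % 4 = 1 then (n - 1) / 4 else (-n - 1) / 4) := by
    clear hn
    refine int_odd_induction (P := fun n => quarticSym (n : GaussianInt) ⟨1, 1⟩ =
      iPow (if n % 4 = 1 then (n - 1) / 4 else (-n - 1) / 4)) hodd ?_ (fun n hn ih => ?_)
      (fun l n hl hodd hn ih => ?_)
    · rw [Int.cast_one, quarticSym_of_isUnit isUnit_one]; simp [iPow_zero]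
    · rw [Int.cast_neg, quarticSym_neg_left, ih]
      rcases exists_eq_sign_mul_odd hn with h | h
      · rw [if_pos h, if_neg (by omega), neg_neg]
      · rw [if_neg (by omega), if_pos (by omega)]
    · rw [quarticSym_natPrime_mul hodd hn, ih, quarticSym_natPrime_one_add_i hl hodd, ← iPow_add]
      apply iPow_congr
      have hl4 : (l : ℤ) % 4 = 1 ∨ (l : ℤ) % 4 = 3 :=
        exists_eq_sign_mul_odd (by exact_mod_cast hodd)
      have hcast : l % 4 = 1 ↔ (l : ℤ) % 4 = 1 := by omega
      simp only [hcast]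
      generalize (l : ℤ) = m at *
      have aux : ∀ a b : ℤ, a + b ≡ a + b + 4 * (a * b) [ZMOD 4] := fun a b =>
        Int.modEq_iff_dvd.2 ⟨a * b, by ring⟩
      rcases hl4 with h | h <;> rcases exists_eq_sign_mul_odd hn with h' | h'
      · obtain ⟨a, rfl⟩ : ∃ a, m = 4 * a + 1 := ⟨m / 4, by omega⟩
        obtain ⟨b, rfl⟩ : ∃ b, n = 4 * b + 1 := ⟨n / 4, by omega⟩
        have e : (4 * a + 1) * (4 * b + 1) = 4 * (a + b + 4 * (a * b)) + 1 := by ring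
        rw [if_pos h, if_pos h', e, if_pos (by omega)]
        convert aux a b using 1 <;> omega
      · obtain ⟨a, rfl⟩ : ∃ a, m = 4 * a + 1 := ⟨m / 4, by omega⟩
        obtain ⟨b, rfl⟩ : ∃ b, n = -(4 * b + 1) := ⟨-n / 4, by omega⟩
        have e : (4 * a + 1) * -(4 * b + 1) = -(4 * (a + b + 4 * (a * b)) + 1) := by ring
        rw [if_pos h, if_neg (by omega), e, if_neg (by omega)]
        convert aux a b using 1 <;> omega
      · obtain ⟨a, rfl⟩ : ∃ a, m = -(4 * a + 1) := ⟨-m / 4, by omega⟩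
        obtain ⟨b, rfl⟩ : ∃ b, n = 4 * b + 1 := ⟨n / 4, by omega⟩
        have e : -(4 * a + 1) * (4 * b + 1) = -(4 * (a + b + 4 * (a * b)) + 1) := by ring
        rw [if_neg (by omega), if_pos h', e, if_neg (by omega)]
        convert aux a b using 1 <;> omega
      · obtain ⟨a, rfl⟩ : ∃ a, m = -(4 * a + 1) := ⟨-m / 4, by omega⟩
        obtain ⟨b, rfl⟩ : ∃ b, n = -(4 * b + 1) := ⟨-n / 4, by omega⟩
        have e : -(4 * a + 1) * -(4 * b + 1) = 4 * (a + b + 4 * (a * b)) + 1 := by ring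
        rw [if_neg (by omega), if_neg (by omega), e, if_pos (by omega)]
        convert aux a b using 1 <;> omega
  rwa [if_pos hn] at key

/-! ### The quartic character of ℤ/p and its Jacobi sum. -/

section Character

variable {p : ℕ} [Fact p.Prime] {ϖ : GaussianInt}

lemma odd_norm_of_eq {p : ℕ} {ϖ : GaussianInt} (hN : ϖ.norm = p) (h2 : Odd p) : Odd ϖ.norm := by
  rw [hN]; exact_mod_cast h2

lemma dvd_natCast_of_norm {p : ℕ} {ϖ : GaussianInt} (hN : ϖ.norm = p) : ϖ ∣ (p : GaussianInt) := by
  refine ⟨star ϖ, ?_⟩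
  rw [← Zsqrtd.norm_eq_mul_conj, hN, Int.cast_natCast]

lemma dvd_sub_of_zmod_eq {p : ℕ} {ϖ : GaussianInt} (hN : ϖ.norm = p) {m n : ℤ}
    (h : (m : ZMod p) = n) : ϖ ∣ (m : GaussianInt) - n := by
  have h1 : (p : ℤ) ∣ m - n := by
    rw [← ZMod.intCast_zmod_eq_zero_iff_dvd]; push_cast; rw [h, sub_self]
  have h2 := (Zsqrtd.intCast_dvd_intCast (d := -1) _ _).2 h1
  push_cast at h2
  exact (dvd_natCast_of_norm hN).trans h2

/-- The quartic residue character of `ℤ/p` attached to a Gaussian prime `ϖ` of norm `p`. -/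
noncomputable def quarticChar (hN : ϖ.norm = p) (h2 : Odd p) : MulChar (ZMod p) GaussianInt where
  toFun a := primeSym ϖ ((a.val : ℤ) : GaussianInt)
  map_one' := by
    rw [← primeSym_one (prime_of_norm_prime Fact.out hN) (odd_norm_of_eq hN h2)]
    apply primeSym_congr
    have := dvd_sub_of_zmod_eq hN (m := ((1 : ZMod p).val : ℤ)) (n := 1) (by simp)
    simpa using this
  map_mul' a b := by
    rw [← primeSym_mul (prime_of_norm_prime Fact.out hN) (odd_norm_of_eq hN h2)]
    apply primeSym_congr
    have := dvd_sub_of_zmod_eq hN (m := ((a * b : ZMod p).val : ℤ)) (n := a.val * b.val) (by simp)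
    simpa using this
  map_nonunit' a ha := by
    apply primeSym_eq_zero (prime_of_norm_prime Fact.out hN) (odd_norm_of_eq hN h2)
    have : a = 0 := by simpa using ha
    simp [this]

lemma quarticChar_intCast (hN : ϖ.norm = p) (h2 : Odd p) (n : ℤ) :
    quarticChar hN h2 (n : ZMod p) = primeSym ϖ (n : GaussianInt) := by
  apply primeSym_congr
  exact dvd_sub_of_zmod_eq hN (by simp)

lemma quarticChar_cases (hN : ϖ.norm = p) (h2 : Odd p) {a : ZMod p} (ha : a ≠ 0) :
    ∃ k : ℤ, quarticChar hN h2 a = iPow k := by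
  have h0 : quarticChar hN h2 a ≠ 0 := by
    exact ((IsUnit.mk0 a ha).map (quarticChar hN h2)).ne_zero
  have hd : ¬ ϖ ∣ ((a.val : ℤ) : GaussianInt) := fun hd =>
    h0 (primeSym_eq_zero (prime_of_norm_prime Fact.out hN) (odd_norm_of_eq hN h2) hd)
  obtain ⟨k, hk, -⟩ := primeSym_spec (prime_of_norm_prime Fact.out hN) (odd_norm_of_eq hN h2) hd
  exact ⟨k, hk⟩

lemma iPow_pow_four (k : ℤ) : iPow k ^ 4 = 1 := by
  rw [← iPow_mul, ← iPow_zero]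
  exact iPow_congr (Int.modEq_iff_dvd.2 ⟨-k, by push_cast; ring⟩)

lemma quarticChar_pow_four (hN : ϖ.norm = p) (h2 : Odd p) : quarticChar hN h2 ^ 4 = 1 := by
  refine MulChar.ext fun a => ?_
  obtain ⟨k, hk⟩ := quarticChar_cases hN h2 a.ne_zero
  rw [MulChar.pow_apply_coe, hk, iPow_pow_four, MulChar.one_apply_coe]

lemma quarticChar_inv_apply (hN : ϖ.norm = p) (h2 : Odd p) (a : ZMod p) :
    (quarticChar hN h2)⁻¹ a = star (quarticChar hN h2 a) := by
  have h : (quarticChar hN h2)⁻¹ = quarticChar hN h2 ^ 3 := by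
    rw [inv_eq_iff_mul_eq_one, ← pow_succ', quarticChar_pow_four]
  rw [h, MulChar.pow_apply' _ (by norm_num)]
  by_cases ha : a = 0
  · rw [ha, MulChar.map_zero, star_zero, zero_pow (by norm_num)]
  · obtain ⟨k, hk⟩ := quarticChar_cases hN h2 ha
    rw [hk, star_iPow, ← iPow_mul]
    exact iPow_congr (Int.modEq_iff_dvd.2 ⟨-k, by push_cast; ring⟩)

/-- Euler's criterion for the quartic character. -/
lemma map_quarticChar (hN : ϖ.norm = p) (h2 : Odd p) {f : GaussianInt →+* ZMod p} (hf : f ϖ = 0)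
    (a : ZMod p) : f (quarticChar hN h2 a) = a ^ ((p - 1) / 4) := by
  have h := dvd_pow_sub_primeSym (prime_of_norm_prime Fact.out hN) (odd_norm_of_eq hN h2)
    ((a.val : ℤ) : GaussianInt)
  have h1 := (map_eq_zero_iff_dvd (prime_of_norm_prime Fact.out hN) f hf _).2 h
  rw [map_sub, map_pow, map_intCast, sub_eq_zero, hN] at h1
  rw [Int.natAbs_natCast, Int.cast_natCast, ZMod.natCast_zmod_val] at h1
  exact h1.symm

lemma mod_four_of_norm {p : ℕ} {ϖ : GaussianInt} (hN : ϖ.norm = p) (h2 : Odd p) : p % 4 = 1 := by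
  have := norm_mod_four (odd_norm_of_eq hN h2)
  rw [hN] at this; omega

/-- Otherwise a^((p-1)/2) = 1 for every nonzero a, contradicting the existence of a nonsquare. -/
lemma quarticChar_sq_ne_one (hN : ϖ.norm = p) (h2 : Odd p) :
    quarticChar hN h2 * quarticChar hN h2 ≠ 1 := by
  intro h
  have h4 := mod_four_of_norm hN h2
  obtain ⟨-, f, -, hf⟩ := exists_hom_zmod hN
  obtain ⟨a, ha⟩ := FiniteField.exists_nonsquare (F := ZMod p) (by
    rw [ZMod.ringChar_zmod_n]; rintro rfl; omega)
  have ha0 : a ≠ 0 := by rintro rfl; exact ha (IsSquare.zero)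
  apply ha
  rw [ZMod.euler_criterion p ha0]
  have h1 := congrArg (fun χ : MulChar (ZMod p) GaussianInt => f (χ a)) h
  simp only [MulChar.mul_apply, map_mul, map_quarticChar hN h2 hf] at h1
  rw [MulChar.one_apply (IsUnit.mk0 a ha0), map_one, ← pow_add] at h1
  rw [← h1]
  congr 1
  omega

lemma quarticChar_ne_one (hN : ϖ.norm = p) (h2 : Odd p) : quarticChar hN h2 ≠ 1 := fun h =>
  quarticChar_sq_ne_one hN h2 (by rw [h, one_mul])

lemma isPrimitiveRoot_i : IsPrimitiveRoot (⟨0, 1⟩ : GaussianInt) 4 := by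
  refine IsPrimitiveRoot.mk_of_lt _ (by norm_num) (by decide) ?_
  intro l h0 h4
  interval_cases l <;> decide

/-- The Jacobi sum is -1 modulo (i-1)² = -2i. This fixes the Jacobi sum among its associates up to
sign. -/
lemma jacobiSum_quarticChar_parity (hN : ϖ.norm = p) (h2 : Odd p) :
    Odd (jacobiSum (quarticChar hN h2) (quarticChar hN h2)).re ∧
      Even (jacobiSum (quarticChar hN h2) (quarticChar hN h2)).im := by
  have h4 := mod_four_of_norm hN h2
  obtain ⟨z, -, hz⟩ := exists_jacobiSum_eq_neg_one_add (n := 4) (by norm_num)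
    (quarticChar_pow_four hN h2) (quarticChar_pow_four hN h2) (by rw [ZMod.card]; omega)
    isPrimitiveRoot_i
  rw [hz, show ((⟨0, 1⟩ : GaussianInt) - 1) ^ 2 = ⟨0, -2⟩ by decide]
  obtain ⟨x, y⟩ := z
  constructor
  · simp only [Zsqrtd.re_add, Zsqrtd.re_neg, Zsqrtd.re_one, Zsqrtd.re_mul]
    exact ⟨y - 1, by ring⟩
  · simp only [Zsqrtd.im_add, Zsqrtd.im_neg, Zsqrtd.im_one, Zsqrtd.im_mul]
    exact ⟨-x, by ring⟩

/-- The summand is a polynomial in a of degree 2k < p-1, and the power sums of such exponents vanish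
in ℤ/p. -/
lemma sum_pow_mul_one_sub_pow {k : ℕ} (hk : 2 * k < p - 1) :
    ∑ a : ZMod p, a ^ k * (1 - a) ^ k = 0 := by
  have e : ∀ a : ZMod p, a ^ k * (1 - a) ^ k =
      ∑ m ∈ Finset.range (k + 1), ((-1) ^ (m + k) * (k.choose m : ZMod p)) * a ^ (k + (k - m)) := by
    intro a
    rw [sub_pow, Finset.mul_sum]
    refine Finset.sum_congr rfl fun m _ => ?_
    rw [pow_add, one_pow]; ring
  simp_rw [e]
  rw [Finset.sum_comm]
  refine Finset.sum_eq_zero fun m _ => ?_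
  rw [← Finset.mul_sum, FiniteField.sum_pow_lt_card_sub_one, mul_zero]
  rw [ZMod.card]; omega

/-- By Euler's criterion the Jacobi sum reduces modulo ϖ to the sum of (a(1-a))^((p-1)/4). -/
lemma dvd_jacobiSum_quarticChar (hN : ϖ.norm = p) (h2 : Odd p) :
    ϖ ∣ jacobiSum (quarticChar hN h2) (quarticChar hN h2) := by
  obtain ⟨-, f, -, hf⟩ := exists_hom_zmod hN
  have h4 := mod_four_of_norm hN h2
  have hp : 1 < p := (Fact.out : p.Prime).one_lt
  rw [← map_eq_zero_iff_dvd (prime_of_norm_prime Fact.out hN) f hf, jacobiSum, map_sum]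
  simp only [map_mul, map_quarticChar hN h2 hf]
  exact sum_pow_mul_one_sub_pow (by omega)

/-- The classical J(χ,χ)J(χ⁻¹,χ⁻¹) = p is transported from ℂ; the second factor is the conjugate of
the first. -/
lemma norm_jacobiSum_quarticChar (hN : ϖ.norm = p) (h2 : Odd p) :
    (jacobiSum (quarticChar hN h2) (quarticChar hN h2)).norm = p := by
  set χ := quarticChar hN h2
  have hinj : Function.Injective GaussianInt.toComplex := GaussianInt.toComplex_injective
  have hne := (MulChar.ringHomComp_ne_one_iff hinj).2 (quarticChar_ne_one hN h2)
  have hne2 := (MulChar.ringHomComp_ne_one_iff hinj).2 (quarticChar_sq_ne_one hN h2)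
  rw [MulChar.ringHomComp_mul] at hne2
  have hp := (Fact.out : p.Prime).pos
  have h := jacobiSum_mul_jacobiSum_inv (F' := ℂ) (by
    rw [ZMod.ringChar_zmod_n, ringChar.eq_zero]; omega) hne hne hne2
  rw [MulChar.ringHomComp_inv, jacobiSum_ringHomComp, jacobiSum_ringHomComp, ← map_mul,
    ZMod.card] at h
  have h1 : jacobiSum χ⁻¹ χ⁻¹ = star (jacobiSum χ χ) := by
    rw [jacobiSum, jacobiSum, star_sum]
    refine Finset.sum_congr rfl fun a _ => ?_
    rw [star_mul', quarticChar_inv_apply, quarticChar_inv_apply]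
  rw [h1, ← Zsqrtd.norm_eq_mul_conj, map_intCast] at h
  exact_mod_cast h

/-- The Jacobi sum of the quartic character with itself is `± ϖ`. -/
lemma jacobiSum_quarticChar_sq (hN : ϖ.norm = p) (h2 : Odd p) (him : Even ϖ.im) :
    jacobiSum (quarticChar hN h2) (quarticChar hN h2) ^ 2 = ϖ ^ 2 := by
  obtain ⟨hr, hi⟩ := jacobiSum_quarticChar_parity hN h2
  have hn := norm_jacobiSum_quarticChar hN h2
  obtain ⟨u, hu⟩ := dvd_jacobiSum_quarticChar hN h2
  rw [hu] at hr hi hn ⊢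
  have hp : (p : ℤ) ≠ 0 := by exact_mod_cast (Fact.out : p.Prime).ne_zero
  rw [Zsqrtd.norm_mul, hN] at hn
  have hu1 : u.norm = 1 := (mul_eq_left₀ hp).1 hn
  obtain ⟨k, hk⟩ := exists_iPow_of_isUnit ((Zsqrtd.norm_eq_one_iff' (by norm_num) u).1 hu1)
  rw [Int.odd_iff] at hr
  rw [Int.even_iff] at hi him
  -- Since ϖ has even imaginary part, a unit factor ±i would make the real part of the Jacobi sum
  -- even.
  rcases iPow_cases k with ⟨-, h⟩ | ⟨-, h⟩ | ⟨-, h⟩ | ⟨-, h⟩ <;> rw [hk, h] at hr ⊢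
  · rw [mul_one]
  · exfalso; rw [Zsqrtd.re_mul] at hr; simp only at hr; omega
  · ring
  · exfalso; rw [Zsqrtd.re_mul] at hr; simp only at hr; omega

end Character

/-! ### Quartic Gauss sums with values in a field of characteristic l. -/

section GaussSum

variable {p : ℕ} [Fact p.Prime] {ϖ : GaussianInt} {K : Type*} [Field K]

lemma ringHomComp_sq_ne_one (hN : ϖ.norm = p) (h2 : Odd p) {f : GaussianInt →+* K}
    (hf : ∀ a b, f (iPow a) = f (iPow b) → iPow a = iPow b) :
    (quarticChar hN h2).ringHomComp f * (quarticChar hN h2).ringHomComp f ≠ 1 := by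
  intro h
  apply quarticChar_sq_ne_one hN h2
  refine MulChar.ext fun a => ?_
  obtain ⟨k, hk⟩ := quarticChar_cases hN h2 a.ne_zero
  have h1 := congrArg (fun χ : MulChar (ZMod p) K => χ a) h
  simp only [MulChar.mul_apply, MulChar.ringHomComp_apply, MulChar.one_apply_coe, hk] at h1
  rw [MulChar.mul_apply, hk, MulChar.one_apply_coe, ← iPow_add, ← iPow_zero]
  apply hf
  rw [iPow_add, map_mul, h1, iPow_zero, map_one]

/-- Combine G(χ)² = J(χ,χ)G(χ²), G(χ²)² = χ²(-1)p = p and J(χ,χ)² = ϖ². The unknown sign of J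
disappears in the fourth power. -/
lemma gaussSum_pow_four (hN : ϖ.norm = p) (h2 : Odd p) (him : Even ϖ.im)
    {f : GaussianInt →+* K} (hf : ∀ a b, f (iPow a) = f (iPow b) → iPow a = iPow b)
    {ψ : AddChar (ZMod p) K} (hψ : ψ.IsPrimitive) :
    gaussSum ((quarticChar hN h2).ringHomComp f) ψ ^ 4 = f (ϖ ^ 3 * star ϖ) := by
  have hne := ringHomComp_sq_ne_one hN h2 hf
  set χ := (quarticChar hN h2).ringHomComp f with hχ
  have h1 := jacobiSum_mul_nontrivial hne ψ
  have hval : ∀ a : ZMod p, a ≠ 0 → (χ a * χ a) * (χ a * χ a) = 1 := by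
    intro a ha
    obtain ⟨k, hk⟩ := quarticChar_cases hN h2 ha
    rw [hχ, MulChar.ringHomComp_apply, hk, ← map_mul, ← map_mul]
    have := iPow_pow_four k
    rw [show iPow k * iPow k * (iPow k * iPow k) = iPow k ^ 4 by ring, this, map_one]
  have hq : (χ * χ).IsQuadratic := by
    intro a
    by_cases ha : a = 0
    · left; rw [ha, MulChar.map_zero]
    · right
      rw [MulChar.mul_apply]
      exact mul_self_eq_one_iff.1 (hval a ha)
  have h3 := gaussSum_sq hne hq hψ
  have h4 : (χ * χ) (-1) = 1 := by
    rw [MulChar.mul_apply, ← map_mul]; simp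
  rw [h4, one_mul, ZMod.card] at h3
  have hp : (p : GaussianInt) = ϖ * star ϖ := by
    rw [← Zsqrtd.norm_eq_mul_conj, hN, Int.cast_natCast]
  have hj := jacobiSum_quarticChar_sq hN h2 him
  calc gaussSum χ ψ ^ 4 = (gaussSum χ ψ * gaussSum χ ψ) ^ 2 := by ring
    _ = gaussSum (χ * χ) ψ ^ 2 * jacobiSum χ χ ^ 2 := by rw [← h1]; ring
    _ = f p * f (ϖ ^ 2) := by
      rw [h3, hχ, jacobiSum_ringHomComp, ← map_pow, hj, map_natCast]
    _ = f (ϖ ^ 3 * star ϖ) := by rw [hp, ← map_mul]; congr 1; ring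

/-- The Frobenius action on the quartic Gauss sum. -/
lemma gaussSum_pow_char {l : ℕ} [Fact l.Prime] [CharP K l] (hlp : l ≠ p)
    (χ : MulChar (ZMod p) K) (ψ : AddChar (ZMod p) K) :
    χ l ^ l * gaussSum χ ψ ^ l = gaussSum (χ ^ l) ψ := by
  have hl : IsUnit (l : ZMod p) := by
    rw [isUnit_iff_ne_zero, Ne, ZMod.natCast_eq_zero_iff]
    intro h
    exact hlp ((Nat.prime_dvd_prime_iff_eq Fact.out Fact.out).1 h).symm
  rw [gaussSum_frob l, AddChar.pow_mulShift]
  have := gaussSum_mulShift (χ ^ l) ψ hl.unit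
  rw [hl.unit_spec, MulChar.pow_apply' _ (Fact.out : l.Prime).ne_zero] at this
  exact this

end GaussSum

/-- A field containing the residue field of an odd Gaussian prime `ϖ'` above `l` and a nontrivial
additive character of `ℤ/p`. -/
lemma exists_field_addChar {ϖ' : GaussianInt} (hϖ' : Prime ϖ') {l p : ℕ} [Fact l.Prime]
    [Fact p.Prime] (hd : ϖ' ∣ (l : GaussianInt)) (hlp : l ≠ p) :
    ∃ (K : Type) (_ : Field K) (_ : CharP K l) (f : GaussianInt →+* K) (ψ : AddChar (ZMod p) K),
      f ϖ' = 0 ∧ ψ.IsPrimitive := by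
  have hmax : (Ideal.span {ϖ'}).IsMaximal :=
    PrincipalIdealRing.isMaximal_of_irreducible hϖ'.irreducible
  let K₀ := GaussianInt ⧸ Ideal.span {ϖ'}
  let _ : Field K₀ := Ideal.Quotient.field _
  have hl0 : (l : K₀) = 0 := by
    rw [← map_natCast (Ideal.Quotient.mk (Ideal.span {ϖ'})), Ideal.Quotient.eq_zero_iff_mem,
      Ideal.mem_span_singleton]
    exact hd
  have hchar : ringChar K₀ = l := CharP.ringChar_of_prime_eq_zero Fact.out hl0
  have hcp : CharP K₀ l := ringChar.of_eq hchar
  let ψ := AddChar.FiniteField.primitiveChar (ZMod p) K₀ (by rwa [hchar, ZMod.ringChar_zmod_n])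
  refine ⟨CyclotomicField ψ.n K₀, inferInstance,
    charP_of_injective_algebraMap (algebraMap K₀ (CyclotomicField ψ.n K₀)).injective l,
    (algebraMap K₀ (CyclotomicField ψ.n K₀)).comp (Ideal.Quotient.mk _), ψ.char, ?_, ψ.prim⟩
  rw [RingHom.comp_apply, Ideal.Quotient.eq_zero_iff_mem.2 (Ideal.mem_span_singleton_self ϖ'),
    map_zero]

lemma map_iPow_injective {K : Type*} [Field K] {ϖ' : GaussianInt} (hϖ' : Prime ϖ')
    (hodd : Odd ϖ'.norm) {f : GaussianInt →+* K} (h0 : f ϖ' = 0) (a b : ℤ)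
    (h : f (iPow a) = f (iPow b)) : iPow a = iPow b := by
  apply iPow_congr
  apply not_dvd_iPow_sub hϖ' hodd
  rw [← map_eq_zero_iff_dvd hϖ' f h0, map_sub, h, sub_self]

lemma map_pow_eq_map_primeSym {K : Type*} [Field K] {ϖ' : GaussianInt} (hϖ' : Prime ϖ')
    (hodd : Odd ϖ'.norm) {f : GaussianInt →+* K} (h0 : f ϖ' = 0) (β : GaussianInt) :
    f (β ^ ((ϖ'.norm.natAbs - 1) / 4)) = f (primeSym ϖ' β) := by
  rw [← sub_eq_zero, ← map_sub, map_eq_zero_iff_dvd hϖ' f h0]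
  exact dvd_pow_sub_primeSym hϖ' hodd β

/-! ### Reciprocity between a split Gaussian prime and a rational prime. -/

variable {p : ℕ} [Fact p.Prime] {ϖ : GaussianInt}

lemma gaussSum_ne_zero {K : Type*} [Field K] {l : ℕ} [Fact l.Prime] [CharP K l] (hlp : l ≠ p)
    (hN : ϖ.norm = p) (h2 : Odd p) {f : GaussianInt →+* K}
    (hf : ∀ a b, f (iPow a) = f (iPow b) → iPow a = iPow b)
    {ψ : AddChar (ZMod p) K} (hψ : ψ.IsPrimitive) :
    gaussSum ((quarticChar hN h2).ringHomComp f) ψ ≠ 0 := by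
  apply gaussSum_ne_zero_of_nontrivial _ _ hψ
  · rw [ZMod.card, Ne, CharP.cast_eq_zero_iff K l]
    intro h
    exact hlp ((Nat.prime_dvd_prime_iff_eq Fact.out Fact.out).1 h)
  · intro h
    exact ringHomComp_sq_ne_one hN h2 hf (by rw [h, one_mul])

lemma not_dvd_natCast_prime {l : ℕ} [Fact l.Prime] (hlp : l ≠ p) (hN : ϖ.norm = p) :
    ¬ ϖ ∣ ((l : ℤ) : GaussianInt) := by
  intro h
  have h1 := norm_dvd_norm h
  rw [hN, Zsqrtd.norm_intCast] at h1
  have h1 : p ∣ l * l := by exact_mod_cast h1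
  have hp : p.Prime := Fact.out
  exact hlp ((Nat.prime_dvd_prime_iff_eq hp Fact.out).1 ((hp.dvd_mul.1 h1).elim id id)).symm

/-- Reciprocity for a rational prime `l ≡ 1 [MOD 4]`. -/
lemma primeSym_natCast_of_mod_four_eq_one {l : ℕ} [Fact l.Prime] (hlp : l ≠ p) (hl : l % 4 = 1)
    (hN : ϖ.norm = p) (h2 : Odd p) (him : Even ϖ.im) :
    primeSym ϖ ((l : ℤ) : GaussianInt) = quarticSym (l : GaussianInt) ϖ := by
  have hl2 : Odd l := by rw [Nat.odd_iff]; omega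
  have hlp' : l.Prime := Fact.out
  have hnp : ¬ Prime (l : GaussianInt) := fun hp => by
    have := GaussianInt.mod_four_eq_three_of_nat_prime_of_prime l hp
    omega
  obtain ⟨a, b, hab⟩ := GaussianInt.sq_add_sq_of_nat_prime_of_not_irreducible l
    (by rwa [irreducible_iff_prime])
  set ρ : GaussianInt := ⟨a, b⟩
  have hNρ : ρ.norm = l := by
    rw [Zsqrtd.norm_def, ← hab]; simp only [ρ]; push_cast; ring
  have hρ := prime_of_norm_prime hlp' hNρ
  have hρodd : Odd ρ.norm := odd_norm_of_eq hNρ hl2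
  have hdl : ρ ∣ (l : GaussianInt) := dvd_natCast_of_norm hNρ
  have hl' : (l : GaussianInt) = ρ * star ρ := by
    rw [← Zsqrtd.norm_eq_mul_conj, hNρ, Int.cast_natCast]
  obtain ⟨K, _, _, f, ψ, hf0, hψ⟩ := exists_field_addChar hρ hdl hlp
  have hf := map_iPow_injective hρ hρodd hf0
  have hnd : ∀ z : GaussianInt, z.norm = p → ¬ ρ ∣ z := by
    intro z hz h
    have h1 := norm_dvd_norm h
    rw [hNρ, hz] at h1
    have h1 : l ∣ p := by exact_mod_cast h1
    exact hlp ((Nat.prime_dvd_prime_iff_eq Fact.out Fact.out).1 h1)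
  obtain ⟨k, hk, -⟩ := primeSym_spec hρ hρodd (hnd ϖ hN)
  obtain ⟨m, hm, -⟩ := primeSym_spec hρ hρodd (hnd (star ϖ) (by rwa [natAbs_norm_star]))
  obtain ⟨n, hn, -⟩ := primeSym_spec (prime_of_norm_prime Fact.out hN) (odd_norm_of_eq hN h2)
    (not_dvd_natCast_prime hlp hN)
  have hst := primeSym_star hρ hρodd (star ϖ)
  rw [star_star] at hst
  rw [hl', quarticSym_prime_mul hρ (by rwa [natAbs_norm_star]),
    quarticSym_of_prime (prime_star hρ), hst, hn, hk, hm, star_iPow, ← iPow_add]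
  set χ := (quarticChar hN h2).ringHomComp f with hχ
  have hG := gaussSum_pow_char (K := K) hlp χ ψ
  have hχl : χ l = f (iPow n) := by
    rw [hχ, MulChar.ringHomComp_apply, ← hn, ← quarticChar_intCast hN h2, Int.cast_natCast]
  have hχ4 : χ ^ 4 = 1 := by
    refine MulChar.ext fun a => ?_
    obtain ⟨k, hk⟩ := quarticChar_cases hN h2 a.ne_zero
    rw [MulChar.pow_apply_coe, hχ, MulChar.ringHomComp_apply, hk, ← map_pow, iPow_pow_four, map_one,
      MulChar.one_apply_coe]
  obtain ⟨s, hs⟩ : ∃ s, l = 4 * s + 1 := ⟨l / 4, by omega⟩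
  have hχs : χ ^ l = χ := by rw [hs, pow_succ, pow_mul, hχ4, one_pow, one_mul]
  have hfs : f (iPow n) ^ l = f (iPow n) := by
    rw [hs, pow_succ, pow_mul, ← map_pow, iPow_pow_four, map_one, one_pow, one_mul]
  have hG0 := gaussSum_ne_zero (K := K) hlp hN h2 hf hψ
  have hG4 := gaussSum_pow_four hN h2 him hf hψ
  rw [← hχ] at hG0 hG4
  -- With l = 4s+1, G^l = (G⁴)^s · G, and Euler's criterion modulo ρ evaluates (ϖ³ϖ̄)^s. Comparison
  -- with Frobenius gives n + 3k + m ≡ 0, that is n ≡ k - m modulo 4.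
  have hGl : gaussSum χ ψ ^ l = f (iPow (3 * k + m)) * gaussSum χ ψ := by
    have e : s = (ρ.norm.natAbs - 1) / 4 := by rw [hNρ, Int.natAbs_natCast]; omega
    have e2 : f ((ϖ ^ 3 * star ϖ) ^ s) = f (iPow (3 * k + m)) := by
      rw [e, map_pow_eq_map_primeSym hρ hρodd hf0, primeSym_mul hρ hρodd, pow_succ, pow_two,
        primeSym_mul hρ hρodd, primeSym_mul hρ hρodd, hk, hm, ← iPow_add, ← iPow_add, ← iPow_add]
      congr 2; ring
    conv_lhs => rw [hs, pow_succ, pow_mul, hG4, ← map_pow, e2]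
  rw [hχs, hχl, hfs, hGl, ← mul_assoc, ← map_mul, ← iPow_add] at hG
  have h1 : f (iPow (n + (3 * k + m))) = f (iPow 0) := by
    rw [iPow_zero, map_one]
    exact mul_right_cancel₀ hG0 (hG.trans (one_mul _).symm)
  have h3 := iPow_inj (hf _ _ h1)
  apply iPow_congr
  show _ % _ = _ % _
  have h3 : (n + (3 * k + m)) % 4 = 0 % 4 := h3
  omega

/-- Reciprocity for a rational prime `l ≡ 3 [MOD 4]`. -/
lemma primeSym_neg_natCast_of_mod_four_eq_three {l : ℕ} [Fact l.Prime] (hlp : l ≠ p)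
    (hl : l % 4 = 3) (hN : ϖ.norm = p) (h2 : Odd p) (him : Even ϖ.im) :
    primeSym ϖ ((-(l : ℤ) : ℤ) : GaussianInt) = quarticSym (l : GaussianInt) ϖ := by
  have hl2 : Odd l := by rw [Nat.odd_iff]; omega
  have hlp' : l.Prime := Fact.out
  have hρ := GaussianInt.prime_of_nat_prime_of_mod_four_eq_three l hl
  have hρodd : Odd (l : GaussianInt).norm := by
    rw [← Int.cast_natCast, odd_norm_intCast]; exact_mod_cast hl2
  rw [quarticSym_of_prime hρ]
  obtain ⟨K, _, _, f, ψ, hf0, hψ⟩ := exists_field_addChar hρ dvd_rfl hlp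
  have hf := map_iPow_injective hρ hρodd hf0
  have hnd : ¬ (l : GaussianInt) ∣ ϖ := by
    intro h
    have h1 := norm_dvd_norm h
    rw [Zsqrtd.norm_natCast, hN] at h1
    have h1 : l ∣ p := by exact_mod_cast dvd_of_mul_right_dvd h1
    exact hlp ((Nat.prime_dvd_prime_iff_eq Fact.out Fact.out).1 h1)
  obtain ⟨k, hk, -⟩ := primeSym_spec hρ hρodd hnd
  have hnd' : ¬ ϖ ∣ ((-(l : ℤ) : ℤ) : GaussianInt) := by
    rw [Int.cast_neg, dvd_neg]
    exact not_dvd_natCast_prime hlp hN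
  obtain ⟨n, hn, -⟩ := primeSym_spec (prime_of_norm_prime Fact.out hN) (odd_norm_of_eq hN h2) hnd'
  rw [hn, hk]
  set χ := (quarticChar hN h2).ringHomComp f with hχ
  have hG := gaussSum_pow_char (K := K) hlp χ ψ
  have hχl : χ (-1) * χ l = f (iPow n) := by
    rw [← map_mul, hχ, MulChar.ringHomComp_apply, ← hn, ← quarticChar_intCast hN h2]
    congr 2; push_cast; ring
  have hχ4 : χ ^ 4 = 1 := by
    refine MulChar.ext fun a => ?_
    obtain ⟨k, hk⟩ := quarticChar_cases hN h2 a.ne_zero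
    rw [MulChar.pow_apply_coe, hχ, MulChar.ringHomComp_apply, hk, ← map_pow, iPow_pow_four, map_one,
      MulChar.one_apply_coe]
  obtain ⟨s, hs⟩ : ∃ s, l = 4 * s + 3 := ⟨l / 4, by omega⟩
  have hχs : χ ^ l = χ⁻¹ := by
    rw [hs, pow_add, pow_mul, hχ4, one_pow, one_mul, eq_inv_iff_mul_eq_one, ← pow_succ, hχ4]
  have hneg : χ (-1) * χ (-1) = 1 := by rw [← map_mul]; simp
  have hinv : χ⁻¹ (-1) = χ (-1) := by rw [MulChar.inv_apply']; congr 1; rw [inv_neg, inv_one]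
  have hχ1 : χ ≠ 1 := fun h => ringHomComp_sq_ne_one hN h2 hf (by rw [← hχ, h, one_mul])
  have hprod := gaussSum_mul_gaussSum_eq_card hχ1 hψ
  have hshift := mul_gaussSum_inv_eq_gaussSum χ⁻¹ ψ
  rw [hinv] at hshift
  rw [ZMod.card] at hprod
  have hG4 := gaussSum_pow_four hN h2 him hf hψ
  rw [← hχ] at hG4
  have hstar : f (star ϖ) = f ϖ ^ l := by
    have := (map_eq_zero_iff_dvd hρ f hf0 _).2 (inert_pow_dvd hlp' hl ϖ)
    rw [map_sub, sub_eq_zero, map_pow] at this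
    exact this.symm
  have hp : (p : K) = f ϖ ^ (l + 1) := by
    have : (p : GaussianInt) = ϖ * star ϖ := by
      rw [← Zsqrtd.norm_eq_mul_conj, hN, Int.cast_natCast]
    rw [← map_natCast f, this, map_mul, hstar, pow_succ']
  have hw : f ϖ ≠ 0 := by rwa [Ne, map_eq_zero_iff_dvd hρ f hf0]
  rw [map_mul, map_pow, hstar, ← pow_add] at hG4
  have hsym : f ϖ ^ ((l - 1) * (s + 1)) = f (iPow k) := by
    rw [← hk, ← map_pow_eq_map_primeSym hρ hρodd hf0, map_pow]
    congr 1
    rw [Zsqrtd.norm_natCast, Int.natAbs_mul, Int.natAbs_natCast]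
    have e2 : l * l - 1 = 4 * ((l - 1) * (s + 1)) := by
      rw [hs, show 4 * s + 3 - 1 = 4 * s + 2 by omega]
      have : (4 * s + 3) * (4 * s + 3) = 4 * ((4 * s + 2) * (s + 1)) + 1 := by ring
      omega
    rw [e2]; omega
  -- In K the conjugate of ϖ is ϖ^l, so G⁴ = ϖ^(l+3). With l+1 = 4(s+1), G^(l+1) has exponent
  -- (l+3)(s+1) = (l+1) + (l-1)(s+1), whose second part is Euler's exponent.
  have hGG : gaussSum χ ψ ^ l * gaussSum χ ψ = f ϖ ^ (l + 1) * f (iPow k) := by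
    have : gaussSum χ ψ ^ l * gaussSum χ ψ = (gaussSum χ ψ ^ 4) ^ (s + 1) := by
      rw [← pow_succ, ← pow_mul]; congr 1; omega
    rw [this, hG4, ← hsym, ← pow_mul, ← pow_add]
    congr 1
    rw [hs, show 4 * s + 3 - 1 = 4 * s + 2 by omega]; ring
  -- Now χ^l = χ⁻¹, so Frobenius yields G(χ⁻¹), and G(χ)G(χ⁻¹) is χ(-1)p with p = ϖ^(l+1) in K.
  -- Cancelling leaves nl + k ≡ 0 modulo 4, and l ≡ -1.
  have hfin : (χ (-1) * χ l) ^ l * (f ϖ ^ (l + 1) * f (iPow k)) = f ϖ ^ (l + 1) := by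
    have hodd : χ (-1) ^ l = χ (-1) := by
      rw [hs, show 4 * s + 3 = 2 * (2 * s + 1) + 1 by ring, pow_succ, pow_mul, pow_two, hneg,
        one_pow, one_mul]
    rw [← hGG, mul_pow, hodd]
    calc χ (-1) * χ l ^ l * (gaussSum χ ψ ^ l * gaussSum χ ψ)
        = χ (-1) * (χ l ^ l * gaussSum χ ψ ^ l) * gaussSum χ ψ := by ring
      _ = (χ (-1) * χ (-1)) * (gaussSum χ ψ * gaussSum χ⁻¹ ψ⁻¹) := by
        rw [hG, hχs, ← hshift]; ring
      _ = f ϖ ^ (l + 1) := by rw [hneg, one_mul, hprod, hp]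
  rw [hχl, ← map_pow, ← iPow_mul] at hfin
  have h1 : f (iPow (n * l + k)) = f (iPow 0) := by
    rw [iPow_zero, map_one, iPow_add, map_mul]
    apply mul_left_cancel₀ (pow_ne_zero (l + 1) hw)
    rw [mul_one]
    conv_rhs => rw [← hfin]
    ring
  have h3 := iPow_inj (hf _ _ h1)
  apply iPow_congr
  show _ % _ = _ % _
  have h3 : (n * l + k) % 4 = 0 % 4 := h3
  rw [hs, show n * ((4 * s + 3 : ℕ) : ℤ) + k = 4 * (n * s) + 3 * n + k by push_cast; ring] at h3
  omega

/-! ### Reciprocity for composite arguments. -/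

lemma iPow_eq_iff {a b : ℤ} : iPow a = iPow b ↔ (a : ZMod 4) = b := by
  rw [ZMod.intCast_eq_intCast_iff a b 4]
  exact ⟨iPow_inj, iPow_congr⟩

/-- The integer `± n` that is congruent to `1` modulo `4`, for odd `n`. -/
def primary (n : ℤ) : ℤ := if n % 4 = 1 then n else -n

lemma primary_mul {m n : ℤ} (hm : Odd m) (hn : Odd n) :
    primary (m * n) = primary m * primary n := by
  have key : ∀ a b : ℤ, (4 * a + 1) * (4 * b + 1) = 4 * (a + b + 4 * (a * b)) + 1 := fun a b => by ring
  have e : ∀ a : ℤ, primary (4 * a + 1) = 4 * a + 1 := fun a => if_pos (by omega)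
  have e' : ∀ a : ℤ, primary (-(4 * a + 1)) = 4 * a + 1 := fun a => by
    rw [primary, if_neg (by omega), neg_neg]
  have hex : ∀ {m : ℤ}, Odd m → ∃ a, m = 4 * a + 1 ∨ m = -(4 * a + 1) := by
    intro m hm
    rcases exists_eq_sign_mul_odd hm with h | h
    · exact ⟨m / 4, .inl (by omega)⟩
    · exact ⟨-m / 4, .inr (by omega)⟩
  obtain ⟨a, rfl | rfl⟩ := hex hm <;> obtain ⟨b, rfl | rfl⟩ := hex hn
  · rw [key, e, e, e, key]
  · rw [mul_neg, key, e, e', e', key]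
  · rw [neg_mul, key, e, e', e', key]
  · rw [neg_mul_neg, key, e, e', e', key]

lemma primary_neg {n : ℤ} (hn : Odd n) : primary (-n) = primary n := by
  rw [primary, primary]
  rcases exists_eq_sign_mul_odd hn with h | h
  · rw [if_neg (by omega), if_pos h, neg_neg]
  · rw [if_pos (by omega), if_neg (by omega)]

lemma odd_norm_of_re_im {z : GaussianInt} (hre : Odd z.re) (him : Even z.im) : Odd z.norm := by
  rw [Zsqrtd.norm_def, show z.re * z.re - -1 * z.im * z.im = z.re * z.re + z.im * z.im by ring]
  exact (hre.mul hre).add_even (him.mul_left _)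

lemma odd_re_of_even_im {z : GaussianInt} (h : Odd z.norm) (him : Even z.im) : Odd z.re := by
  by_contra hre
  rw [Int.not_odd_iff_even] at hre
  rw [Zsqrtd.norm_def, show z.re * z.re - -1 * z.im * z.im = z.re * z.re + z.im * z.im by ring] at h
  exact (Int.not_odd_iff_even.2 ((hre.mul_left _).add (him.mul_left _))) h

lemma even_im_mul {a b : GaussianInt} (ha : Even a.im) (hb : Even b.im) : Even (a * b).im := by
  rw [Zsqrtd.im_mul]
  exact (hb.mul_left _).add (ha.mul_right _)

/-- If both `z` and `i ^ k z` are odd with even imaginary part then `i ^ k = ± 1`. -/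
lemma iPow_eq_of_even_im {z : GaussianInt} {k : ℤ} (hz : Odd z.norm) (him : Even z.im)
    (him' : Even (iPow k * z).im) : iPow k = 1 ∨ iPow k = -1 := by
  have hre := odd_re_of_even_im hz him
  rw [Int.even_iff] at him'
  rw [Int.odd_iff] at hre
  rcases iPow_cases k with ⟨-, h⟩ | ⟨-, h⟩ | ⟨-, h⟩ | ⟨-, h⟩
  · exact .inl h
  · exfalso; rw [h, Zsqrtd.im_mul] at him'; simp only at him'; omega
  · exact .inr h
  · exfalso; rw [h, Zsqrtd.im_mul] at him'; simp only at him'; omega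

lemma exists_iPow_mul_even_im {z : GaussianInt} (hz : Odd z.norm) :
    ∃ k : ℤ, Even (iPow k * z).im := by
  rcases Int.even_or_odd z.im with h | h
  · exact ⟨0, by rwa [iPow_zero, one_mul]⟩
  · refine ⟨1, ?_⟩
    rw [iPow_one, Zsqrtd.im_mul]
    simp only [zero_mul, one_mul, zero_add]
    by_contra hre
    rw [Int.not_even_iff_odd] at hre
    rw [Zsqrtd.norm_def, show z.re * z.re - -1 * z.im * z.im = z.re * z.re + z.im * z.im by ring] at hz
    exact (Int.not_odd_iff_even.2 ((hre.mul hre).add_odd (h.mul h))) hz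

lemma quarticSym_intCast_neg_one {n : ℤ} (hn : Odd n) :
    quarticSym (n : GaussianInt) (-1) = 1 := by
  have := quarticSym_intCast_intCast hn (m := -1) isCoprime_one_right.neg_right
  simpa using this

lemma quarticSym_natPrime_self {l : ℕ} {z : GaussianInt} (h2 : Odd l) (hz : Prime z)
    (hzl : z ∣ (l : GaussianInt)) : quarticSym (l : GaussianInt) z = 0 := by
  obtain ⟨w, hw⟩ := hzl
  have hodd : Odd (l : GaussianInt).norm := by
    rw [← Int.cast_natCast, odd_norm_intCast]; exact_mod_cast h2
  rw [hw] at hodd ⊢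
  rw [odd_norm_mul] at hodd
  rw [quarticSym_prime_mul hz hodd.2, primeSym_eq_zero hz hodd.1 dvd_rfl, zero_mul]

/-- If ϖ divides l both symbols vanish. For split ϖ this is Gauss sum reciprocity; an inert ϖ is ± a
rational prime by the parity condition, and both symbols are 1. -/
lemma primeSym_primary_natPrime {ϖ : GaussianInt} (hϖ : Prime ϖ) (hodd : Odd ϖ.norm)
    (him : Even ϖ.im) {l : ℕ} (hl : l.Prime) (h2 : Odd l) :
    primeSym ϖ ((primary l : ℤ) : GaussianInt) = quarticSym (l : GaussianInt) ϖ := by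
  have := Fact.mk hl
  by_cases hdvd : ϖ ∣ (l : GaussianInt)
  · rw [quarticSym_natPrime_self h2 hϖ hdvd, primeSym_eq_zero hϖ hodd]
    rw [primary]
    split_ifs
    · rwa [Int.cast_natCast]
    · rwa [Int.cast_neg, dvd_neg, Int.cast_natCast]
  rcases prime_cases hϖ hodd with ⟨p, hp, h4, hN⟩ | ⟨r, hr, h3, ha⟩
  · have := Fact.mk hp
    have hlp : l ≠ p := by
      rintro rfl; exact hdvd (dvd_natCast_of_norm hN)
    have hp2 : Odd p := by rw [Nat.odd_iff]; omega
    rcases exists_eq_sign_mul_odd (n := l) (by exact_mod_cast h2) with h | h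
    · rw [primary, if_pos h]
      exact primeSym_natCast_of_mod_four_eq_one hlp (by omega) hN hp2 him
    · rw [primary, if_neg (by omega)]
      exact primeSym_neg_natCast_of_mod_four_eq_three hlp (by omega) hN hp2 him
  · have hrodd : Odd (r : GaussianInt).norm := by
      rw [← Int.cast_natCast, odd_norm_intCast, Int.odd_iff]; omega
    obtain ⟨u, hu⟩ := ha.symm
    obtain ⟨k, hk⟩ := exists_iPow_of_isUnit u.isUnit
    have hrϖ : ϖ = iPow k * r := by rw [← hu, ← hk, mul_comm]
    have h1 := iPow_eq_of_even_im (z := r) (k := k) hrodd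
      (by rw [Zsqrtd.im_natCast]; exact Even.zero) (hrϖ ▸ him)
    have hlr : ¬ (r : ℤ) ∣ l := by
      intro h
      apply hdvd
      rw [ha.dvd_iff_dvd_left]
      have := (Zsqrtd.intCast_dvd_intCast (d := -1) _ _).2 h
      simpa using this
    have hr2 : Odd r := by rw [Nat.odd_iff]; omega
    have hne : l ≠ r := by rintro rfl; exact hlr dvd_rfl
    have hlr' : ¬ (l : ℤ) ∣ r := by
      intro h
      exact hne ((Nat.prime_dvd_prime_iff_eq hl hr).1 (by exact_mod_cast h))
    have e1 : primeSym ϖ ((primary l : ℤ) : GaussianInt) = 1 := by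
      rw [primeSym_associated ha, ← quarticSym_of_prime (ha.prime hϖ)]
      apply quarticSym_natPrime_intCast hr hr2
      rw [primary]
      split_ifs
      · exact hlr
      · rwa [dvd_neg]
    rw [e1, hrϖ]
    rcases h1 with h1 | h1
    · rw [h1, one_mul]
      have := quarticSym_natPrime_intCast hl h2 hlr'
      rw [Int.cast_natCast] at this
      exact this.symm
    · rw [h1, neg_one_mul]
      have := quarticSym_natPrime_intCast hl h2 (m := -r) (by rwa [dvd_neg])
      rw [Int.cast_neg, Int.cast_natCast] at this
      exact this.symm

lemma primeSym_primary {ϖ : GaussianInt} (hϖ : Prime ϖ) (hodd : Odd ϖ.norm)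
    (him : Even ϖ.im) {n : ℤ} (hn : Odd n) :
    primeSym ϖ ((primary n : ℤ) : GaussianInt) = quarticSym (n : GaussianInt) ϖ := by
  refine int_odd_induction
    (P := fun n => primeSym ϖ ((primary n : ℤ) : GaussianInt) = quarticSym (n : GaussianInt) ϖ)
    hn ?_ (fun n hn ih => ?_) (fun l n hl hodd' hn ih => ?_)
  · rw [Int.cast_one, quarticSym_of_isUnit isUnit_one, primary, if_pos (by norm_num), Int.cast_one,
      primeSym_one hϖ hodd]
  · rw [primary_neg hn, ih, Int.cast_neg, quarticSym_neg_left]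
  · rw [quarticSym_natPrime_mul hodd' hn, primary_mul (by exact_mod_cast hodd') hn, Int.cast_mul,
      primeSym_mul hϖ hodd, ih, primeSym_primary_natPrime hϖ hodd him hl hodd']

/-- Quartic reciprocity between a rational integer `n ≡ 1 [ZMOD 4]` and an odd Gaussian integer
with even imaginary part. -/
theorem quarticSym_reciprocity {α : GaussianInt} (hα : Odd α.norm) (him : Even α.im) {n : ℤ}
    (hn : n % 4 = 1) : quarticSym α (n : GaussianInt) = quarticSym (n : GaussianInt) α := by
  have hodd : Odd n := by rw [Int.odd_iff]; omega
  have hnodd : Odd (n : GaussianInt).norm := odd_norm_intCast.2 hodd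
  have hprim : primary n = n := if_pos hn
  -- The prime factors of α need not have even imaginary part. Each is normalised by a unit, and the
  -- induction carries the accumulated unit, which at the end can only be ±1.
  have key : ∃ k : ℤ, Even (iPow k * α).im ∧
      quarticSym α (n : GaussianInt) = quarticSym (n : GaussianInt) (iPow k * α) := by
    refine odd_induction (P := fun α => ∃ k : ℤ, Even (iPow k * α).im ∧
      quarticSym α (n : GaussianInt) = quarticSym (n : GaussianInt) (iPow k * α)) hα
      (fun u hu => ?_) (fun ϖ α hϖ h h' ih => ?_)
    · obtain ⟨k, rfl⟩ := exists_iPow_of_isUnit hu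
      refine ⟨-k, ?_, ?_⟩
      · rw [← iPow_add, neg_add_cancel, iPow_zero]; exact Even.zero
      · rw [← iPow_add, neg_add_cancel, iPow_zero, quarticSym_of_isUnit hu, quarticSym_one hnodd]
    · obtain ⟨k, hk, hk'⟩ := ih
      obtain ⟨m, hm⟩ := exists_iPow_mul_even_im h
      have hass : Associated ϖ (iPow m * ϖ) :=
        ⟨(isUnit_iPow m).unit, mul_comm _ _⟩
      have hp' := hass.prime hϖ
      have hodd' : Odd (iPow m * ϖ).norm := by
        rw [odd_norm_mul]
        exact ⟨odd_norm_of_dvd (β := 1) (by decide) (isUnit_iff_dvd_one.1 (isUnit_iPow m)), h⟩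
      have := primeSym_primary hp' hodd' hm hodd
      rw [hprim] at this
      refine ⟨m + k, ?_, ?_⟩
      · rw [iPow_add, mul_mul_mul_comm]; exact even_im_mul hm hk
      · rw [quarticSym_prime_mul hϖ h', primeSym_associated hass, this, hk', iPow_add,
          mul_mul_mul_comm, quarticSym_mul_right hnodd (iPow m * ϖ)]
  obtain ⟨k, hk, hk'⟩ := key
  rw [hk', quarticSym_mul_right hnodd]
  rcases iPow_eq_of_even_im hα him hk with h | h
  · rw [h, quarticSym_one hnodd, one_mul]
  · rw [h, quarticSym_intCast_neg_one hodd, one_mul]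

/-! ### Explicit reciprocity and the supplementary laws for 2 and 1-i. -/

lemma norm_mk (A B : ℤ) : Zsqrtd.norm (⟨A, B⟩ : GaussianInt) = A * A + B * B := by
  rw [Zsqrtd.norm_def]; ring

lemma odd_norm_mk {A B : ℤ} (hA : Odd A) : Odd (Zsqrtd.norm (⟨A, 2 * B⟩ : GaussianInt)) :=
  odd_norm_of_re_im hA (even_two_mul B)

/-- `χ_α(i ^ k)` for `α = (2 A + 1) + 2 B i`. -/
lemma quarticSym_mk_iPow (A B k : ℤ) :
    quarticSym ⟨2 * A + 1, 2 * B⟩ (iPow k) = iPow (k * (A ^ 2 + A + B ^ 2)) := by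
  rw [quarticSym_iPow (odd_norm_mk (odd_two_mul_add_one A)), norm_mk]
  congr 2
  rw [show (2 * A + 1) * (2 * A + 1) + 2 * B * (2 * B) - 1 = 4 * (A ^ 2 + A + B ^ 2) by ring]
  omega

lemma quarticSym_int_iPow (A k : ℤ) :
    quarticSym ((2 * A + 1 : ℤ) : GaussianInt) (iPow k) = iPow (k * (A ^ 2 + A)) := by
  have := quarticSym_mk_iPow A 0 k
  rw [Zsqrtd.intCast_val]
  simpa using this

/-- Quartic reciprocity between an odd rational integer and `(2 A + 1) + 2 B i`. -/
lemma quarticSym_mk_intCast (A B : ℤ) {m : ℤ} (hm : Odd m) :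
    quarticSym ⟨2 * A + 1, 2 * B⟩ (m : GaussianInt) =
      quarticSym (m : GaussianInt) ⟨2 * A + 1, 2 * B⟩ * iPow ((m - 1) * B) := by
  have hodd := odd_norm_mk (B := B) (odd_two_mul_add_one A)
  rcases exists_eq_sign_mul_odd hm with h | h
  · rw [quarticSym_reciprocity hodd (even_two_mul B) h]
    obtain ⟨s, rfl⟩ : ∃ s, m = 4 * s + 1 := ⟨m / 4, by omega⟩
    have : iPow ((4 * s + 1 - 1) * B) = iPow 0 := by
      rw [iPow_eq_iff]; push_cast
      have : (4 : ZMod 4) = 0 := by decide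
      rw [this]; ring
    rw [this, iPow_zero, mul_one]
  · have e : (m : GaussianInt) = iPow 2 * ((-m : ℤ) : GaussianInt) := by
      rw [iPow_two]; push_cast; ring
    conv_lhs => rw [e, quarticSym_mul_right hodd,
      quarticSym_reciprocity hodd (even_two_mul B) (show (-m) % 4 = 1 by omega)]
    rw [Int.cast_neg, quarticSym_neg_left, mul_comm, quarticSym_mk_iPow]
    congr 1
    obtain ⟨s, rfl⟩ : ∃ s, m = 4 * s + 3 := ⟨m / 4, by omega⟩
    rw [iPow_eq_iff]; push_cast
    generalize (A : ZMod 4) = a; generalize (B : ZMod 4) = b; generalize (s : ZMod 4) = s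
    revert a b s; decide

lemma quarticSym_intCast_one_sub_i {n : ℤ} (hn : n % 4 = 1) :
    quarticSym (n : GaussianInt) ⟨1, -1⟩ = iPow (-((n - 1) / 4)) := by
  have hodd : Odd (n : GaussianInt).norm := odd_norm_intCast.2 (by rw [Int.odd_iff]; omega)
  have := quarticSym_star hodd ⟨1, 1⟩
  rw [star_intCast, quarticSym_intCast_one_add_i hn, star_iPow] at this
  exact this

lemma isCoprime_intCast {m n : ℤ} (h : IsCoprime m n) :
    IsCoprime (m : GaussianInt) (n : GaussianInt) := by
  simpa using h.map (Int.castRingHom GaussianInt)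

/-- The basic relation determining `χ_α(1 - i)` for a primitive `α`. -/
lemma quarticSym_mk_one_sub_i (A B : ℤ) (h : IsCoprime (2 * A + 1) (2 * B)) :
    quarticSym ⟨2 * A + 1, 2 * B⟩ ⟨1, -1⟩ * iPow (A ^ 2 + A + 2 * A * B) =
      iPow (3 * (A ^ 2 + A + B ^ 2) + 2 * (A + B) * B) *
        quarticSym ((2 * (A + B) + 1 : ℤ) : GaussianInt) ⟨1, -1⟩ := by
  have hodd := odd_norm_mk (B := B) (odd_two_mul_add_one A)
  set α : GaussianInt := ⟨2 * A + 1, 2 * B⟩ with hα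
  -- Modulo α one has 2A+1 ≡ -i·2B and 2(A+B)+1 ≡ (1-i)·2B. Comparing the two eliminates 2B and
  -- isolates 1-i.
  have e1 : quarticSym α ((2 * A + 1 : ℤ) : GaussianInt) =
      quarticSym α (iPow 3) * quarticSym α ((2 * B : ℤ) : GaussianInt) := by
    rw [← quarticSym_mul_right hodd]
    apply quarticSym_congr hodd
    have : ((2 * A + 1 : ℤ) : GaussianInt) - iPow 3 * ((2 * B : ℤ) : GaussianInt) = α := by
      rw [iPow_three, hα]; ext <;> simp
    rw [this]
  have e2 : quarticSym α ((2 * (A + B) + 1 : ℤ) : GaussianInt) =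
      quarticSym α ⟨1, -1⟩ * quarticSym α ((2 * B : ℤ) : GaussianInt) := by
    rw [← quarticSym_mul_right hodd]
    apply quarticSym_congr hodd
    have : ((2 * (A + B) + 1 : ℤ) : GaussianInt) - ⟨1, -1⟩ * ((2 * B : ℤ) : GaussianInt) = α := by
      rw [hα]; ext <;> simp <;> ring
    rw [this]
  -- After inversion the rational moduli simplify α: it is i·2B modulo 2A+1, and (1-i)(2A+1) modulo
  -- 2(A+B)+1.
  have e3 : quarticSym ((2 * A + 1 : ℤ) : GaussianInt) α = iPow (A ^ 2 + A) := by
    have ho : Odd ((2 * A + 1 : ℤ) : GaussianInt).norm := odd_norm_intCast.2 (odd_two_mul_add_one A)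
    have : quarticSym ((2 * A + 1 : ℤ) : GaussianInt) α =
        quarticSym ((2 * A + 1 : ℤ) : GaussianInt) (iPow 1 * ((2 * B : ℤ) : GaussianInt)) := by
      apply quarticSym_congr ho
      have : α - iPow 1 * ((2 * B : ℤ) : GaussianInt) = ((2 * A + 1 : ℤ) : GaussianInt) := by
        rw [iPow_one, hα]; ext <;> simp
      rw [this]
    rw [this, quarticSym_mul_right ho, quarticSym_intCast_intCast (odd_two_mul_add_one A) h, mul_one,
      quarticSym_int_iPow, one_mul]
  have hcop : IsCoprime (2 * (A + B) + 1) (2 * A + 1) := by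
    have := h.symm.add_mul_left_left 1
    rwa [show 2 * B + (2 * A + 1) * 1 = 2 * (A + B) + 1 by ring] at this
  have e4 : quarticSym ((2 * (A + B) + 1 : ℤ) : GaussianInt) α =
      quarticSym ((2 * (A + B) + 1 : ℤ) : GaussianInt) ⟨1, -1⟩ := by
    have ho : Odd ((2 * (A + B) + 1 : ℤ) : GaussianInt).norm :=
      odd_norm_intCast.2 (odd_two_mul_add_one _)
    have : quarticSym ((2 * (A + B) + 1 : ℤ) : GaussianInt) α =
        quarticSym ((2 * (A + B) + 1 : ℤ) : GaussianInt) (⟨1, -1⟩ * ((2 * A + 1 : ℤ) : GaussianInt)) := by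
      apply quarticSym_congr ho
      have : α - ⟨1, -1⟩ * ((2 * A + 1 : ℤ) : GaussianInt) =
          ((2 * (A + B) + 1 : ℤ) : GaussianInt) * iPow 1 := by
        rw [iPow_one, hα]; ext <;> simp <;> ring
      rw [this]; exact dvd_mul_right _ _
    rw [this, quarticSym_mul_right ho, quarticSym_intCast_intCast (odd_two_mul_add_one _) hcop,
      mul_one]
  have e5 : quarticSym α (iPow 3) = iPow (3 * (A ^ 2 + A + B ^ 2)) := quarticSym_mk_iPow A B 3
  rw [quarticSym_mk_intCast A B (odd_two_mul_add_one A), ← hα, e3, e5, ← iPow_add] at e1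
  rw [quarticSym_mk_intCast A B (odd_two_mul_add_one _), ← hα, e4] at e2
  rw [show A ^ 2 + A + 2 * A * B = A ^ 2 + A + (2 * A + 1 - 1) * B by ring, e1, iPow_add,
    mul_left_comm, ← e2, mul_comm (quarticSym _ _), ← mul_assoc]
  congr 2
  congr 1; ring

/-- `χ_α(2) = i ^ (A B / 2)` for a primitive `α = A + B i` with `A` odd and `B` even. -/
theorem quarticSym_mk_two (A B : ℤ) (h : IsCoprime (2 * A + 1) (2 * B)) :
    quarticSym ⟨2 * A + 1, 2 * B⟩ 2 = iPow ((2 * A + 1) * B) := by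
  have hodd := odd_norm_mk (B := B) (odd_two_mul_add_one A)
  have ho : Odd ((2 * (A + B) + 1 : ℤ) : GaussianInt).norm :=
    odd_norm_intCast.2 (odd_two_mul_add_one _)
  have key := quarticSym_mk_one_sub_i A B h
  -- Because 2 = i(1-i)², the square of the relation for 1-i is enough, and modulo a rational
  -- integer the symbol of (1-i)² = -2i is known in every residue class.
  have hsq : quarticSym ((2 * (A + B) + 1 : ℤ) : GaussianInt) ⟨1, -1⟩ ^ 2 =
      iPow (3 * ((A + B) ^ 2 + (A + B))) := by
    rw [← quarticSym_pow ho, show (⟨1, -1⟩ : GaussianInt) ^ 2 = iPow 3 * ((2 : ℤ) : GaussianInt) by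
      rw [iPow_three]; decide, quarticSym_mul_right ho, quarticSym_int_iPow,
      quarticSym_intCast_intCast (odd_two_mul_add_one _), mul_one]
    exact ⟨1, -(A + B), by ring⟩
  have key2 := congrArg (· ^ 2) key
  simp only [mul_pow, hsq, ← iPow_mul] at key2
  rw [show (2 : GaussianInt) = iPow 1 * ⟨1, -1⟩ ^ 2 by rw [iPow_one]; decide,
    quarticSym_mul_right hodd, quarticSym_mk_iPow, quarticSym_pow hodd]
  apply mul_right_cancel₀ (iPow_ne_zero ((A ^ 2 + A + 2 * A * B) * (2 : ℕ)))
  rw [mul_assoc, key2, ← iPow_add, ← iPow_add, ← iPow_add, iPow_eq_iff]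
  push_cast
  generalize (A : ZMod 4) = a; generalize (B : ZMod 4) = b
  revert a b; decide

/-- `χ_α(1 - i)` for a primitive `α ≡ 1` modulo `4`. -/
lemma quarticSym_one_sub_i_of_mod_four (A B : ℤ) (h : IsCoprime (4 * A + 1) (4 * B)) :
    quarticSym ⟨4 * A + 1, 4 * B⟩ ⟨1, -1⟩ = iPow (-A - B) := by
  have key := quarticSym_mk_one_sub_i (2 * A) (2 * B) (by convert h using 1 <;> ring)
  rw [quarticSym_intCast_one_sub_i (by omega), ← iPow_add,
    show (2 * (2 * A + 2 * B) + 1 - 1) / 4 = A + B by omega] at key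
  rw [show (4 * A + 1) = 2 * (2 * A) + 1 by ring, show 4 * B = 2 * (2 * B) by ring]
  apply mul_right_cancel₀ (iPow_ne_zero ((2 * A) ^ 2 + 2 * A + 2 * (2 * A) * (2 * B)))
  rw [key, ← iPow_add, iPow_eq_iff]
  push_cast
  generalize (A : ZMod 4) = a; generalize (B : ZMod 4) = b
  revert a b; decide

/-! ### Tools for moving symbols between moduli. -/

/-- Since β divides its norm, an identity for the norm becomes an equality of symbols modulo β. This
is how the representation of p by x² + 2qy² enters. -/
lemma quarticSym_eq_of_mul_norm {β : GaussianInt} (hβ : Odd β.norm) {m n k : ℤ}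
    (h : k * β.norm = m - n) : quarticSym β (m : GaussianInt) = quarticSym β (n : GaussianInt) := by
  apply quarticSym_congr hβ
  have := congrArg (Int.cast : ℤ → GaussianInt) h
  rw [Int.cast_mul, Zsqrtd.norm_eq_mul_conj, Int.cast_sub] at this
  exact ⟨k * star β, by rw [← this]; ring⟩

lemma quarticSym_intCast_congr {n : ℤ} (hn : Odd n) {z w : GaussianInt} (hre : n ∣ z.re - w.re)
    (him : n ∣ z.im - w.im) : quarticSym (n : GaussianInt) z = quarticSym (n : GaussianInt) w := by
  apply quarticSym_congr (odd_norm_intCast.2 hn)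
  rw [Zsqrtd.intCast_dvd]
  exact ⟨by simpa using hre, by simpa using him⟩

lemma quarticSym_intCast_two {n : ℤ} (hn : Odd n) : quarticSym (n : GaussianInt) 2 = 1 := by
  obtain ⟨k, rfl⟩ := hn
  have := quarticSym_intCast_intCast (odd_two_mul_add_one k) (m := 2) ⟨1, -k, by ring⟩
  simpa using this

lemma quarticSym_intCast_two_pow {n : ℤ} (hn : Odd n) (k : ℕ) :
    quarticSym (n : GaussianInt) (2 ^ k) = 1 := by
  rw [quarticSym_pow (odd_norm_intCast.2 hn), quarticSym_intCast_two hn, one_pow]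

lemma eq_iPow_of_mul_eq {z : GaussianInt} {a b c : ℤ} (h : iPow a * z = iPow b)
    (hc : (a + c : ZMod 4) = b) : z = iPow c := by
  apply mul_left_cancel₀ (iPow_ne_zero a)
  rw [h, ← iPow_add, iPow_eq_iff, ← hc]; push_cast; ring

/-- The square of the symbol of an odd rational integer does not depend on the order. -/
lemma quarticSym_mk_intCast_sq (A B : ℤ) {m : ℤ} (hm : Odd m) :
    quarticSym ⟨2 * A + 1, 2 * B⟩ (m : GaussianInt) ^ 2 =
      quarticSym (m : GaussianInt) (⟨2 * A + 1, 2 * B⟩ ^ 2) := by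
  rw [quarticSym_mk_intCast A B hm, mul_pow, ← iPow_mul, quarticSym_pow (odd_norm_intCast.2 hm)]
  obtain ⟨k, rfl⟩ := hm
  have : iPow ((2 * k + 1 - 1) * B * (2 : ℕ)) = iPow 0 := by
    rw [iPow_eq_iff]; push_cast
    generalize (k : ZMod 4) = k; generalize (B : ZMod 4) = b
    revert k b; decide
  rw [this, iPow_zero, mul_one]

lemma isCoprime_of_dvd_sub {n a b : ℤ} (h : IsCoprime n a) (hd : n ∣ a - b) : IsCoprime n b := by
  obtain ⟨k, hk⟩ := hd
  obtain ⟨r, s, hrs⟩ := h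
  exact ⟨r + s * k, s, by rw [← hrs]; linear_combination (-s) * hk⟩

/-- Reciprocity needs an odd argument, so a factor 1+i of α has to be divided out first. -/
lemma quarticSym_primary_of_one_add_i {n : ℤ} {k : ℤ} {β α : GaussianInt} (hα : α = ⟨1, 1⟩ * β)
    (hn : n % 4 = 1) (h : quarticSym (n : GaussianInt) α = iPow k) :
    quarticSym (n : GaussianInt) β = iPow (k - (n - 1) / 4) := by
  have ho : Odd (n : GaussianInt).norm := odd_norm_intCast.2 (by rw [Int.odd_iff]; omega)
  rw [hα, quarticSym_mul_right ho, quarticSym_intCast_one_add_i hn] at h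
  exact eq_iPow_of_mul_eq h (by push_cast; ring)

/-! ### The symbols of π + ix and π + x modulo q. -/

/-- The symbol of `π + i x` modulo `q`, where `π = (4 c + 1) + 4 d i` and `x = 4 x + 1`. -/
lemma quarticSym_add_i_mul {c d x Q y₀ X Y : ℤ} {s : ℕ} (hy : Odd y₀)
    (hrel : 2 * c ^ 2 + c + 2 * d ^ 2 = 2 * x ^ 2 + x + (8 * Q + 1) * (2 ^ s * y₀) ^ 2)
    (hcop : IsCoprime (4 * c + 1) (4 * x + 1 + 4 * d))
    (hX : quarticSym ((4 * x + 1 : ℤ) : GaussianInt) ⟨4 * c + 1, 4 * d⟩ = iPow X)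
    (hY : quarticSym (y₀ : GaussianInt) ⟨4 * c + 1, 4 * d⟩ = iPow Y) :
    quarticSym ((8 * Q + 1 : ℤ) : GaussianInt) ⟨4 * c + 1, 4 * x + 1 + 4 * d⟩ =
      iPow (X - Y - 2 * (s + 1) * d - 2 * x + d + 2 * Q) := by
  set E := c + x + d with hE
  set F := x + d - c with hF
  set β : GaussianInt := ⟨2 * E + 1, 2 * F⟩ with hβ
  have hodd : Odd β.norm := odd_norm_mk (odd_two_mul_add_one E)
  -- Both coordinates of α = π + ix are odd; β is what remains after removing 1+i, and has even
  -- imaginary part.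
  have hαβ : (⟨4 * c + 1, 4 * x + 1 + 4 * d⟩ : GaussianInt) = ⟨1, 1⟩ * β := by
    ext <;> simp [hβ, hE, hF] <;> ring
  have hqo : Odd ((8 * Q + 1 : ℤ) : GaussianInt).norm := odd_norm_intCast.2 ⟨4 * Q, by ring⟩
  have hxo : Odd (4 * x + 1) := ⟨2 * x, by ring⟩
  have hxdo : Odd (4 * x + 1 + 4 * d) := ⟨2 * x + 2 * d, by ring⟩
  have hxdy : IsCoprime (4 * x + 1 + 4 * d) y₀ := by
    have h1 : IsCoprime (4 * x + 1 + 4 * d) ((4 * c + 1) ^ 2) := hcop.symm.pow_right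
    have h2 : IsCoprime (4 * x + 1 + 4 * d) ((8 * (8 * Q + 1) * 2 ^ (2 * s) * y₀) * y₀) :=
      isCoprime_of_dvd_sub h1 ⟨4 * x + 1 - 4 * d, by
        rw [pow_mul, pow_right_comm]; linear_combination 8 * hrel⟩
    exact h2.of_mul_right_right
  -- In the original variables N(β) = x(x+d) + qy², so qy² ≡ -x(x+d) modulo β. Here `hrel` is the
  -- equality of the two forms for p, divided by 8, with 2^s y₀ = y/2.
  have hmain : quarticSym β (((8 * Q + 1) * (2 * (2 ^ s * y₀)) ^ 2 : ℤ) : GaussianInt) =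
      quarticSym β ((-1 * (4 * x + 1) * (4 * x + 1 + 4 * d) : ℤ) : GaussianInt) := by
    apply quarticSym_eq_of_mul_norm hodd (k := 1)
    rw [hβ, norm_mk, hE, hF]; linear_combination 4 * hrel
  have hneg : quarticSym β (-1) = iPow (2 * (E ^ 2 + E + F ^ 2)) := by
    rw [← iPow_two]; exact quarticSym_mk_iPow E F 2
  have hx : quarticSym β ((4 * x + 1 : ℤ) : GaussianInt) = iPow (X - x) := by
    rw [quarticSym_reciprocity hodd (even_two_mul F) (by omega)]
    have : quarticSym ((4 * x + 1 : ℤ) : GaussianInt) ⟨4 * c + 1, 4 * x + 1 + 4 * d⟩ = iPow X := by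
      rw [← hX]
      exact quarticSym_intCast_congr hxo ⟨0, by ring⟩ ⟨1, by ring⟩
    rw [quarticSym_primary_of_one_add_i hαβ (by omega) this]
    congr 2; omega
  have hxd : quarticSym β ((4 * x + 1 + 4 * d : ℤ) : GaussianInt) = iPow (-x - d) := by
    rw [quarticSym_reciprocity hodd (even_two_mul F) (by omega)]
    have : quarticSym ((4 * x + 1 + 4 * d : ℤ) : GaussianInt) ⟨4 * c + 1, 4 * x + 1 + 4 * d⟩ =
        iPow 0 := by
      rw [iPow_zero, ← quarticSym_intCast_intCast hxdo hcop.symm]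
      refine quarticSym_intCast_congr hxdo ⟨0, ?_⟩ ⟨1, ?_⟩
      · rw [Zsqrtd.re_intCast]; ring
      · rw [Zsqrtd.im_intCast]; ring
    rw [quarticSym_primary_of_one_add_i hαβ (by omega) this]
    congr 1; omega
  have h2 : quarticSym β 2 = iPow ((2 * E + 1) * F) := by
    apply quarticSym_mk_two
    obtain ⟨r, t, h⟩ := hcop
    have h1 : IsCoprime (2 * E + 1) F :=
      ⟨r + t, 2 * (t - r), by rw [hE, hF]; linear_combination h⟩
    exact IsCoprime.mul_right ⟨1, -E, by ring⟩ h1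
  have hy2 : quarticSym β (y₀ : GaussianInt) ^ 2 = iPow Y := by
    rw [hβ, quarticSym_mk_intCast_sq E F hy, ← hβ, ← hY]
    -- Modulo y, x² ≡ ππ̄ gives (π+ix)² ≡ 2i(x+d)π, and 2i = (1+i)² is cancelled.
    have h1 : quarticSym (y₀ : GaussianInt) (β ^ 2) = quarticSym (y₀ : GaussianInt)
        (⟨4 * c + 1, 4 * d⟩ * ((4 * x + 1 + 4 * d : ℤ) : GaussianInt)) := by
      refine quarticSym_intCast_congr hy ⟨0, ?_⟩ ⟨-4 * (8 * Q + 1) * 2 ^ (2 * s) * y₀, ?_⟩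
      · simp only [pow_two, Zsqrtd.re_mul, Zsqrtd.re_intCast, Zsqrtd.im_intCast, hβ, hE, hF]; ring
      · simp only [pow_two, Zsqrtd.im_mul, Zsqrtd.re_intCast, Zsqrtd.im_intCast, hβ, hE, hF]
        rw [pow_mul, pow_right_comm]
        linear_combination -4 * hrel
    rw [h1, quarticSym_mul_right (odd_norm_intCast.2 hy), quarticSym_intCast_intCast hy hxdy.symm,
      mul_one]
  -- If s > 0 then `hrel` forces x ≡ c modulo 2; if s = 0 then s + 2 is even. The dependence of the
  -- exponent on s is reconciled by this.
  have hpar : (2 : ℤ) ∣ (s + 2) * (x - c) := by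
    rcases Nat.eq_zero_or_pos s with rfl | hs
    · exact ⟨x - c, by push_cast; ring⟩
    · obtain ⟨k, rfl⟩ : ∃ k, s = k + 1 := ⟨s - 1, by omega⟩
      refine Dvd.dvd.mul_left ⟨c ^ 2 + d ^ 2 - x ^ 2 - (8 * Q + 1) * 2 * (2 ^ k * y₀) ^ 2, ?_⟩ _
      rw [pow_succ] at hrel
      linear_combination -hrel
  have hexp : (((8 * Q + 1) * (2 * (2 ^ s * y₀)) ^ 2 : ℤ) : GaussianInt) =
      ((8 * Q + 1 : ℤ) : GaussianInt) * (2 ^ (2 * (s + 1)) * (y₀ : GaussianInt) ^ 2) := by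
    push_cast; ring
  rw [hexp, quarticSym_mul_right hodd, quarticSym_mul_right hodd, quarticSym_pow hodd,
    quarticSym_pow hodd, h2, hy2, ← iPow_mul, ← iPow_add, Int.cast_mul, Int.cast_mul,
    quarticSym_mul_right hodd, quarticSym_mul_right hodd, hx, hxd, Int.cast_neg, Int.cast_one,
    hneg, ← iPow_add, ← iPow_add, mul_comm] at hmain
  rw [hαβ, quarticSym_mul_right hqo, quarticSym_intCast_one_add_i (by omega),
    ← quarticSym_reciprocity hodd (even_two_mul F) (by omega),
    eq_iPow_of_mul_eq (c := X - Y - 2 * (s + 1) * d - 2 * x + d) hmain, ← iPow_add]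
  · congr 1; omega
  · obtain ⟨k, hk⟩ := hpar
    have hk' := congrArg (Int.cast : ℤ → ZMod 4) hk
    push_cast [hE, hF] at hk' ⊢
    have aux : ∀ c d x s : ZMod 4, 2 * ((s + 2) * (x - c)) = 0 →
        2 * (s + 1) * ((2 * (c + x + d) + 1) * (x + d - c)) - 2 * (s + 1) * d - 2 * x + d =
          2 * ((c + x + d) ^ 2 + (c + x + d) + (x + d - c) ^ 2) - 2 * x - d := by decide
    have h4 : (4 : ZMod 4) = 0 := by decide
    linear_combination aux c d x s (by rw [hk']; linear_combination (k : ZMod 4) * h4)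

/-- A common factor of n and y would divide 2d². The odd part of x+c is thereby coprime to y₀. -/
lemma isCoprime_of_dvd_form {n q t y d : ℤ} (hn : Odd n) (hd : IsCoprime n d)
    (h : n ∣ q * (t * y) ^ 2 - 2 * d ^ 2) : IsCoprime n y := by
  have h2 : IsCoprime n 2 := by obtain ⟨k, rfl⟩ := hn; exact ⟨1, -k, by ring⟩
  have h3 : IsCoprime n (2 * d ^ 2) := h2.mul_right hd.pow_right
  have h4 : IsCoprime n ((q * t ^ 2 * y) * y) := isCoprime_of_dvd_sub h3 (by
    obtain ⟨k, hk⟩ := h; exact ⟨-k, by linear_combination -hk⟩)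
  exact h4.of_mul_right_right

lemma zmod_four_eq_zero : (4 : ZMod 4) = 0 := by decide

/-- The symbol of `π + x` modulo `q`, where `π = (4 c + 1) + 4 d i` and `x = 4 x + 1`. -/
lemma quarticSym_add_of_mod_four_eq_one {c d x Q y₀ X Y : ℤ} {s : ℕ} (hy : Odd y₀)
    (hrel : 2 * c ^ 2 + c + 2 * d ^ 2 = 2 * x ^ 2 + x + (8 * Q + 1) * (2 ^ s * y₀) ^ 2)
    (hcop : IsCoprime (2 * (x + c) + 1) d)
    (hX : quarticSym ((4 * x + 1 : ℤ) : GaussianInt) ⟨4 * c + 1, 4 * d⟩ = iPow X)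
    (hY : quarticSym (y₀ : GaussianInt) ⟨4 * c + 1, 4 * d⟩ = iPow Y) :
    quarticSym ((8 * Q + 1 : ℤ) : GaussianInt) ⟨4 * x + 1 + (4 * c + 1), 4 * d⟩ =
      iPow (X - Y - 2 * (s + 1) * d - 2 * x + d) := by
  set A := x + c with hA
  set β : GaussianInt := ⟨2 * A + 1, 2 * d⟩ with hβ
  have hodd : Odd β.norm := odd_norm_mk (odd_two_mul_add_one A)
  have hαβ : (⟨4 * x + 1 + (4 * c + 1), 4 * d⟩ : GaussianInt) = 2 * β := by
    ext <;> simp [hβ, hA] <;> ring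
  have hqo : Odd (8 * Q + 1) := ⟨4 * Q, by ring⟩
  have hxo : Odd (4 * x + 1) := ⟨2 * x, by ring⟩
  have hAo := odd_two_mul_add_one A
  have hAy : IsCoprime (2 * A + 1) y₀ := isCoprime_of_dvd_form (q := 8 * Q + 1) (t := 2 ^ s) hAo hcop
    ⟨c - x, by rw [hA]; linear_combination -hrel⟩
  -- Here N(β) = N(π+x)/4, and x+c equals 2(2A+1) in the original variables.
  have hmain : quarticSym β (((8 * Q + 1) * (2 * (2 ^ s * y₀) ^ 2) : ℤ) : GaussianInt) =
      quarticSym β ((-1 * (4 * x + 1) * (2 * A + 1) : ℤ) : GaussianInt) := by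
    apply quarticSym_eq_of_mul_norm hodd (k := 1)
    rw [hβ, norm_mk, hA]; linear_combination 2 * hrel
  have hneg : quarticSym β (-1) = iPow (2 * (A ^ 2 + A + d ^ 2)) := by
    rw [← iPow_two]; exact quarticSym_mk_iPow A d 2
  have hx : quarticSym β ((4 * x + 1 : ℤ) : GaussianInt) = iPow X := by
    rw [quarticSym_reciprocity hodd (even_two_mul d) (by omega), ← hX,
      ← one_mul (quarticSym _ β), ← quarticSym_intCast_two hxo,
      ← quarticSym_mul_right (odd_norm_intCast.2 hxo), ← hαβ]
    exact quarticSym_intCast_congr hxo ⟨1, by ring⟩ ⟨0, by ring⟩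
  have hn : quarticSym β ((2 * A + 1 : ℤ) : GaussianInt) = iPow (A ^ 2 + A + 2 * A * d) := by
    rw [hβ, quarticSym_mk_intCast A d hAo]
    have : quarticSym ((2 * A + 1 : ℤ) : GaussianInt) ⟨2 * A + 1, 2 * d⟩ =
        quarticSym ((2 * A + 1 : ℤ) : GaussianInt) (iPow 1 * ((2 * d : ℤ) : GaussianInt)) := by
      refine quarticSym_intCast_congr hAo ⟨1, ?_⟩ ⟨0, ?_⟩
      · simp [iPow_one]
      · simp [iPow_one]
    rw [this, quarticSym_mul_right (odd_norm_intCast.2 hAo),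
      quarticSym_intCast_intCast hAo (IsCoprime.mul_right ⟨1, -A, by ring⟩ hcop), mul_one,
      quarticSym_int_iPow, ← iPow_add]
    congr 1; ring
  have h2 : quarticSym β 2 = iPow ((2 * A + 1) * d) :=
    quarticSym_mk_two A d (IsCoprime.mul_right ⟨1, -A, by ring⟩ hcop)
  have hy2 : quarticSym β (y₀ : GaussianInt) ^ 2 = iPow Y := by
    rw [hβ, quarticSym_mk_intCast_sq A d hy, ← hβ, ← hY]
    -- This is (π+x)² ≡ 2(x+c)π modulo y, divided by 4.
    have h1 : quarticSym (y₀ : GaussianInt) (β ^ 2) = quarticSym (y₀ : GaussianInt)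
        (⟨4 * c + 1, 4 * d⟩ * ((2 * A + 1 : ℤ) : GaussianInt)) := by
      refine quarticSym_intCast_congr hy ⟨-2 * (8 * Q + 1) * 2 ^ (2 * s) * y₀, ?_⟩ ⟨0, ?_⟩
      · simp only [pow_two, Zsqrtd.re_mul, Zsqrtd.re_intCast, Zsqrtd.im_intCast, hβ, hA]
        rw [pow_mul, pow_right_comm]
        linear_combination -2 * hrel
      · simp only [pow_two, Zsqrtd.im_mul, Zsqrtd.re_intCast, Zsqrtd.im_intCast, hβ, hA]; ring
    rw [h1, quarticSym_mul_right (odd_norm_intCast.2 hy), quarticSym_intCast_intCast hy hAy.symm,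
      mul_one]
  have hexp : (((8 * Q + 1) * (2 * (2 ^ s * y₀) ^ 2) : ℤ) : GaussianInt) =
      ((8 * Q + 1 : ℤ) : GaussianInt) * (2 ^ (2 * s + 1) * (y₀ : GaussianInt) ^ 2) := by
    push_cast; ring
  rw [hexp, quarticSym_mul_right hodd, quarticSym_mul_right hodd, quarticSym_pow hodd,
    quarticSym_pow hodd, h2, hy2, ← iPow_mul, ← iPow_add, Int.cast_mul, Int.cast_mul,
    quarticSym_mul_right hodd, quarticSym_mul_right hodd, hx, hn, Int.cast_neg, Int.cast_one,
    hneg, ← iPow_add, ← iPow_add, mul_comm] at hmain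
  rw [hαβ, quarticSym_mul_right (odd_norm_intCast.2 hqo), quarticSym_intCast_two hqo, one_mul,
    ← quarticSym_reciprocity hodd (even_two_mul d) (by omega)]
  apply eq_iPow_of_mul_eq hmain
  have hk := congrArg (Int.cast : ℤ → ZMod 4) hrel
  push_cast [hA] at hk ⊢
  generalize ((2 : ZMod 4) ^ s * (y₀ : ZMod 4)) = u at *
  generalize (c : ZMod 4) = c at *; generalize (d : ZMod 4) = d at *
  generalize (x : ZMod 4) = x at *; generalize (s : ZMod 4) = s at *
  have aux1 : ∀ u c d x : ZMod 4, 2 * c ^ 2 + c + 2 * d ^ 2 = 2 * x ^ 2 + x + u ^ 2 →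
      (x + c) ^ 2 + (x + c) + 2 * d ^ 2 + 2 * x = 0 := by decide
  have aux2 : ∀ a : ZMod 4, 2 * (a ^ 2 + a) = 0 := by decide
  have h4 := zmod_four_eq_zero
  linear_combination -aux1 u c d x (by linear_combination hk + 2 * u ^ 2 * (Q : ZMod 4) * h4)
    - aux2 (x + c) + s * (x + c) * d * h4

lemma exists_sq_eq_of_odd {w : ℤ} : ∃ m, w ^ 2 + w = 2 * m ∧ (2 * w + 1) ^ 2 = 8 * m + 1 := by
  obtain ⟨m, hm⟩ := Int.even_mul_succ_self w
  exact ⟨m, by linear_combination hm, by linear_combination 4 * hm⟩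

/-- In exponents of i only the class of 4^s modulo 4 matters: it is 1 for s = 0 and 0 otherwise. -/
lemma two_pow_two_mul_eq (s : ℕ) : s = 0 ∨ ∃ k : ℤ, (2 : ℤ) ^ (2 * s) = 4 * k := by
  rcases Nat.eq_zero_or_pos s with h | h
  · exact .inl h
  · obtain ⟨k, rfl⟩ : ∃ k, s = k + 1 := ⟨s - 1, by omega⟩
    exact .inr ⟨2 ^ (2 * k), by ring⟩

/-- The symbol of `π + x` modulo `q`, where `π = (4 c + 1) + 4 d i` and `x = 4 x - 1`, when
`d` is `2`-adically smaller than `x + c`. -/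
lemma quarticSym_add_of_lt {c d x Q y₀ X Y n G : ℤ} {s : ℕ} (hy : Odd y₀)
    (hrel : 2 * c ^ 2 + c + 2 * d ^ 2 = 2 * x ^ 2 - x + (8 * Q + 1) * (2 ^ s * y₀) ^ 2)
    (hn : x + c = 2 ^ (2 * s) * (2 * n + 1)) (hd : d = 2 ^ (2 * s) * (2 * G))
    (hcop : IsCoprime (2 * n + 1) d)
    (hX : quarticSym ((1 - 4 * x : ℤ) : GaussianInt) ⟨4 * c + 1, 4 * d⟩ = iPow X)
    (hY : quarticSym (y₀ : GaussianInt) ⟨4 * c + 1, 4 * d⟩ = iPow Y) :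
    quarticSym ((8 * Q + 1 : ℤ) : GaussianInt) ⟨4 * x - 1 + (4 * c + 1), 4 * d⟩ =
      iPow (X - Y - 2 * (s + 1) * d - 2 * x + d) := by
  have hPs := two_pow_two_mul_eq s
  have hu : (2 ^ s * y₀) ^ 2 = 2 ^ (2 * s) * y₀ ^ 2 := by ring
  have h2P : (2 : GaussianInt) ^ (2 * s + 2) = ((4 * 2 ^ (2 * s) : ℤ) : GaussianInt) := by
    push_cast; ring
  have h2P' : (2 : GaussianInt) ^ (2 * s + 1) = ((2 * 2 ^ (2 * s) : ℤ) : GaussianInt) := by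
    push_cast; ring
  have hcop' : ∀ z : ℤ, 2 * n + 1 ∣ (8 * Q + 1) * (2 ^ s * z) ^ 2 - 2 * d ^ 2 → IsCoprime (2 * n + 1) z :=
    fun z h => isCoprime_of_dvd_form (odd_two_mul_add_one n) hcop h
  have hP0 : (2 : ℤ) ^ (2 * s) ≠ 0 := by positivity
  generalize hP : (2 : ℤ) ^ (2 * s) = P at *
  obtain rfl : c = P * (2 * n + 1) - x := by linear_combination hn
  subst hd
  -- This is `hrel` in the form (x+c)(1+2(c-x)) = (8Q+1)(2^s y₀)² - 2d², divided by P = 4^s.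
  have hrel' : (2 * n + 1) * (1 + 2 * (P * (2 * n + 1) - 2 * x)) =
      (8 * Q + 1) * y₀ ^ 2 - 2 * P * (2 * G) ^ 2 := by
    apply mul_left_cancel₀ hP0
    rw [hu] at hrel
    linear_combination hrel
  set β : GaussianInt := ⟨2 * n + 1, 2 * G⟩ with hβ
  have hodd : Odd β.norm := odd_norm_mk (odd_two_mul_add_one n)
  have hαβ : (⟨4 * x - 1 + (4 * (P * (2 * n + 1) - x) + 1), 4 * (P * (2 * G))⟩ : GaussianInt) =
      2 ^ (2 * s + 2) * β := by
    rw [h2P]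
    ext
    · rw [Zsqrtd.re_smul]; ring
    · rw [Zsqrtd.im_smul]; ring
  have hqo : Odd (8 * Q + 1) := ⟨4 * Q, by ring⟩
  have hxo : Odd (1 - 4 * x) := ⟨-2 * x, by ring⟩
  have hno := odd_two_mul_add_one n
  have hcopG : IsCoprime (2 * n + 1) (2 * G) := hcop.of_mul_right_right
  have hny : IsCoprime (2 * n + 1) y₀ := hcop' _ ⟨P * (1 + 2 * (P * (2 * n + 1) - 2 * x)), by
    linear_combination -hrel⟩
  have hmain : quarticSym β (((8 * Q + 1) * y₀ ^ 2 : ℤ) : GaussianInt) =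
      quarticSym β (((1 - 4 * x) * (2 * n + 1) : ℤ) : GaussianInt) := by
    apply quarticSym_eq_of_mul_norm hodd (k := 2 * P)
    rw [hβ, norm_mk]; linear_combination hrel'
  have hx : quarticSym β ((1 - 4 * x : ℤ) : GaussianInt) = iPow X := by
    rw [quarticSym_reciprocity hodd (even_two_mul G) (by omega), ← hX,
      ← one_mul (quarticSym _ β), ← quarticSym_intCast_two_pow hxo (2 * s + 2),
      ← quarticSym_mul_right (odd_norm_intCast.2 hxo), ← hαβ]
    exact quarticSym_intCast_congr hxo ⟨-1, by ring⟩ ⟨0, by ring⟩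
  have hn : quarticSym β ((2 * n + 1 : ℤ) : GaussianInt) = iPow (n ^ 2 + n + 2 * n * G) := by
    rw [hβ, quarticSym_mk_intCast n G hno]
    have : quarticSym ((2 * n + 1 : ℤ) : GaussianInt) ⟨2 * n + 1, 2 * G⟩ =
        quarticSym ((2 * n + 1 : ℤ) : GaussianInt) (iPow 1 * ((2 * G : ℤ) : GaussianInt)) := by
      refine quarticSym_intCast_congr hno ⟨1, ?_⟩ ⟨0, ?_⟩
      · simp [iPow_one]
      · simp [iPow_one]
    rw [this, quarticSym_mul_right (odd_norm_intCast.2 hno),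
      quarticSym_intCast_intCast hno hcopG, mul_one, quarticSym_int_iPow, ← iPow_add]
    congr 1; ring
  have hy2 : quarticSym β (y₀ : GaussianInt) ^ 2 = iPow Y := by
    rw [hβ, quarticSym_mk_intCast_sq n G hy, ← hβ, ← hY,
      ← one_mul (quarticSym _ (β ^ 2)), ← quarticSym_intCast_two_pow hy (2 * s + 1),
      ← quarticSym_mul_right (odd_norm_intCast.2 hy), h2P',
      ← mul_one (quarticSym _ ⟨_, 4 * (P * (2 * G))⟩), ← quarticSym_intCast_intCast hy hny.symm,
      ← quarticSym_mul_right (odd_norm_intCast.2 hy)]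
    refine quarticSym_intCast_congr hy ⟨-(8 * Q + 1) * y₀, ?_⟩ ⟨0, ?_⟩
    · rw [Zsqrtd.re_smul]
      simp only [pow_two, Zsqrtd.re_mul, Zsqrtd.re_intCast, Zsqrtd.im_intCast, hβ]
      linear_combination -hrel'
    · rw [Zsqrtd.im_smul]
      simp only [pow_two, Zsqrtd.im_mul, Zsqrtd.re_intCast, Zsqrtd.im_intCast, hβ]; ring
  rw [Int.cast_mul, Int.cast_mul, Int.cast_pow, quarticSym_mul_right hodd,
    quarticSym_mul_right hodd, quarticSym_pow hodd, hy2, hx, hn, ← iPow_add, mul_comm] at hmain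
  rw [hαβ, quarticSym_mul_right (odd_norm_intCast.2 hqo), quarticSym_intCast_two_pow hqo, one_mul,
    ← quarticSym_reciprocity hodd (even_two_mul G) (by omega)]
  apply eq_iPow_of_mul_eq hmain
  obtain ⟨w, rfl⟩ := hy
  obtain ⟨m, -, hm⟩ := exists_sq_eq_of_odd (w := w)
  rw [hm] at hrel'
  -- Expanding `hrel'` gives n + P ≡ 2x modulo 4, the congruence that reconciles the two exponents.
  have hk : n + P - 2 * x =
      4 * (Q * (8 * m + 1) + m - P * G ^ 2 - P * (n ^ 2 + n) + x * n) := by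
    linarith only [hrel']
  have h4 := zmod_four_eq_zero
  have hk' := congrArg (Int.cast : ℤ → ZMod 4) hk
  push_cast at hk' ⊢
  rw [h4, zero_mul] at hk'
  have hP' : s = 0 ∧ (P : ZMod 4) = 1 ∨ (P : ZMod 4) = 0 := by
    rcases hPs with rfl | ⟨k, rfl⟩
    · left; exact ⟨rfl, by rw [← hP]; simp⟩
    · right; push_cast; rw [h4, zero_mul]
  generalize (n : ZMod 4) = n at *; generalize (x : ZMod 4) = x at *
  generalize (G : ZMod 4) = G at *
  have aux1 : ∀ n x G s : ZMod 4, n + 1 - 2 * x = 0 →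
      -2 * (s + 1) * (1 * (2 * G)) - 2 * x + 1 * (2 * G) = n ^ 2 + n + 2 * n * G := by decide
  have aux0 : ∀ n x G s : ZMod 4, n + 0 - 2 * x = 0 →
      -2 * (s + 1) * (0 * (2 * G)) - 2 * x + 0 * (2 * G) = n ^ 2 + n + 2 * n * G := by decide
  rcases hP' with ⟨-, h⟩ | h <;> rw [h] at hk' ⊢
  · linear_combination aux1 n x G s hk'
  · linear_combination aux0 n x G s hk'

/-- The symbol of `π + x` modulo `q`, where `π = (4 c + 1) + 4 d i` and `x = 4 x - 1`, when
`d` and `x + c` have the same `2`-adic valuation. -/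
lemma quarticSym_add_of_eq {c d x Q y₀ X Y n δ : ℤ} {s : ℕ} (hy : Odd y₀)
    (hrel : 2 * c ^ 2 + c + 2 * d ^ 2 = 2 * x ^ 2 - x + (8 * Q + 1) * (2 ^ s * y₀) ^ 2)
    (hn : x + c = 2 ^ (2 * s) * (4 * n + 1)) (hd : d = 2 ^ (2 * s) * (4 * δ + 1))
    (hcop : IsCoprime (4 * n + 1) d)
    (hX : quarticSym ((1 - 4 * x : ℤ) : GaussianInt) ⟨4 * c + 1, 4 * d⟩ = iPow X)
    (hY : quarticSym (y₀ : GaussianInt) ⟨4 * c + 1, 4 * d⟩ = iPow Y) :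
    quarticSym ((8 * Q + 1 : ℤ) : GaussianInt) ⟨4 * x - 1 + (4 * c + 1), 4 * d⟩ =
      iPow (X - Y - 2 * (s + 1) * d - 2 * x + d) := by
  have hPs := two_pow_two_mul_eq s
  have hu : (2 ^ s * y₀) ^ 2 = 2 ^ (2 * s) * y₀ ^ 2 := by ring
  have h2P : (2 : GaussianInt) ^ (2 * s + 2) = ((4 * 2 ^ (2 * s) : ℤ) : GaussianInt) := by
    push_cast; ring
  have hcop' : ∀ z : ℤ, 4 * n + 1 ∣ (8 * Q + 1) * (2 ^ s * z) ^ 2 - 2 * d ^ 2 → IsCoprime (4 * n + 1) z :=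
    fun z h => isCoprime_of_dvd_form ⟨2 * n, by ring⟩ hcop h
  have hP0 : (2 : ℤ) ^ (2 * s) ≠ 0 := by positivity
  generalize hP : (2 : ℤ) ^ (2 * s) = P at *
  obtain rfl : c = P * (4 * n + 1) - x := by linear_combination hn
  subst hd
  have hrel' : (4 * n + 1) * (1 + 2 * (P * (4 * n + 1) - 2 * x)) =
      (8 * Q + 1) * y₀ ^ 2 - 2 * P * (4 * δ + 1) ^ 2 := by
    apply mul_left_cancel₀ hP0
    rw [hu] at hrel
    linear_combination hrel
  set β : GaussianInt := ⟨2 * (n + δ) + 1, 2 * (δ - n)⟩ with hβ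
  have hodd : Odd β.norm := odd_norm_mk (odd_two_mul_add_one _)
  have him : Even β.im := even_two_mul (δ - n)
  -- With equal valuations, removing the power of 2 leaves two odd coordinates, so a factor 1+i must
  -- go as well.
  have hγ : (⟨4 * n + 1, 4 * δ + 1⟩ : GaussianInt) = ⟨1, 1⟩ * β := by
    ext <;> simp [hβ] <;> ring
  have hαγ : (⟨4 * x - 1 + (4 * (P * (4 * n + 1) - x) + 1), 4 * (P * (4 * δ + 1))⟩ : GaussianInt) =
      2 ^ (2 * s + 2) * ⟨4 * n + 1, 4 * δ + 1⟩ := by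
    rw [h2P]
    ext
    · rw [Zsqrtd.re_smul]; ring
    · rw [Zsqrtd.im_smul]; ring
  have hqo : Odd (8 * Q + 1) := ⟨4 * Q, by ring⟩
  have hxo : Odd (1 - 4 * x) := ⟨-2 * x, by ring⟩
  have hno : Odd (4 * n + 1) := ⟨2 * n, by ring⟩
  have hcopδ : IsCoprime (4 * n + 1) (4 * δ + 1) := hcop.of_mul_right_right
  have hny : IsCoprime (4 * n + 1) y₀ := hcop' _ ⟨P * (1 + 2 * (P * (4 * n + 1) - 2 * x)), by
    linear_combination -hrel⟩
  have hmain : quarticSym β (((8 * Q + 1) * y₀ ^ 2 : ℤ) : GaussianInt) =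
      quarticSym β (((1 - 4 * x) * (4 * n + 1) : ℤ) : GaussianInt) := by
    apply quarticSym_eq_of_mul_norm hodd (k := 4 * P)
    rw [hβ, norm_mk]; linear_combination hrel'
  have hx : quarticSym β ((1 - 4 * x : ℤ) : GaussianInt) = iPow (X + x) := by
    rw [quarticSym_reciprocity hodd him (by omega)]
    have : quarticSym ((1 - 4 * x : ℤ) : GaussianInt) ⟨4 * n + 1, 4 * δ + 1⟩ = iPow X := by
      rw [← hX, ← one_mul (quarticSym _ _), ← quarticSym_intCast_two_pow hxo (2 * s + 2),
        ← quarticSym_mul_right (odd_norm_intCast.2 hxo), ← hαγ]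
      exact quarticSym_intCast_congr hxo ⟨-1, by ring⟩ ⟨0, by ring⟩
    rw [quarticSym_primary_of_one_add_i hγ (by omega) this]
    congr 1; omega
  have hn : quarticSym β ((4 * n + 1 : ℤ) : GaussianInt) = iPow n := by
    rw [quarticSym_reciprocity hodd him (by omega)]
    have : quarticSym ((4 * n + 1 : ℤ) : GaussianInt) ⟨4 * n + 1, 4 * δ + 1⟩ =
        quarticSym ((4 * n + 1 : ℤ) : GaussianInt) (iPow 1 * ((4 * δ + 1 : ℤ) : GaussianInt)) := by
      refine quarticSym_intCast_congr hno ⟨1, ?_⟩ ⟨0, ?_⟩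
      · simp [iPow_one]
      · simp [iPow_one]
    rw [quarticSym_mul_right (odd_norm_intCast.2 hno),
      quarticSym_intCast_intCast hno hcopδ, mul_one,
      show 4 * n + 1 = 2 * (2 * n) + 1 by ring, quarticSym_int_iPow] at this
    rw [show 4 * n + 1 = 2 * (2 * n) + 1 by ring, quarticSym_primary_of_one_add_i
      (show _ = ⟨1, 1⟩ * β by rw [← hγ]) (by omega)
      (by rw [← this, show 4 * n + 1 = 2 * (2 * n) + 1 by ring])]
    apply iPow_congr
    rw [Int.ModEq, show (2 * (2 * n) + 1 - 1) / 4 = n by omega]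
    ring_nf; omega
  obtain ⟨w, rfl⟩ := hy
  have hyo := odd_two_mul_add_one w
  have hy2 : quarticSym β ((2 * w + 1 : ℤ) : GaussianInt) ^ 2 = iPow (Y - (w ^ 2 + w)) := by
    rw [hβ, quarticSym_mk_intCast_sq _ _ hyo, ← hβ]
    refine eq_iPow_of_mul_eq (a := 1 * (w ^ 2 + w)) (b := Y) ?_ (by push_cast; ring)
    rw [← quarticSym_int_iPow, ← quarticSym_mul_right (odd_norm_intCast.2 hyo), ← hY,
      ← one_mul (quarticSym _ (_ * _)), ← quarticSym_intCast_two_pow hyo (2 * s + 2),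
      ← quarticSym_mul_right (odd_norm_intCast.2 hyo), h2P,
      ← mul_one (quarticSym _ ⟨_, 4 * (P * (4 * δ + 1))⟩),
      ← quarticSym_intCast_intCast hyo hny.symm,
      ← quarticSym_mul_right (odd_norm_intCast.2 hyo)]
    refine quarticSym_intCast_congr hyo ⟨-(8 * Q + 1) * (2 * w + 1), ?_⟩ ⟨0, ?_⟩
    · rw [Zsqrtd.re_smul]
      simp only [pow_two, iPow_one, Zsqrtd.re_mul, Zsqrtd.im_mul, Zsqrtd.re_intCast,
        Zsqrtd.im_intCast, hβ]
      linear_combination -hrel'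
    · rw [Zsqrtd.im_smul]
      simp only [pow_two, iPow_one, Zsqrtd.re_mul, Zsqrtd.im_mul, Zsqrtd.re_intCast,
        Zsqrtd.im_intCast, hβ]
      ring
  rw [Int.cast_mul, Int.cast_mul, Int.cast_pow, quarticSym_mul_right hodd,
    quarticSym_mul_right hodd, quarticSym_pow hodd, hy2, hx, hn, ← iPow_add, mul_comm] at hmain
  obtain ⟨m, hm', hm⟩ := exists_sq_eq_of_odd (w := w)
  rw [hm] at hrel'
  rw [hαγ, hγ, quarticSym_mul_right (odd_norm_intCast.2 hqo), quarticSym_intCast_two_pow hqo,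
    one_mul, quarticSym_mul_right (odd_norm_intCast.2 hqo),
    quarticSym_intCast_one_add_i (by omega), ← quarticSym_reciprocity hodd him (by omega),
    eq_iPow_of_mul_eq hmain (c := X + x + n - Y + 2 * m) (by rw [hm']; push_cast; ring), ← iPow_add,
    show (8 * Q + 1 - 1) / 4 = 2 * Q by omega, iPow_eq_iff]
  have hk : n + P - x - 2 * (Q + m) =
      4 * (4 * Q * m - P * (2 * δ ^ 2 + δ) - P * (2 * n ^ 2 + n) + n * x) := by
    linarith only [hrel']
  have h4 := zmod_four_eq_zero
  have hk' := congrArg (Int.cast : ℤ → ZMod 4) hk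
  push_cast at hk' ⊢
  rw [h4, zero_mul] at hk'
  rcases hPs with rfl | ⟨k, rfl⟩
  · rw [pow_zero] at hP
    rw [← hP] at hk' ⊢
    push_cast at hk' ⊢
    linear_combination hk' + (m + Q + x + δ) * h4
  · push_cast at hk' ⊢
    simp only [h4, zero_mul, mul_zero, add_zero] at hk' ⊢
    linear_combination hk' + (m + Q + x) * h4

/-- The symbol of `π + x` modulo `q`, where `π = (4 c + 1) + 4 d i` and `x = 4 x - 1`, when
`x + c` is `2`-adically smaller than `d`. -/
lemma quarticSym_add_of_gt {c d x Q y₀ X Y n δ G k : ℤ} {s e v j : ℕ} (hy : Odd y₀)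
    (hrel : 2 * c ^ 2 + c + 2 * d ^ 2 = 2 * x ^ 2 - x + (8 * Q + 1) * (2 ^ s * y₀) ^ 2)
    (hn : x + c = 2 ^ v * (2 * n + 1)) (hG : x + c = 2 ^ e * (2 * G)) (hd : d = 2 ^ e * (2 * δ + 1))
    (hcop : IsCoprime (2 * n + 1) d) (hnG : 2 * n + 1 ∣ G) (hδG : IsCoprime (2 * δ + 1) G)
    (hk : k * ((2 * δ + 1) ^ 2 + (2 * G) ^ 2) =
      (8 * Q + 1) * (2 ^ j * y₀ ^ 2) - (1 - 4 * x) * (2 * n + 1))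
    (hX : quarticSym ((1 - 4 * x : ℤ) : GaussianInt) ⟨4 * c + 1, 4 * d⟩ = iPow X)
    (hY : quarticSym (y₀ : GaussianInt) ⟨4 * c + 1, 4 * d⟩ = iPow Y) :
    quarticSym ((8 * Q + 1 : ℤ) : GaussianInt) ⟨4 * x - 1 + (4 * c + 1), 4 * d⟩ =
      iPow (X - Y - 2 * x - 2 * n * G + j * ((2 * δ + 1) * G)) := by
  set β : GaussianInt := ⟨2 * δ + 1, 2 * -G⟩ with hβ
  have hodd : Odd β.norm := odd_norm_mk (odd_two_mul_add_one _)
  have him : Even β.im := even_two_mul _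
  -- Now the imaginary part has the smaller valuation; the factor i brings the odd coordinate into
  -- the real part.
  have hα : (⟨4 * x - 1 + (4 * c + 1), 4 * d⟩ : GaussianInt) = 2 ^ (e + 2) * (iPow 1 * β) := by
    rw [show (2 : GaussianInt) ^ (e + 2) = ((4 * 2 ^ e : ℤ) : GaussianInt) by push_cast; ring]
    ext
    · rw [Zsqrtd.re_smul, Zsqrtd.re_mul, iPow_one]; linear_combination 4 * hG
    · rw [Zsqrtd.im_smul, Zsqrtd.im_mul, iPow_one]; linear_combination 4 * hd
  have hqo : Odd (8 * Q + 1) := ⟨4 * Q, by ring⟩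
  have hxo : Odd (1 - 4 * x) := ⟨-2 * x, by ring⟩
  have hno := odd_two_mul_add_one n
  have hny : IsCoprime (2 * n + 1) y₀ := isCoprime_of_dvd_form (q := 8 * Q + 1) (t := 2 ^ s) hno hcop
    ⟨2 ^ v * (1 + 2 * (c - x)), by linear_combination (1 + 2 * (c - x)) * hn - hrel⟩
  -- The hypothesis `hk` is the norm relation with common powers of 2 removed; j and k record those
  -- that remain on either side.
  have hmain : quarticSym β (((8 * Q + 1) * (2 ^ j * y₀ ^ 2) : ℤ) : GaussianInt) =
      quarticSym β (((1 - 4 * x) * (2 * n + 1) : ℤ) : GaussianInt) := by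
    apply quarticSym_eq_of_mul_norm hodd (k := k)
    rw [hβ, norm_mk]; linear_combination hk
  have hx : quarticSym β ((1 - 4 * x : ℤ) : GaussianInt) = iPow (X - 2 * x) := by
    rw [quarticSym_reciprocity hodd him (by omega)]
    refine eq_iPow_of_mul_eq (a := 1 * ((-2 * x) ^ 2 + -2 * x)) (b := X) ?_ ?_
    · rw [← quarticSym_int_iPow, show 2 * (-2 * x) + 1 = 1 - 4 * x by ring,
        ← quarticSym_mul_right (odd_norm_intCast.2 hxo), ← hX, ← one_mul (quarticSym _ (_ * _)),
        ← quarticSym_intCast_two_pow hxo (e + 2), ← quarticSym_mul_right (odd_norm_intCast.2 hxo),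
        ← hα]
      exact quarticSym_intCast_congr hxo ⟨-1, by ring⟩ ⟨0, by ring⟩
    · push_cast
      linear_combination ((x : ZMod 4) ^ 2 - x) * zmod_four_eq_zero
  have hn' : quarticSym β ((2 * n + 1 : ℤ) : GaussianInt) = iPow (-(2 * n * G)) := by
    rw [hβ, quarticSym_mk_intCast δ (-G) hno]
    have : quarticSym ((2 * n + 1 : ℤ) : GaussianInt) ⟨2 * δ + 1, 2 * -G⟩ =
        quarticSym ((2 * n + 1 : ℤ) : GaussianInt) ((2 * δ + 1 : ℤ) : GaussianInt) := by
      refine quarticSym_intCast_congr hno ⟨0, ?_⟩ ?_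
      · rw [Zsqrtd.re_intCast]; ring
      · rw [Zsqrtd.im_intCast, sub_zero]; exact (hnG.neg_right.mul_left 2)
    rw [hd] at hcop
    rw [this, quarticSym_intCast_intCast hno hcop.of_mul_right_right, one_mul]
    congr 1; ring
  have h2 : quarticSym β 2 = iPow ((2 * δ + 1) * -G) :=
    quarticSym_mk_two δ (-G) (IsCoprime.mul_right ⟨1, -δ, by ring⟩ hδG.neg_right)
  have hy2 : quarticSym β (y₀ : GaussianInt) ^ 2 = iPow Y := by
    rw [hβ, quarticSym_mk_intCast_sq _ _ hy, ← hβ, ← hY]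
    -- Modulo y₀, (π+x)² ≡ 2(x+c)π becomes -2^(2e+1) β² ≡ 2^v (2n+1)π. The rational factors have
    -- symbol 1 and are inserted for this comparison.
    have h1 := quarticSym_intCast_intCast hy (m := -1) isCoprime_one_right.neg_right
    rw [← one_mul (quarticSym _ (β ^ 2)), ← h1, ← one_mul (quarticSym _ _ * _),
      ← quarticSym_intCast_two_pow hy (2 * e + 1),
      ← mul_one (quarticSym _ ⟨_, 4 * d⟩), ← quarticSym_intCast_intCast hy hny.symm,
      ← one_mul (quarticSym _ ⟨_, 4 * d⟩ * _), ← quarticSym_intCast_two_pow hy v,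
      ← quarticSym_mul_right (odd_norm_intCast.2 hy), ← quarticSym_mul_right (odd_norm_intCast.2 hy),
      ← quarticSym_mul_right (odd_norm_intCast.2 hy), ← quarticSym_mul_right (odd_norm_intCast.2 hy),
      show (2 : GaussianInt) ^ (2 * e + 1) = ((2 * 2 ^ e * 2 ^ e : ℤ) : GaussianInt) by push_cast; ring,
      show (2 : GaussianInt) ^ v = ((2 ^ v : ℤ) : GaussianInt) by push_cast; ring]
    have hu : (2 ^ s * y₀) ^ 2 = 2 ^ (2 * s) * y₀ ^ 2 := by ring
    rw [hu] at hrel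
    refine quarticSym_intCast_congr hy ⟨-(8 * Q + 1) * 2 ^ (2 * s) * y₀, ?_⟩ ⟨0, ?_⟩
    · rw [Zsqrtd.re_smul, Zsqrtd.re_smul]
      simp only [pow_two, Zsqrtd.re_mul, Zsqrtd.im_mul, Zsqrtd.re_intCast,
        Zsqrtd.im_intCast, hβ]
      linear_combination (4 * c + 1) * hn - 2 * (x + c + 2 ^ e * (2 * G)) * hG +
        2 * (d + 2 ^ e * (2 * δ + 1)) * hd - hrel
    · rw [Zsqrtd.im_smul, Zsqrtd.im_smul]
      simp only [pow_two, Zsqrtd.im_mul, Zsqrtd.re_mul, Zsqrtd.re_intCast, Zsqrtd.im_intCast, hβ]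
      linear_combination 4 * d * hn - 4 * d * hG - 8 * 2 ^ e * G * hd
  rw [Int.cast_mul, Int.cast_mul, Int.cast_mul, Int.cast_pow, Int.cast_pow,
    quarticSym_mul_right hodd, quarticSym_mul_right hodd, quarticSym_mul_right hodd,
    quarticSym_pow hodd, quarticSym_pow hodd, hy2, hx, hn', Int.cast_ofNat, h2, ← iPow_mul,
    ← iPow_add, ← iPow_add, mul_comm] at hmain
  have hqi : quarticSym ((8 * Q + 1 : ℤ) : GaussianInt) (iPow 1) = 1 := by
    have := quarticSym_int_iPow (4 * Q) 1
    rw [show 2 * (4 * Q) + 1 = 8 * Q + 1 by ring] at this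
    rw [this, ← iPow_zero, iPow_eq_iff]
    push_cast
    linear_combination (4 * (Q : ZMod 4) ^ 2 + Q) * zmod_four_eq_zero
  rw [hα, quarticSym_mul_right (odd_norm_intCast.2 hqo), quarticSym_intCast_two_pow hqo, one_mul,
    quarticSym_mul_right (odd_norm_intCast.2 hqo), hqi, one_mul,
    ← quarticSym_reciprocity hodd him (by omega)]
  exact eq_iPow_of_mul_eq hmain (by push_cast; ring)

lemma eq_of_two_pow_mul_eq {v w : ℕ} {a b : ℤ} (ha : Odd a) (hb : Odd b)
    (h : 2 ^ v * a = 2 ^ w * b) : v = w := by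
  have key : ∀ {v w : ℕ} {a b : ℤ}, Odd a → 2 ^ v * a = 2 ^ w * b → w ≤ v := by
    intro v w a b ha h
    have h1 : (2 : ℤ) ^ w ∣ 2 ^ v * a := ⟨b, h⟩
    have h2 : IsCoprime ((2 : ℤ) ^ w) a := by
      obtain ⟨k, rfl⟩ := ha
      exact IsCoprime.pow_left ⟨-k, 1, by ring⟩
    exact (pow_dvd_pow_iff (by norm_num) Int.prime_two.not_isUnit).1 (h2.dvd_of_dvd_mul_right h1)
  exact le_antisymm (key hb h.symm) (key ha h)

lemma exists_eq_two_pow_mul_odd_int {z : ℤ} (hz : z ≠ 0) :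
    ∃ (v : ℕ) (n : ℤ), z = 2 ^ v * n ∧ Odd n := by
  obtain ⟨n, h1, h2⟩ := (Int.finiteMultiplicity_iff (a := 2).2 ⟨by norm_num, hz⟩).exists_eq_pow_mul_and_not_dvd
  exact ⟨_, n, h1, Int.not_even_iff_odd.1 (fun h => h2 h.two_dvd)⟩

/-- The symbol of `π + x` modulo `q`, where `π = (4 c + 1) + 4 d i` and `x = 4 x - 1`. -/
lemma quarticSym_add_of_mod_four_eq_three {c d x Q y₀ X Y δ : ℤ} {s e : ℕ} (hy : Odd y₀)
    (hrel : 2 * c ^ 2 + c + 2 * d ^ 2 = 2 * x ^ 2 - x + (8 * Q + 1) * (2 ^ s * y₀) ^ 2)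
    (hd : d = 2 ^ e * (4 * δ + 1)) (hcop : IsCoprime (4 * δ + 1) (x + c))
    (hX : quarticSym ((1 - 4 * x : ℤ) : GaussianInt) ⟨4 * c + 1, 4 * d⟩ = iPow X)
    (hY : quarticSym (y₀ : GaussianInt) ⟨4 * c + 1, 4 * d⟩ = iPow Y) :
    quarticSym ((8 * Q + 1 : ℤ) : GaussianInt) ⟨4 * x - 1 + (4 * c + 1), 4 * d⟩ =
      iPow (X - Y - 2 * (s + 1) * d - 2 * x + d) := by
  have hfac : (x + c) * (1 + 2 * (c - x)) =
      (8 * Q + 1) * (2 ^ s * y₀) ^ 2 - 2 * (2 ^ e * (4 * δ + 1)) ^ 2 := by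
    rw [← hd]; linear_combination hrel
  have hqy : Odd ((8 * Q + 1) * y₀ ^ 2) := Odd.mul ⟨4 * Q, by ring⟩ hy.pow
  have hδ : Odd (4 * δ + 1) := ⟨2 * δ, by ring⟩
  -- The factor 1+2(c-x) is odd, so x+c has the 2-adic valuation of the right side of `hfac`. This
  -- is min(2s, 2e+1), and a tie is impossible by parity.
  have hval : ∃ (w : ℕ) (b : ℤ), Odd b ∧ (x + c) * (1 + 2 * (c - x)) = 2 ^ w * b ∧
      (s ≤ e ∧ w = 2 * s ∨ e < s ∧ w = 2 * e + 1) := by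
    rcases le_or_gt s e with h | h
    · obtain ⟨k, rfl⟩ := Nat.exists_eq_add_of_le h
      refine ⟨2 * s, (8 * Q + 1) * y₀ ^ 2 - 2 * (2 ^ k * (4 * δ + 1)) ^ 2,
        hqy.sub_even (even_two_mul _), ?_, .inl ⟨h, rfl⟩⟩
      rw [hfac]; ring
    · obtain ⟨k, rfl⟩ := Nat.exists_eq_add_of_lt h
      refine ⟨2 * e + 1, 2 * ((8 * Q + 1) * (2 ^ k * y₀) ^ 2) - (4 * δ + 1) ^ 2,
        (even_two_mul _).sub_odd hδ.pow, ?_, .inr ⟨h, rfl⟩⟩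
      rw [hfac]; ring
  obtain ⟨w, b, hb, hw, hcase⟩ := hval
  have hne : x + c ≠ 0 := by
    rintro h
    rw [h, zero_mul] at hw
    rcases mul_eq_zero.1 hw.symm with h | h
    · exact absurd h (by positivity)
    · rw [h] at hb; exact absurd hb (by decide)
  obtain ⟨v, n', hv, n, rfl⟩ := exists_eq_two_pow_mul_odd_int hne
  obtain rfl : v = w := by
    rw [hv, mul_assoc] at hw
    exact eq_of_two_pow_mul_eq (Odd.mul (odd_two_mul_add_one n) ⟨c - x, by ring⟩) hb hw
  have hnδ : IsCoprime (2 * n + 1) (4 * δ + 1) := by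
    rw [hv] at hcop; exact hcop.of_mul_right_right.symm
  have hnd : IsCoprime (2 * n + 1) d := by
    rw [hd]; exact IsCoprime.mul_right (IsCoprime.pow_right ⟨1, -n, by ring⟩) hnδ
  have hδpow : ∀ g : ℕ, IsCoprime (2 * (2 * δ) + 1) (2 ^ g * (2 * n + 1)) := fun g =>
    IsCoprime.mul_right (IsCoprime.pow_right ⟨1, -(2 * δ), by ring⟩)
      (by rw [← mul_assoc]; exact hnδ.symm)
  have hpow : ∀ k : ℕ, (2 : ℤ) ^ k ≠ 0 := fun k => by positivity
  have hN : 2 * (x + c) ^ 2 + 2 * d ^ 2 =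
      (4 * x - 1) * (x + c) + (8 * Q + 1) * (2 ^ s * y₀) ^ 2 := by linear_combination hrel
  rw [hv, hd] at hN
  rcases hcase with ⟨hse, rfl⟩ | ⟨hes, rfl⟩
  · obtain ⟨k, rfl⟩ := Nat.exists_eq_add_of_le hse
    obtain ⟨m, hm⟩ : ∃ m, y₀ ^ 2 = 8 * m + 1 := by
      obtain ⟨w, rfl⟩ := hy
      obtain ⟨m, -, hm⟩ := exists_sq_eq_of_odd (w := w)
      exact ⟨m, hm⟩
    have hfac' : (2 * n + 1) * (1 + 2 * (2 ^ (2 * s) * (2 * n + 1) - 2 * x)) =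
        (8 * Q + 1) * (8 * m + 1) - 2 * (2 ^ k * (4 * δ + 1)) ^ 2 := by
      apply mul_left_cancel₀ (hpow (2 * s))
      rw [show c = 2 ^ (2 * s) * (2 * n + 1) - x by linear_combination hv] at hfac
      rw [← hm]
      linear_combination hfac
    -- Here x+c has valuation 2s and d has valuation e = s+k, so comparing k with s compares the
    -- two.
    rcases lt_trichotomy k s with h | rfl | h
    · obtain ⟨g, rfl⟩ := Nat.exists_eq_add_of_lt h
      rw [quarticSym_add_of_gt (n := n) (δ := 2 * δ) (G := 2 ^ g * (2 * n + 1)) (k := 2 ^ (2 * k + 1))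
        (e := k + g + 1 + k) (j := 0) hy hrel hv (by rw [hv]; ring) (by rw [hd]; ring) hnd
        (dvd_mul_left _ _) (hδpow g) ?_ hX hY]
      · apply iPow_congr
        rw [Int.modEq_iff_dvd]
        obtain ⟨t, ht⟩ : ∃ t, n = 2 * t - (2 ^ k) ^ 2 := by
          refine ⟨x * (2 * n + 1) - 2 * (2 ^ k * 2 ^ g) ^ 2 * (2 * n + 1) ^ 2 + 16 * Q * m +
            2 * Q + 2 * m - (2 ^ k) ^ 2 * (8 * δ ^ 2 + 4 * δ), ?_⟩
          apply mul_left_cancel₀ (two_ne_zero (α := ℤ))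
          linear_combination hfac'
        refine ⟨2 ^ g * (t * (2 * n + 1) - (2 ^ k) ^ 2 * (n - 2 * δ) -
          (k + g + 2) * (2 ^ k) ^ 2 * (4 * δ + 1)), ?_⟩
        rw [hd]
        push_cast
        linear_combination 2 * 2 ^ g * (2 * n + 1) * ht
      · apply mul_left_cancel₀ (hpow (2 * (k + g + 1)))
        linear_combination hN
    -- For k = s the identity `hfac'` forces n to be even, so the odd part 2n+1 has the form 4l+1.
    · have hl : n = 2 * (-2 ^ (2 * k) * (2 * n ^ 2 + 2 * n) - 2 ^ (2 * k) + x * (2 * n + 1) +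
          16 * Q * m + 2 * Q + 2 * m - 2 ^ (2 * k) * (8 * δ ^ 2 + 4 * δ)) := by
        rw [mul_pow, ← pow_mul, mul_comm k 2] at hfac'
        linarith only [hfac']
      generalize (-2 ^ (2 * k) * (2 * n ^ 2 + 2 * n) - 2 ^ (2 * k) + x * (2 * n + 1) +
          16 * Q * m + 2 * Q + 2 * m - 2 ^ (2 * k) * (8 * δ ^ 2 + 4 * δ)) = l at hl
      subst hl
      exact quarticSym_add_of_eq (n := l) hy hrel (by rw [hv]; ring) (by rw [hd]; ring)
        (by convert hnd using 1; ring) hX hY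
    · obtain ⟨g, rfl⟩ := Nat.exists_eq_add_of_lt h
      exact quarticSym_add_of_lt (n := n) (G := 2 ^ g * (4 * δ + 1)) hy hrel hv
        (by rw [hd]; ring) hnd hX hY
  -- Here x+c has valuation 2e+1, always larger than the valuation e of d.
  · obtain ⟨k, rfl⟩ := Nat.exists_eq_add_of_lt hes
    rw [quarticSym_add_of_gt (n := n) (δ := 2 * δ) (G := 2 ^ e * (2 * n + 1)) (k := 1)
        (e := e) (j := 2 * k + 1) hy hrel hv (by rw [hv]; ring) (by rw [hd]; ring) hnd (dvd_mul_left _ _)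
        (hδpow e) ?_ hX hY]
    · apply iPow_congr
      rw [Int.modEq_iff_dvd, hd]
      obtain ⟨w, hw⟩ : ∃ w : ℤ, 2 ^ e * (e : ℤ) = 2 * w := by
        rcases Nat.eq_zero_or_pos e with rfl | h
        · exact ⟨0, by simp⟩
        · obtain ⟨l, rfl⟩ : ∃ l, e = l + 1 := ⟨e - 1, by omega⟩
          exact ⟨2 ^ l * (l + 1), by push_cast; ring⟩
      refine ⟨-w * (4 * δ + 1) + 2 ^ e * ((4 * δ + 1) * (-k - 1 - k * n) - 2 * n * δ + n ^ 2), ?_⟩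
      push_cast
      linear_combination (-2) * (4 * δ + 1) * hw
    · apply mul_left_cancel₀ (hpow (2 * e + 1))
      linear_combination hN

/-! ### From symbols to congruences modulo p and q. -/

lemma map_iPow {K : Type*} [Field K] (f : GaussianInt →+* K) (k : ℤ) :
    f (iPow k) = f ⟨0, 1⟩ ^ k := by
  have h := congrArg Units.val (map_zpow (Units.map (f : GaussianInt →* K)) iUnit k)
  rwa [Units.coe_map, Units.val_zpow_eq_zpow_val] at h

lemma isCoprime_of_sq_lt {p : ℕ} (hp : p.Prime) {z : ℤ} (hz : z ≠ 0) (h : z ^ 2 < p) :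
    IsCoprime z p := by
  refine ((Nat.prime_iff_prime_int.1 hp).coprime_iff_not_dvd.2 fun hd => hz ?_).symm
  refine Int.eq_zero_of_abs_lt_dvd hd ?_
  rw [← sq_abs] at h
  nlinarith [abs_nonneg z, Int.one_le_abs hz]

lemma exists_quarticSym_intCast_eq_iPow {n A B : ℤ} (hn : Odd n) (h : IsCoprime n (A ^ 2 + B ^ 2)) :
    ∃ k, quarticSym (n : GaussianInt) ⟨A, B⟩ = iPow k := by
  apply exists_quarticSym_eq_iPow (odd_norm_intCast.2 hn)
  have h1 := isCoprime_intCast h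
  have h2 : ((A ^ 2 + B ^ 2 : ℤ) : GaussianInt) = ⟨A, B⟩ * star ⟨A, B⟩ := by
    rw [← Zsqrtd.norm_eq_mul_conj, norm_mk]; push_cast; ring
  rw [h2] at h1
  exact h1.of_mul_right_left

/-- The power of `-q` modulo `p` in terms of quartic symbols. -/
lemma neg_pow_eq_map_iPow {p q : ℕ} [Fact p.Prime] {c d x y₀ X Y : ℤ} {s : ℕ} {f : GaussianInt →+* ZMod p}
    (hf : f ⟨4 * c + 1, 4 * d⟩ = 0) (hp : (p : ℤ) = (4 * c + 1) ^ 2 + (4 * d) ^ 2)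
    (hpx : (p : ℤ) = (4 * x + 1) ^ 2 + 2 * q * (2 * (2 ^ s * y₀)) ^ 2) (hy : Odd y₀)
    (hcop : IsCoprime (4 * c + 1) (4 * d))
    (hX : quarticSym ((4 * x + 1 : ℤ) : GaussianInt) ⟨4 * c + 1, 4 * d⟩ = iPow X)
    (hY : quarticSym (y₀ : GaussianInt) ⟨4 * c + 1, 4 * d⟩ = iPow Y) :
    (-(q : ZMod p)) ^ ((p - 1) / 8) = f (iPow (X - Y - 2 * (s + 1) * d - 2 * c - d)) := by
  set π : GaussianInt := ⟨4 * c + 1, 4 * d⟩ with hπ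
  have hπ' : π = ⟨2 * (2 * c) + 1, 2 * (2 * d)⟩ := by rw [hπ]; congr 1 <;> ring
  have hodd : Odd π.norm := by rw [hπ']; exact odd_norm_mk (odd_two_mul_add_one _)
  have hN : π.norm = p := by rw [hp, hπ, norm_mk]; ring
  have hprime : Prime π := prime_of_norm_prime Fact.out hN
  obtain ⟨M, hM, hM8⟩ : ∃ M : ℕ, (M : ℤ) = 2 * c ^ 2 + c + 2 * d ^ 2 ∧ p = 8 * M + 1 := by
    have h0 : 0 ≤ 2 * c ^ 2 + c + 2 * d ^ 2 := by
      rcases le_or_gt 0 c with h | h <;> nlinarith [sq_nonneg d]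
    refine ⟨(2 * c ^ 2 + c + 2 * d ^ 2).toNat, Int.toNat_of_nonneg h0, ?_⟩
    zify
    rw [Int.toNat_of_nonneg h0, hp]; ring
  have hpow : ∀ β, f β ^ (2 * M) = f (quarticSym π β) := by
    intro β
    rw [quarticSym_of_prime hprime, ← map_pow_eq_map_primeSym hprime hodd hf, map_pow, hN]
    congr 1; omega
  have hx : quarticSym π ((4 * x + 1 : ℤ) : GaussianInt) = iPow X := by
    rw [quarticSym_reciprocity hodd (hπ' ▸ even_two_mul (2 * d)) (by omega), hX]
  have hyY : quarticSym π (y₀ : GaussianInt) = iPow Y := by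
    rw [hπ', quarticSym_mk_intCast _ _ hy, ← hπ', hY, ← iPow_add, iPow_eq_iff]
    obtain ⟨w, rfl⟩ := hy
    push_cast
    linear_combination (w * d : ZMod 4) * zmod_four_eq_zero
  have h2 : quarticSym π 2 = iPow ((2 * (2 * c) + 1) * (2 * d)) := by
    rw [hπ']
    apply quarticSym_mk_two
    convert hcop using 1 <;> ring
  have hi : quarticSym π ⟨1, -1⟩ = iPow (-c - d) := quarticSym_one_sub_i_of_mod_four c d hcop
  -- As (1-i)²·i = 2, the number -2qy² is -iq times a square. The M-th power, with p = 8M+1,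
  -- therefore turns both squares into quartic symbols, leaving (-q)^M.
  have key : (⟨1, -1⟩ * (2 ^ (s + 1) * (y₀ : GaussianInt))) ^ 2 * (iPow 1 * -(q : GaussianInt)) =
      ((4 * x + 1 : ℤ) : GaussianInt) ^ 2 - p := by
    have hi2 : (⟨1, -1⟩ : GaussianInt) ^ 2 * iPow 1 = 2 := by rw [iPow_one]; decide
    have hpx' := congrArg (Int.cast : ℤ → GaussianInt) hpx
    push_cast at hpx' ⊢
    linear_combination hpx' - (2 ^ (s + 1) * (y₀ : GaussianInt)) ^ 2 * q * hi2
  have key2 : f ⟨1, -1⟩ ^ (2 * M) * ((f 2 ^ (2 * M)) ^ (s + 1) * f y₀ ^ (2 * M)) *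
      (f (iPow 1) ^ M * (-(q : ZMod p)) ^ M) = f ((4 * x + 1 : ℤ) : GaussianInt) ^ (2 * M) := by
    have := congrArg (fun z => f z ^ M) key
    simp only [map_mul f, map_pow f, map_sub f, map_natCast, CharP.cast_eq_zero, sub_zero,
      map_neg] at this
    rw [pow_mul (f ((4 * x + 1 : ℤ) : GaussianInt)) 2 M, ← this]
    ring
  rw [hpow, hpow, hpow, hpow, hi, h2, hyY, hx, ← map_pow, ← map_pow, ← iPow_mul, ← iPow_mul,
    ← map_mul, ← map_mul, ← mul_assoc, ← map_mul, ← iPow_add, ← iPow_add, ← iPow_add] at key2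
  rw [show (p - 1) / 8 = M by omega]
  apply mul_left_cancel₀ (((isUnit_iPow _).map f).ne_zero)
  rw [key2, ← map_mul, ← iPow_add]
  congr 1
  rw [iPow_eq_iff, hM]
  push_cast
  have aux : ∀ c d : ZMod 4, 2 * (c ^ 2 - c) + 2 * (d ^ 2 - d) = 0 := by decide
  linear_combination -aux c d - 2 * c * d * (s + 1) * zmod_four_eq_zero

/-- The power of `π / star π` modulo `q` in terms of a quartic symbol modulo `q`. -/
lemma exists_div_pow_eq_map_iPow {q : ℕ} [Fact q.Prime] {a b c d x j T Q : ℤ} {α z : GaussianInt}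
    (hQ : (q : ℤ) = 8 * Q + 1) (hqab : (q : ℤ) = a ^ 2 + b ^ 2) (hx : (q : ℤ) ∣ x ^ 2 - (c ^ 2 + d ^ 2))
    (hxq : ¬ (q : ℤ) ∣ x) (hα : α * x = iPow j * ⟨c, d⟩ * star α + q * z)
    (hT : quarticSym ((8 * Q + 1 : ℤ) : GaussianInt) α = iPow (T + j * (2 * Q))) (m : ℤ) :
    (((a * c + b * d : ℤ) : ZMod q) / ((a * c - b * d : ℤ) : ZMod q)) ^ ((q - 1) / 8) =
        ((b : ZMod q) / (a : ZMod q)) ^ m ↔ iPow T = iPow m := by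
  set ϖ : GaussianInt := ⟨a, b⟩ with hϖ
  have hN : ϖ.norm = q := by rw [hqab, hϖ, norm_mk]; ring
  have hodd : Odd ϖ.norm := odd_norm_of_eq hN ⟨4 * Q.toNat, by omega⟩
  have hprime : Prime ϖ := prime_of_norm_prime Fact.out hN
  obtain ⟨M, rfl⟩ : ∃ M : ℕ, Q = M := ⟨Q.toNat, by omega⟩
  have hM8 : q = 8 * M + 1 := by exact_mod_cast hQ
  obtain ⟨ha, g, hgi, hg⟩ := exists_hom_zmod hN
  change (a : ZMod q) ≠ 0 at ha
  change g ⟨0, 1⟩ = (b : ZMod q) / a at hgi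
  have hgim : ∀ C D : ℤ, g ⟨C, D⟩ = C + D * (b / a : ZMod q) := by
    intro C D
    rw [← hgi, show (⟨C, D⟩ : GaussianInt) = (C : GaussianInt) + (D : GaussianInt) * ⟨0, 1⟩ by
      ext <;> simp, map_add, map_mul, map_intCast, map_intCast]
  have hpow : ∀ β, g β ^ (2 * M) = g (primeSym ϖ β) := by
    intro β
    rw [← map_pow_eq_map_primeSym hprime hodd hg, map_pow, hN]
    congr 1; omega
  have hqϖ : ((8 * (M : ℤ) + 1 : ℤ) : GaussianInt) = ϖ * star ϖ := by
    rw [← hQ, ← hN, Zsqrtd.norm_eq_mul_conj]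
  have hodd' : Odd (star ϖ).norm := by rwa [natAbs_norm_star]
  -- The symbol modulo q = ϖϖ̄ is χ_ϖ(α) times the conjugate of χ_ϖ(ᾱ), that is χ_ϖ(α)/χ_ϖ(ᾱ) =
  -- i^(A-B).
  rw [hqϖ, quarticSym_prime_mul hprime hodd', quarticSym_of_prime (prime_star hprime),
    ← star_star α, primeSym_star hprime hodd, star_star] at hT
  obtain ⟨A, hA, -⟩ := primeSym_spec hprime hodd (β := α) fun h => iPow_ne_zero _ (by
    rw [← hT, primeSym_eq_zero hprime hodd h, zero_mul])
  obtain ⟨B, hB, -⟩ := primeSym_spec hprime hodd (β := star α) fun h => iPow_ne_zero _ (by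
    rw [← hT, primeSym_eq_zero hprime hodd h, star_zero, mul_zero])
  rw [hA, hB, star_iPow, ← iPow_add, iPow_eq_iff] at hT
  have hx0 : (x : ZMod q) ≠ 0 := fun h => hxq ((ZMod.intCast_zmod_eq_zero_iff_dvd _ _).1 h)
  have hx2 : (x : ZMod q) ^ 2 = c ^ 2 + d ^ 2 := by
    have := (ZMod.intCast_zmod_eq_zero_iff_dvd _ q).2 hx
    push_cast at this
    exact sub_eq_zero.1 this
  have hba : (a : ZMod q) ^ 2 + b ^ 2 = 0 := by
    have := congrArg (Int.cast : ℤ → ZMod q) hqab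
    push_cast at this
    rw [← this, CharP.cast_eq_zero]
  -- Under i ↦ b/a the quotient is g(π)/g(π̄), while g(π)g(π̄) = x²; hence it equals (g(π)/x)².
  have hR : ((a * c + b * d : ℤ) : ZMod q) / ((a * c - b * d : ℤ) : ZMod q) * x ^ 2 =
      g ⟨c, d⟩ ^ 2 := by
    rw [hgim]
    push_cast
    obtain ⟨t, ht⟩ : ∃ t : ZMod q, (b : ZMod q) = a * t := ⟨b / a, by field_simp⟩
    have ht2 : t ^ 2 = -1 := by
      apply mul_left_cancel₀ (pow_ne_zero 2 ha)
      rw [ht] at hba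
      linear_combination hba
    have hprod : ((c : ZMod q) + d * t) * (c - d * t) = x ^ 2 := by
      rw [hx2]; linear_combination -(d : ZMod q) ^ 2 * ht2
    have hne : (c : ZMod q) - d * t ≠ 0 := by
      intro h
      rw [h, mul_zero] at hprod
      exact hx0 (pow_eq_zero_iff two_ne_zero |>.1 hprod.symm)
    rw [ht, mul_div_cancel_left₀ _ ha, ← hprod, show (a : ZMod q) * c + a * t * d =
      a * (c + d * t) by ring, show (a : ZMod q) * c - a * t * d = a * (c - d * t) by ring,
      mul_div_mul_left _ _ ha]
    field_simp
  have key := congrArg (fun z => g z ^ (2 * M)) hα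
  simp only [map_mul g, map_add g, map_natCast, map_intCast, CharP.cast_eq_zero, zero_mul, add_zero,
    mul_pow, hpow α, hpow (star α), hA, hB] at key
  rw [pow_mul (g ⟨c, d⟩) 2 M, ← hR, mul_pow, ← pow_mul, ← map_pow, ← iPow_mul] at key
  rw [show (q - 1) / 8 = M by omega, ← hgi, ← map_iPow]
  have hRT : (((a * c + b * d : ℤ) : ZMod q) / ((a * c - b * d : ℤ) : ZMod q)) ^ M =
      g (iPow T) := by
    apply mul_left_cancel₀ (((isUnit_iPow (j * (2 * M : ℕ) + B)).map g).ne_zero)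
    apply mul_right_cancel₀ (pow_ne_zero (2 * M) hx0)
    rw [← map_mul, ← iPow_add, show iPow (j * (2 * M : ℕ) + B + T) = iPow A by
      rw [iPow_eq_iff]
      push_cast at hT ⊢
      linear_combination -hT, key, iPow_add, map_mul]
    ring
  rw [hRT]
  exact ⟨map_iPow_injective hprime hodd hg T m, congrArg g⟩

lemma quarticSym_intCast_star {n : ℤ} (hn : Odd n) {A B k : ℤ}
    (h : quarticSym (n : GaussianInt) ⟨A, B⟩ = iPow k) :
    quarticSym (n : GaussianInt) ⟨A, -B⟩ = iPow (-k) := by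
  have h1 := quarticSym_star (odd_norm_intCast.2 hn) ⟨A, B⟩
  rw [h, star_iPow, star_intCast] at h1
  exact h1

/-- There is a Gaussian integer `α` with `α x ≡ i ^ j π (star α)` modulo `q` whose symbol modulo `q`
is known. -/
lemma exists_quarticSym_eq {c d x ξ Q y₀ X Y δ : ℤ} {s e : ℕ} (hy : Odd y₀)
    (hrel : 2 * c ^ 2 + c + 2 * d ^ 2 = 2 * ξ ^ 2 + ξ + (8 * Q + 1) * (2 ^ s * y₀) ^ 2)
    (hx : x = 4 * ξ + 1 ∨ x = -(4 * ξ + 1)) (hd : d = 2 ^ e * (4 * δ + 1))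
    (hcop : IsCoprime (4 * c + 1) (x + 4 * d) ∨ IsCoprime (4 * δ + 1) (x + (4 * c + 1)))
    (hX : quarticSym ((4 * ξ + 1 : ℤ) : GaussianInt) ⟨4 * c + 1, 4 * d⟩ = iPow X)
    (hY : quarticSym (y₀ : GaussianInt) ⟨4 * c + 1, 4 * d⟩ = iPow Y) :
    ∃ (j : ℤ) (α z : GaussianInt),
      α * x = iPow j * ⟨4 * c + 1, 4 * d⟩ * star α + ((8 * Q + 1 : ℤ) : GaussianInt) * z ∧
      quarticSym ((8 * Q + 1 : ℤ) : GaussianInt) α =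
        iPow (X - Y - 2 * (s + 1) * d - 2 * ξ + d + j * (2 * Q)) := by
  have hqo : Odd (8 * Q + 1) := ⟨4 * Q, by ring⟩
  have hx2 : x ^ 2 = (4 * ξ + 1) ^ 2 := by rcases hx with rfl | rfl <;> ring
  rcases hcop with hcop | hcop
  -- The choice α = π + ix: iπᾱ = πx + iππ̄, and ππ̄ ≡ x² modulo q. The witness z records p - x² =
  -- 2qy².
  · refine ⟨1, ⟨4 * c + 1, x + 4 * d⟩, ⟨0, -8 * (2 ^ s * y₀) ^ 2⟩, ?_, ?_⟩
    · ext
      · rw [iPow_one]; simp; ring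
      · rw [iPow_one]; simp
        linear_combination hx2 - 8 * hrel
    · rcases hx with rfl | rfl
      · rw [quarticSym_add_i_mul hy hrel hcop hX hY, one_mul]
      -- For x ≡ 3 modulo 4, conjugation replaces (d, x) by (-d, -x) and inverts every symbol, so
      -- the previous case applies.
      · have h1 := quarticSym_add_i_mul (c := c) (d := -d) (x := ξ) (Q := Q) (s := s) hy (by rw [neg_sq, hrel])
          (by rw [show 4 * ξ + 1 + 4 * -d = -(-(4 * ξ + 1) + 4 * d) by ring]; exact hcop.neg_right)
          (by rw [mul_neg]; exact quarticSym_intCast_star ⟨2 * ξ, by ring⟩ hX)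
          (by rw [mul_neg]; exact quarticSym_intCast_star hy hY)
        have h2 := quarticSym_intCast_star hqo h1
        rw [show -(4 * ξ + 1) + 4 * d = -(4 * ξ + 1 + 4 * -d) by ring, h2, iPow_eq_iff]
        push_cast
        linear_combination (ξ - Q : ZMod 4) * zmod_four_eq_zero
  -- The choice α = π + x. Conjugation does not change the sign of x here, and for x ≡ 3 modulo 4
  -- the sum x+c is divisible by 4, so that class needs its own 2-adic analysis.
  · refine ⟨0, ⟨x + (4 * c + 1), 4 * d⟩, ⟨-8 * (2 ^ s * y₀) ^ 2, 0⟩, ?_, ?_⟩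
    · rw [iPow_zero, one_mul]
      ext
      · simp
        linear_combination hx2 - 8 * hrel
      · simp; ring
    · rw [zero_mul, add_zero]
      rcases hx with rfl | rfl
      · refine quarticSym_add_of_mod_four_eq_one hy hrel ?_ hX hY
        rw [show 4 * ξ + 1 + (4 * c + 1) = 2 * (2 * (ξ + c) + 1) by ring] at hcop
        rw [hd]
        exact IsCoprime.mul_right (IsCoprime.pow_right ⟨1, -(ξ + c), by ring⟩)
          hcop.of_mul_right_right.symm
      · have h1 := quarticSym_add_of_mod_four_eq_three (x := -ξ) (c := c) (Q := Q) (s := s) hy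
          (by linear_combination hrel) hd ?_
          (by rw [← hX]; congr 2; ring) hY
        · rw [show -(4 * ξ + 1) = 4 * -ξ - 1 by ring, h1, iPow_eq_iff]
          push_cast
          linear_combination (ξ : ZMod 4) * zmod_four_eq_zero
        · rw [show -(4 * ξ + 1) + (4 * c + 1) = 4 * (-ξ + c) by ring] at hcop
          exact hcop.of_mul_right_right

end QuarticSymbol

/-! ### Assembly of the theorem. -/

open QuarticSymbol in
/-- All congruences of quotients are equations in the fields `ZMod p` and `ZMod q`, where every
denominator is nonzero under the hypotheses; the hypotheses also give `4 ∣ d` and `2 ∣ y`, so that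
the divisions in the exponent of `-1` are exact. -/
theorem theorem4p6 (p q : ℕ) [Fact p.Prime] [Fact q.Prime] (hpq : p ≠ q)
    (hp8 : p ≡ 1 [MOD 8]) (hq8 : q ≡ 1 [MOD 8])
    (a b c d x y d₀ : ℤ) (r : ℕ)
    (hpcd : (p : ℤ) = c ^ 2 + d ^ 2) (hpxy : (p : ℤ) = x ^ 2 + 2 * (q : ℤ) * y ^ 2)
    (hqab : (q : ℤ) = a ^ 2 + b ^ 2)
    (hc : c ≡ 1 [ZMOD 4]) (hd : d = 2 ^ r * d₀) (hd₀ : d₀ ≡ 1 [ZMOD 4])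
    (hgcd : Int.gcd c (x + d) = 1 ∨ Int.gcd d₀ (x + c) = 1) (m : ℤ) :
    (-(q : ZMod p)) ^ ((p - 1) / 8) =
        (-1 : ZMod p) ^ (d / 4 + y / 2) * ((d : ZMod p) / (c : ZMod p)) ^ m ↔
      (((a * c + b * d : ℤ) : ZMod q) / ((a * c - b * d : ℤ) : ZMod q)) ^ ((q - 1) / 8) =
        ((b : ZMod q) / (a : ZMod q)) ^ m := by
  have hp : p.Prime := Fact.out
  have hq : q.Prime := Fact.out
  have hpZ : Prime (p : ℤ) := Nat.prime_iff_prime_int.1 hp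
  obtain ⟨P, hP⟩ : ∃ P : ℤ, (p : ℤ) = 8 * P + 1 := ⟨p / 8, by have : p % 8 = 1 := hp8; omega⟩
  obtain ⟨Q, hQ⟩ : ∃ Q : ℤ, (q : ℤ) = 8 * Q + 1 := ⟨q / 8, by have : q % 8 = 1 := hq8; omega⟩
  obtain ⟨c, rfl⟩ : ∃ c', c = 4 * c' + 1 := ⟨c / 4, by rw [Int.ModEq] at hc; omega⟩
  obtain ⟨δ, rfl⟩ : ∃ δ, d₀ = 4 * δ + 1 := ⟨d₀ / 4, by rw [Int.ModEq] at hd₀; omega⟩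
  have hδ0 : 4 * δ + 1 ≠ 0 := by omega
  have hd0 : d ≠ 0 := by rw [hd]; positivity
  have hy0 : y ≠ 0 := by
    rintro rfl
    exact hpZ.irreducible.not_isSquare ⟨x, by rw [hpxy]; ring⟩
  -- Since c² ≡ 1 modulo 8, the values r = 0 and r = 1 contradict p ≡ 1 modulo 8.
  have hr : 2 ≤ r := by
    by_contra! h
    rw [hd, hP] at hpcd
    interval_cases r
    · have : 8 * (P - 2 * c ^ 2 - c - 2 * δ ^ 2 - δ) = 1 := by linear_combination hpcd
      omega
    · have : 8 * (P - 2 * c ^ 2 - c - 8 * δ ^ 2 - 4 * δ) = 4 := by linear_combination hpcd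
      omega
  obtain ⟨e, rfl⟩ : ∃ e, r = e + 2 := ⟨r - 2, by omega⟩
  obtain ⟨d, rfl⟩ : ∃ d', d = 4 * d' := ⟨2 ^ e * (4 * δ + 1), by rw [hd]; ring⟩
  replace hd : d = 2 ^ e * (4 * δ + 1) := by
    apply mul_left_cancel₀ (show (4 : ℤ) ≠ 0 by norm_num); rw [hd]; ring
  obtain ⟨ξ, hx⟩ : ∃ ξ, x = 4 * ξ + 1 ∨ x = -(4 * ξ + 1) := by
    have : Odd x := by
      by_contra h
      obtain ⟨k, rfl⟩ := Int.not_odd_iff_even.1 h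
      have : 2 * (2 * k ^ 2 + q * y ^ 2 - 4 * P) = 1 := by linear_combination hP - hpxy
      omega
    rcases exists_eq_sign_mul_odd this with h | h
    · exact ⟨x / 4, .inl (by omega)⟩
    · exact ⟨-x / 4, .inr (by omega)⟩
  have hx2 : x ^ 2 = (4 * ξ + 1) ^ 2 := by rcases hx with rfl | rfl <;> ring
  -- Odd y would give x² + 2qy² ≡ 3 modulo 8.
  obtain ⟨u, rfl⟩ : ∃ u, y = 2 * u := by
    obtain ⟨k, rfl | rfl⟩ := Int.even_or_odd' y
    · exact ⟨k, rfl⟩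
    have : 8 * (P - 2 * ξ ^ 2 - ξ - 2 * Q * (2 * k + 1) ^ 2 - k ^ 2 - k) = 2 := by
      rw [hQ, hP, hx2] at hpxy
      linear_combination hpxy
    omega
  obtain ⟨s, y₀, hu, hy⟩ := exists_eq_two_pow_mul_odd_int (z := u) (by rintro rfl; simp at hy0)
  have hrel : 2 * c ^ 2 + c + 2 * d ^ 2 = 2 * ξ ^ 2 + ξ + (8 * Q + 1) * (2 ^ s * y₀) ^ 2 := by
    apply mul_left_cancel₀ (show (8 : ℤ) ≠ 0 by norm_num)
    rw [hQ] at hpxy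
    rw [← hu]
    linear_combination hpxy + hx2 - hpcd
  have hq0 : (0 : ℤ) < q := by exact_mod_cast hq.pos
  -- Coprimality to p holds by size: c², x² and y² are nonzero and smaller than p.
  have hcp : IsCoprime (4 * c + 1) (p : ℤ) := isCoprime_of_sq_lt hp (by omega) (by
    rw [hpcd]; exact lt_add_of_pos_right _ (by positivity))
  have hcop : IsCoprime (4 * c + 1) (4 * d) := by
    have h1 : IsCoprime (4 * c + 1) (4 * d * (4 * d)) :=
      isCoprime_of_dvd_sub hcp ⟨4 * c + 1, by rw [hpcd]; ring⟩
    exact h1.of_mul_right_left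
  have hξp : IsCoprime (4 * ξ + 1) (p : ℤ) := isCoprime_of_sq_lt hp (by omega) (by
    rw [hpxy, hx2]; exact lt_add_of_pos_right _ (by positivity))
  have hyp : IsCoprime (2 * u) (p : ℤ) := isCoprime_of_sq_lt hp hy0 (by
    have := pow_pos (abs_pos.2 hy0) 2
    rw [sq_abs] at this
    rw [hpxy]; nlinarith [sq_nonneg x])
  have hy0p : IsCoprime y₀ (p : ℤ) := by
    rw [hu] at hyp; exact hyp.of_mul_left_right.of_mul_left_right
  have hxq : ¬ (q : ℤ) ∣ x := by
    intro h
    have : (q : ℤ) ∣ p := by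
      rw [hpxy]
      exact dvd_add (h.trans (dvd_pow_self _ two_ne_zero)) ⟨2 * (2 * u) ^ 2, by ring⟩
    exact hpq ((Nat.prime_dvd_prime_iff_eq hq hp).1 (Int.natCast_dvd_natCast.1 this)).symm
  obtain ⟨X, hX⟩ := exists_quarticSym_intCast_eq_iPow ⟨2 * ξ, by ring⟩ (hpcd ▸ hξp)
  obtain ⟨Y, hY⟩ := exists_quarticSym_intCast_eq_iPow hy (hpcd ▸ hy0p)
  rw [← Int.isCoprime_iff_gcd_eq_one, ← Int.isCoprime_iff_gcd_eq_one] at hgcd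
  obtain ⟨j, α, z, hα, hT⟩ := exists_quarticSym_eq hy hrel hx hd hgcd hX hY
  rw [exists_div_pow_eq_map_iPow hQ hqab (c := 4 * c + 1) (d := 4 * d)
    ⟨-2 * (2 * u) ^ 2, by rw [← hpcd, hpxy]; ring⟩ hxq (by rw [hα, ← hQ, Int.cast_natCast]) hT m]
  have hN : (⟨4 * c + 1, 4 * d⟩ : GaussianInt).norm = p := by rw [hpcd, norm_mk]; ring
  obtain ⟨-, f, hfi, hf⟩ := exists_hom_zmod hN
  have hpo : Odd p := ⟨4 * P.toNat, by omega⟩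
  have hfm : ∀ n : ℤ, ((-1 : ZMod p)) ^ n = f (iPow (2 * n)) := by
    intro n
    rw [map_iPow, zpow_mul, ← map_iPow, iPow_two, map_neg, map_one]
  rw [neg_pow_eq_map_iPow hf hpcd (by rw [hpxy, hx2, hu]) hy hcop hX hY, ← hfi, ← map_iPow,
    Int.mul_ediv_cancel_left _ (by norm_num), Int.mul_ediv_cancel_left _ (by norm_num), hfm,
    ← map_mul, ← iPow_add]
  -- The two exponents differ by 2ξ - 2c - 2d, up to multiples of 4. This parity turns the
  -- difference into 2(d+u), which is the sign (-1)^(d/4 + y/2) of the theorem.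
  have hpar : (2 : ZMod 4) * c = 2 * ξ + 2 * u := by
    have h := congrArg (Int.cast : ℤ → ZMod 4) hrel
    rw [← hu] at h
    push_cast at h
    have aux : ∀ c d x u Q : ZMod 4, 2 * c ^ 2 + c + 2 * d ^ 2 = 2 * x ^ 2 + x + (8 * Q + 1) * u ^ 2 →
      2 * c = 2 * x + 2 * u := by decide
    exact aux c d ξ u Q h
  have hiff : (f (iPow (X - Y - 2 * (s + 1) * d - 2 * c - d)) = f (iPow (2 * (d + u) + m))) ↔
      iPow (X - Y - 2 * (s + 1) * d - 2 * c - d) = iPow (2 * (d + u) + m) :=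
    ⟨map_iPow_injective (prime_of_norm_prime hp hN) (odd_norm_of_eq hN hpo) hf _ _, congrArg f⟩
  rw [hiff, iPow_eq_iff, iPow_eq_iff]
  push_cast
  constructor <;> intro h
  · linear_combination h + hpar + (d + u) * zmod_four_eq_zero
  · linear_combination h - hpar - (d + u) * zmod_four_eq_zero
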